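/- **Setting.** Let $n\ge 1$, $\theta\ge 0$, and $N=N_1+\dots+N_n$, $M=M_1+\dots+M_n$. $PC([-\theta,0];\mathbb R^k)$ is the set of right-continuous functions $[-\theta,0]\to\mathbb R^k$ with left limits and finitely many discontinuities, $\|\cdot\|$ is the supremum norm (for $V\ge 0$, $\|V(\phi)\|=\sup_{\tau\in[-\theta,0]}V(\phi(\tau))$), and $|\cdot|$ is the Euclidean norm. $x^t(\tau)=x(t+\tau)$ for $\tau\in[-\theta,0]$; $(x^t)^-$ is the same function with its value at $\tau=0$ replaced by the left limit $x^-(t)$. Consider the network $$\dot x_i(t)=f_i(x_1^t,\dots,x_n^t,u_i(t))\ (t\ne t_k),\qquad x_i(t)=g_i((x_1^t)^-,\dots,(x_n^t)^-,u_i^-(t))\ (t=t_k),\qquad i=1,\dots,n,$$ with $x_i(t)\in\mathbb R^{N_i}$, $u_i(t)\in\mathbb R^{M_i}$; the inputs are right-continuous with left limits, solutions are absolutely continuous between impulses and satisfy the differential equation almost everywhere. The maps $f_i$ are Lipschitz on bounded sets, and $t\mapsto f_i(x^t,u_i(t))$ is Lebesgue measurable for every piecewise right-continuous $x$ (with left limits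 and locally finitely many discontinuities) and every input $u$. Put $x=(x_1,\dots,x_n)\in\mathbb R^N$, $u=(u_1,\dots,u_n)\in\mathbb R^M$, $f=(f_1,\dots,f_n)$, $g=(g_1,\dots,g_n)$. *Comparison functions.* $\mathcal K$: continuous strictly increasing $\gamma:\mathbb R_+\to\mathbb R_+$ with $\gamma(0)=0$; $\mathcal K_\infty$: unbounded elements of $\mathcal K$; $\mathcal{KL}$: $\beta:\mathbb R_+^2\to\mathbb R_+$ with $\beta(\cdot,t)\in\mathcal K$ for all $t$ and $\beta(r,\cdot)$ continuous, nonincreasing, with limit $0$ at infinity, for all $r$. *Subsystems.* For each $i$ let $V_i:\mathbb R^{N_i}\to\mathbb R_+$ be continuous, positive definite, radially unbounded, and locally Lipschitz on $\mathbb R^{N_i}\setminus\{0\}$, and an exponential ISS-Lyapunov–Razumikhin function of the $i$-th subsystem with rates $c_i,d_i\in\mathbb R$, $d_i\neq0$, linear gains $\gamma_{ij}\ge0$ ($j=1,\dots,n$) and $\gamma_i^u\in\mathcal K\cup\{0\}$. This means that, for all $\phi=(\phi_1,\dots,\phi_n)\in PC([-\theta,0];\mathbb R^N)$ and $v\in\mathbb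 R^{M_i}$, $$V_i(\phi_i(0))\ge\max\{\max_j\gamma_{ij}\|V_j(\phi_j)\|,\gamma_i^u(|v|)\}\ \Longrightarrow\ D^+V_i(\phi_i(0))\le -c_iV_i(\phi_i(0)),$$ $$V_i(g_i(\phi_1,\dots,\phi_n,v))\le\max\{e^{-d_i}V_i(\phi_i(0)),\ \max_j\gamma_{ij}\|V_j(\phi_j)\|,\ \gamma_i^u(|v|)\}.$$ Here $D^+V_i(\phi_i(0))=\limsup_{h\to0^+}\frac1h\big(V_i(x_i(t+h))-V_i(x_i(t))\big)$, and the condition on it is required for every impulse-free trajectory $x$ of the network on some $[t-\theta,T)$, $T>t$, with $x^t=\phi$, under an input $u$ with $u_i(t)=v$. *Whole network.* $V:\mathbb R^N\to\mathbb R_+$ is an exponential ISS-Lyapunov–Razumikhin function of the network with rates $c,d$ and gains $\gamma_t\in\mathcal K_\infty\cup\{0\}$, $\gamma_u\in\mathcal K\cup\{0\}$ if it is continuous, locally Lipschitz on $\mathbb R^N\setminus\{0\}$, satisfies $\psi_1(|x|)\le V(x)\le\psi_2(|x|)$ for some $\psi_1,\psi_2\in\mathcal K_\infty$, and if, for all $\phi\in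 PC([-\theta,0];\mathbb R^N)$ and $v\in\mathbb R^M$, $V(\phi(0))\ge\max\{\gamma_t(\|V(\phi)\|),\gamma_u(|v|)\}$ implies $D^+V(\phi(0))\le-cV(\phi(0))$ (along all impulse-free trajectories $x$ with $x^t=\phi$, $u(t)=v$) and $V(g(\phi,v))\le e^{-d}V(\phi(0))$. *Impulse times.* Impulse times form a finite, or infinite and unbounded, strictly increasing sequence in $(t_0,\infty)$ without finite accumulation points. With $c:=\min_ic_i$, $d:=\min_id_i$, $\mathcal S[\mu,\lambda]$ is the class of those with $-dN(t,s)-(c-\lambda)(t-s)\le\mu$ for all $t\ge s\ge t_0$, where $N(t,s)$ is the number of impulse times in $(s,t]$. The network is *uniformly ISS over* $\mathcal S[\mu,\lambda]$ if there are $\beta\in\mathcal{KL}$, $\gamma\in\mathcal K_\infty$ such that for every initial time $t_0$, every sequence in $\mathcal S[\mu,\lambda]$, every initial history $x^{t_0}=\xi\in PC([-\theta,0];\mathbb R^N)$ and every input $u$, the solution is unique, exists globally, and satisfies $|x(t)|\le\max\{\beta(\|\xi\|,t-t_0),\gamma(\sup_{[t_0,t]}|u|)\}$ for all $t\ge t_0$.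 **Theorem.** Let $\mu>0$, $\kappa:=\min\{e^{-\mu},e^{-d-\mu}\}$ and $\Gamma(s):=(\max_j\gamma_{1j}s_j,\dots,\max_j\gamma_{nj}s_j)$ for $s\in\mathbb R^n_+$. The following two forms of the small-gain condition are equivalent: (a) $\Gamma(s)\not\ge\kappa s$ for all $s\in\mathbb R^n_+\setminus\{0\}$; (b) there is $s\in\mathbb R^n_+\setminus\{0\}$ with $\Gamma(s)<\kappa s$ in every component. If they hold, then: 1. For every $s$ as in (b), $V(x):=\max_i\frac1{s_i}V_i(x_i)$ is an exponential ISS-Lyapunov–Razumikhin function of the network with rates $c,d$ and gains $$\gamma_t(r)=\max\{e^d,1\}\max_{k,j}\tfrac1{s_k}\gamma_{kj}s_j\,r,\qquad \gamma_u(r)=\max\{e^d,1\}\max_i\tfrac1{s_i}\gamma_i^u(r).$$ Moreover $V$ is locally Lipschitz on all of $\mathbb R^N$ if each $V_i$ is on $\mathbb R^{N_i}$; $\gamma_t\in\mathcal K_\infty$ if some $\gamma_{kj}\ne0$; and $\gamma_u\in\mathcal K_\infty$ if some $\gamma_i^u\in\mathcal K_\infty$. 2. For every $\lambda>0$ the network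 is uniformly ISS over $\mathcal S[\mu,\lambda]$. -/

import Mathlib

open Set Filter Topology MeasureTheory
open scoped NNReal

namespace ImpulsiveNet

/-- Class `K`: continuous, zero at zero, strictly increasing. -/
structure IsClassK (γ : ℝ≥0 → ℝ≥0) : Prop where
  continuous : Continuous γ
  map_zero : γ 0 = 0
  strictMono : StrictMono γ

/-- Class `K∞`: class `K` and unbounded. -/
structure IsClassKInf (γ : ℝ≥0 → ℝ≥0) : Prop extends IsClassK γ where
  unbounded : ¬ BddAbove (range γ)

/-- Class `L`: continuous, (weakly) decreasing, tending to zero at infinity. -/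
structure IsClassL (γ : ℝ≥0 → ℝ≥0) : Prop where
  continuous : Continuous γ
  antitone : Antitone γ
  tendsto_zero : Tendsto γ atTop (𝓝 0)

/-- Class `KL`. -/
structure IsClassKL (β : ℝ≥0 → ℝ≥0 → ℝ≥0) : Prop where
  classK : ∀ t, IsClassK (fun r => β r t)
  classL : ∀ r, IsClassL (β r)

section Histories

variable {E F : Type*} [TopologicalSpace E] [TopologicalSpace F]

/-- `φ : [-θ, 0] → E` is right-continuous, has left limits, and has at most finitely many
discontinuities. All topological notions are those of the interval `[-θ, 0]`, so nothing is
required from outside of it at its end points. -/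
structure IsPC (θ : ℝ≥0) (φ : Icc (-(θ : ℝ)) 0 → E) : Prop where
  right_cont : ∀ τ, ContinuousWithinAt φ (Ici τ) τ
  left_lim : ∀ τ, ∃ l, Tendsto φ (𝓝[<] τ) (𝓝 l)
  finite_disc : {τ | ¬ ContinuousAt φ τ}.Finite

theorem IsPC.comp {θ : ℝ≥0} {φ : Icc (-(θ : ℝ)) 0 → E} (hφ : IsPC θ φ) {p : E → F}
    (hp : Continuous p) : IsPC θ (fun τ => p (φ τ)) where
  right_cont τ := hp.continuousAt.comp_continuousWithinAt (hφ.right_cont τ)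
  left_lim τ := by
    obtain ⟨l, hl⟩ := hφ.left_lim τ
    exact ⟨p l, (hp.tendsto l).comp hl⟩
  finite_disc := hφ.finite_disc.subset fun τ hτ h => hτ (hp.continuousAt.comp h)

theorem isPC_const (θ : ℝ≥0) (e : E) : IsPC θ (fun _ => e) where
  right_cont _ := continuousWithinAt_const
  left_lim _ := ⟨e, tendsto_const_nhds⟩
  finite_disc := by simp [continuousAt_const]

/-- The space `PC([-θ, 0]; E)`. -/
structure PC (θ : ℝ≥0) (E : Type*) [TopologicalSpace E] where
  toFun : Icc (-(θ : ℝ)) 0 → E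
  isPC : IsPC θ toFun

instance (θ : ℝ≥0) : CoeFun (PC θ E) (fun _ => Icc (-(θ : ℝ)) 0 → E) := ⟨PC.toFun⟩

/-- The point `0` of the interval `[-θ, 0]`. -/
def now (θ : ℝ≥0) : Icc (-(θ : ℝ)) 0 := ⟨0, by simp⟩

/-- `x : ℝ → E` is right-continuous and has left limits at all times. -/
structure IsCadlag (x : ℝ → E) : Prop where
  right_cont : ∀ t, ContinuousWithinAt x (Ici t) t
  left_lim : ∀ t, ∃ l, Tendsto x (𝓝[<] t) (𝓝 l)

/-- `x : ℝ → E` is piecewise right-continuous: right-continuous with left limits, and with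
finitely many discontinuities in every bounded interval. -/
structure IsPCPath (x : ℝ → E) : Prop extends IsCadlag x where
  finite_disc : ∀ a b, {t ∈ Icc a b | ¬ ContinuousAt x t}.Finite

variable [Zero E]

open Classical in
/-- The history `x^t`, `x^t(τ) = x(t + τ)` for `τ ∈ [-θ, 0]`. The value `0` is used only if this
function is not in `PC([-θ, 0]; E)`, which never occurs along solutions. -/
noncomputable def hist (θ : ℝ≥0) (x : ℝ → E) (t : ℝ) : PC θ E :=
  if h : IsPC θ (fun τ : Icc (-(θ : ℝ)) 0 => x (t + τ)) then ⟨_, h⟩ else ⟨_, isPC_const θ 0⟩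

open Classical in
/-- The history `(x^t)^-` just before time `t`: it is `x(t + τ)` for `τ ∈ [-θ, 0)`, and the left
limit `x^-(t)` for `τ = 0`. -/
noncomputable def histLeft (θ : ℝ≥0) (x : ℝ → E) (t : ℝ) : PC θ E :=
  if h : IsPC θ (Function.update (fun τ : Icc (-(θ : ℝ)) 0 => x (t + τ)) (now θ)
      (Function.leftLim x t)) then ⟨_, h⟩ else ⟨_, isPC_const θ 0⟩

theorem hist_apply {θ : ℝ≥0} {x : ℝ → E} {t : ℝ}
    (h : IsPC θ (fun τ : Icc (-(θ : ℝ)) 0 => x (t + τ))) (τ : Icc (-(θ : ℝ)) 0) :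
    hist θ x t τ = x (t + τ) := by
  unfold hist
  rw [dif_pos h]

end Histories

/-- `‖V^t(φ)‖ = sup {V(φ(τ)) : τ ∈ [-θ, 0]}`. -/
noncomputable def supV {θ : ℝ≥0} {E : Type*} [TopologicalSpace E] (V : E → ℝ≥0) (φ : PC θ E) :
    ℝ≥0 :=
  ⨆ τ, V (φ τ)

/-- `‖φ‖ = sup {|φ(τ)| : τ ∈ [-θ, 0]}`. -/
noncomputable def supNorm {θ : ℝ≥0} {E : Type*} [NormedAddCommGroup E] (φ : PC θ E) : ℝ≥0 :=
  ⨆ τ, ‖φ τ‖₊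

/-- `‖φ - ψ‖` in `PC([-θ, 0]; E)`. -/
noncomputable def supDist {θ : ℝ≥0} {E : Type*} [NormedAddCommGroup E] (φ ψ : PC θ E) : ℝ≥0 :=
  ⨆ τ, ‖φ τ - ψ τ‖₊

/-- `‖u‖_{[a, b]} = sup {|u(s)| : s ∈ [a, b]}`. -/
noncomputable def supNormOn {E : Type*} [NormedAddCommGroup E] (u : ℝ → E) (a b : ℝ) : ℝ≥0 :=
  sSup ((fun s => ‖u s‖₊) '' Icc a b)

/-- The upper right-hand derivative `limsup_{h → 0+} (v(t + h) - v(t)) / h`, with values in the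
extended reals. -/
noncomputable def upperRightDeriv (v : ℝ → ℝ) (t : ℝ) : EReal :=
  limsup (fun h : ℝ => (((v (t + h) - v t) / h : ℝ) : EReal)) (𝓝[>] 0)

/-! ### Impulse times -/

/-- `I` is the set of members of a finite or unbounded strictly increasing sequence of impulse
times in `(t₀, ∞)` without finite accumulation points. -/
structure IsImpulseTimes (t₀ : ℝ) (I : Set ℝ) : Prop where
  gt_initial : ∀ t ∈ I, t₀ < t
  locally_finite : ∀ t, (I ∩ Iic t).Finite

/-- `N(t, s)`: the number of impulse times in `(s, t]`. -/
noncomputable def impulseCount (I : Set ℝ) (t s : ℝ) : ℕ := (I ∩ Ioc s t).ncard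

/-- The class `S[μ, lam]` of impulse time sequences in `(t₀, ∞)` that satisfy the dwell-time
condition with rates `c` and `d`. -/
def dwellTimeClass (c d μ lam t₀ : ℝ) : Set (Set ℝ) :=
  {I | IsImpulseTimes t₀ I ∧ ∀ s t, t₀ ≤ s → s ≤ t →
    -d * impulseCount I t s - (c - lam) * (t - s) ≤ μ}

/-! ### Impulsive systems with time-delays -/

section Single

variable {θ : ℝ≥0} {X U : Type*} [NormedAddCommGroup X] [NormedSpace ℝ X]
  [NormedAddCommGroup U]

/-- `x` is a solution on `[t₀ - θ, T)` of `x' (t) = f (x^t, u(t))` for `t ∉ I`,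
`x(t) = g ((x^t)^-, u^-(t))` for `t ∈ I`, with initial history `ξ` at time `t₀`. The differential
equation is understood in the sense of Carathéodory (`x` is absolutely continuous between the
impulses and satisfies the equation almost everywhere), in its integrated form. -/
structure IsSolution (f g : PC θ X → U → X) (I : Set ℝ) (t₀ : ℝ) (T : EReal) (ξ : PC θ X)
    (u : ℝ → U) (x : ℝ → X) : Prop where
  initial : ∀ τ : Icc (-(θ : ℝ)) 0, x (t₀ + τ) = ξ τ
  flow : ∀ a b : ℝ, t₀ ≤ a → a ≤ b → (b : EReal) < T → (∀ t ∈ Ioc a b, t ∉ I) →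
    IntervalIntegrable (fun s => f (hist θ x s) (u s)) volume a b ∧
      x b = x a + ∫ s in a..b, f (hist θ x s) (u s)
  jump : ∀ t ∈ I, t₀ < t → (t : EReal) < T →
    (∃ l, Tendsto x (𝓝[<] t) (𝓝 l)) ∧ x t = g (histLeft θ x t) (Function.leftLim u t)

/-- The system is uniformly input-to-state stable over the impulse time sequences in `S t₀`:
for every initial time, sequence, initial history and input there is a global solution,
of which every other solution is a restriction, and it obeys the ISS estimate, in which
`β` and `γ` depend neither on the sequence nor on the initial time. -/
def UniformlyISS (f g : PC θ X → U → X) (S : ℝ → Set (Set ℝ)) : Prop :=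
  ∃ (β : ℝ≥0 → ℝ≥0 → ℝ≥0) (γ : ℝ≥0 → ℝ≥0), IsClassKL β ∧ IsClassKInf γ ∧
    ∀ (t₀ : ℝ), ∀ I ∈ S t₀, ∀ (ξ : PC θ X) (u : ℝ → U), IsCadlag u →
      ∃ x : ℝ → X, IsSolution f g I t₀ ⊤ ξ u x ∧
        (∀ (T : EReal) (y : ℝ → X), IsSolution f g I t₀ T ξ u y →
          ∀ t : ℝ, t₀ ≤ t → (t : EReal) < T → y t = x t) ∧
        ∀ t : ℝ, t₀ ≤ t →
          ‖x t‖₊ ≤ max (β (supNorm ξ) (t - t₀).toNNReal) (γ (supNormOn u t₀ t))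

/-- `V` is an exponential ISS-Lyapunov–Razumikhin function of the system, with rate coefficients
`c`, `d` and gains `γt`, `γu`. The derivative `D⁺V(φ(0))` is taken along the trajectories of
the differential equation (without impulses) that have history `φ` and input value `v` at the
time in question. -/
structure IsExpLyapunovRazumikhin (f g : PC θ X → U → X) (V : X → ℝ≥0) (c d : ℝ)
    (γt γu : ℝ≥0 → ℝ≥0) : Prop where
  continuous : Continuous V
  locallyLipschitz : LocallyLipschitzOn {0}ᶜ V
  bounds : ∃ ψ₁ ψ₂ : ℝ≥0 → ℝ≥0, IsClassKInf ψ₁ ∧ IsClassKInf ψ₂ ∧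
    ∀ x, ψ₁ ‖x‖₊ ≤ V x ∧ V x ≤ ψ₂ ‖x‖₊
  gain_t : IsClassKInf γt ∨ γt = 0
  gain_u : IsClassK γu ∨ γu = 0
  flow : ∀ (φ : PC θ X) (v : U), max (γt (supV V φ)) (γu ‖v‖₊) ≤ V (φ (now θ)) →
    ∀ (t : ℝ) (T : EReal) (u : ℝ → U) (x : ℝ → X), (t : EReal) < T → IsCadlag u → u t = v →
      IsSolution f g ∅ t T φ u x →
      upperRightDeriv (fun s => (V (x s) : ℝ)) t ≤ ((-c * (V (φ (now θ)) : ℝ) : ℝ) : EReal)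
  jump : ∀ (φ : PC θ X) (v : U), max (γt (supV V φ)) (γu ‖v‖₊) ≤ V (φ (now θ)) →
    (V (g φ v) : ℝ) ≤ Real.exp (-d) * V (φ (now θ))

end Single

/-! ### Networks -/

/-- `ℝ^{N₁} × ⋯ × ℝ^{Nₙ}`, with the Euclidean norm of `ℝ^{N₁ + ⋯ + Nₙ}`. -/
abbrev Stacked {n : ℕ} (N : Fin n → ℕ) : Type := PiLp 2 fun i => EuclideanSpace ℝ (Fin (N i))

/-- The right-hand sides of the subsystems: the `i`-th one maps
`PC([-θ, 0]; ℝ^{N₁}) × ⋯ × PC([-θ, 0]; ℝ^{Nₙ}) × ℝ^{Mᵢ}` to `ℝ^{Nᵢ}`. -/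
abbrev SubsystemMaps {n : ℕ} (θ : ℝ≥0) (N M : Fin n → ℕ) : Type :=
  ∀ i : Fin n, (∀ j : Fin n, PC θ (EuclideanSpace ℝ (Fin (N j)))) →
    EuclideanSpace ℝ (Fin (M i)) → EuclideanSpace ℝ (Fin (N i))

section Network

variable {n : ℕ} {θ : ℝ≥0} {N M : Fin n → ℕ}

/-- The component `φⱼ` of `φ = (φ₁, …, φₙ)`. -/
def PC.component (φ : PC θ (Stacked N)) (j : Fin n) : PC θ (EuclideanSpace ℝ (Fin (N j))) :=
  ⟨fun τ => φ τ j, φ.isPC.comp (p := fun x : Stacked N => x j) (by fun_prop)⟩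

/-- The map `(f₁, …, fₙ)` of the whole network. -/
def network (f : SubsystemMaps θ N M) : PC θ (Stacked N) → Stacked M → Stacked N :=
  fun φ u => WithLp.toLp 2 fun i => f i (fun j => φ.component j) (u i)

/-- `F` is Lipschitz on every bounded set. -/
def LipschitzOnBounded {i : Fin n}
    (F : (∀ j, PC θ (EuclideanSpace ℝ (Fin (N j)))) →
      EuclideanSpace ℝ (Fin (M i)) → EuclideanSpace ℝ (Fin (N i))) : Prop :=
  ∀ R : ℝ≥0, ∃ L : ℝ≥0, ∀ φ ψ v w, (∀ j, supNorm (φ j) ≤ R) → (∀ j, supNorm (ψ j) ≤ R) →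
    ‖v‖₊ ≤ R → ‖w‖₊ ≤ R → ‖F φ v - F ψ w‖₊ ≤ L * ((∑ j, supDist (φ j) (ψ j)) + ‖v - w‖₊)

/-- Along all piecewise right-continuous paths and all inputs, `t ↦ F(x₁^t, …, xₙ^t, u(t))` is
Lebesgue measurable. -/
def MeasurableAlongPaths {i : Fin n}
    (F : (∀ j, PC θ (EuclideanSpace ℝ (Fin (N j)))) →
      EuclideanSpace ℝ (Fin (M i)) → EuclideanSpace ℝ (Fin (N i))) : Prop :=
  ∀ (x : ∀ j, ℝ → EuclideanSpace ℝ (Fin (N j))) (u : ℝ → EuclideanSpace ℝ (Fin (M i))),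
    (∀ j, IsPCPath (x j)) → IsCadlag u →
    AEStronglyMeasurable (fun t => F (fun j => hist θ (x j) t) (u t)) volume

/-- The gain operator `Γ(s)ᵢ = maxⱼ γᵢⱼ sⱼ`. -/
def gainOperator (γ : Matrix (Fin n) (Fin n) ℝ≥0) (s : Fin n → ℝ≥0) : Fin n → ℝ≥0 :=
  fun i => Finset.univ.sup fun j => γ i j * s j

/-- `V i` is an exponential ISS-Lyapunov–Razumikhin function of the `i`-th subsystem, with rate
coefficients `c`, `d`, linear gains `γᵢⱼ` and input gain `γu`. Here `V j` are the functions of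
the other subsystems, and `D⁺Vᵢ(φᵢ(0))` is taken along the trajectories of the differential
equation (without impulses) that have history `φ` and `i`-th input value `v` at the time in
question. -/
structure IsSubsystemLyapunovRazumikhin (f g : SubsystemMaps θ N M)
    (V : ∀ i, EuclideanSpace ℝ (Fin (N i)) → ℝ≥0) (i : Fin n) (c d : ℝ) (γ : Fin n → ℝ≥0)
    (γu : ℝ≥0 → ℝ≥0) : Prop where
  continuous : Continuous (V i)
  proper : Tendsto (V i) (Bornology.cobounded _) atTop
  posDef : ∀ x, V i x = 0 ↔ x = 0
  locallyLipschitz : LocallyLipschitzOn {0}ᶜ (V i)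
  gain_u : IsClassK γu ∨ γu = 0
  flow : ∀ (φ : PC θ (Stacked N)) (v : EuclideanSpace ℝ (Fin (M i))),
    max (Finset.univ.sup fun j => γ j * supV (V j) (φ.component j)) (γu ‖v‖₊)
      ≤ V i (φ (now θ) i) →
    ∀ (t : ℝ) (T : EReal) (u : ℝ → Stacked M) (x : ℝ → Stacked N), (t : EReal) < T →
      IsCadlag u → u t i = v → IsSolution (network f) (network g) ∅ t T φ u x →
      upperRightDeriv (fun s => (V i (x s i) : ℝ)) t
        ≤ ((-c * (V i (φ (now θ) i) : ℝ) : ℝ) : EReal)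
  jump : ∀ (φ : PC θ (Stacked N)) (v : EuclideanSpace ℝ (Fin (M i))),
    (V i (g i (fun j => φ.component j) v) : ℝ) ≤
      max (Real.exp (-d) * V i (φ (now θ) i))
        (max (Finset.univ.sup fun j => γ j * supV (V j) (φ.component j)) (γu ‖v‖₊) : ℝ≥0)

/-- `V(x) = maxᵢ Vᵢ(xᵢ) / sᵢ`. -/
noncomputable def networkV (V : ∀ i, EuclideanSpace ℝ (Fin (N i)) → ℝ≥0) (s : Fin n → ℝ≥0)
    (x : Stacked N) : ℝ≥0 :=
  Finset.univ.sup fun i => V i (x i) / s i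

/-- `γ_t(r) = max {e^d, 1} max_{k,j} (γₖⱼ sⱼ / sₖ) r`. -/
noncomputable def networkGainT (γ : Matrix (Fin n) (Fin n) ℝ≥0) (s : Fin n → ℝ≥0) (d : ℝ)
    (r : ℝ≥0) : ℝ≥0 :=
  max (Real.exp d).toNNReal 1 *
    (Finset.univ.sup fun k => Finset.univ.sup fun j => γ k j * s j / s k) * r

/-- `γ_u(r) = max {e^d, 1} maxᵢ γᵢᵘ(r) / sᵢ`. -/
noncomputable def networkGainU (γu : Fin n → ℝ≥0 → ℝ≥0) (s : Fin n → ℝ≥0) (d : ℝ) (r : ℝ≥0) :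
    ℝ≥0 :=
  max (Real.exp d).toNNReal 1 * Finset.univ.sup fun i => γu i r / s i

end Network

/-- `Γ(s) ≱ κ s` for all `s ∈ ℝⁿ₊ ∖ {0}`. -/
def SmallGain {n : ℕ} (γ : Matrix (Fin n) (Fin n) ℝ≥0) (κ : ℝ) : Prop :=
  ∀ s : Fin n → ℝ≥0, s ≠ 0 → ¬ ∀ i, κ * s i ≤ gainOperator γ s i

/-- `s ∈ ℝⁿ₊ ∖ {0}` and `Γ(s) < κ s` (in each component). -/
def IsDecayVector {n : ℕ} (γ : Matrix (Fin n) (Fin n) ℝ≥0) (κ : ℝ) (s : Fin n → ℝ≥0) : Prop :=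
  s ≠ 0 ∧ ∀ i, (gainOperator γ s i : ℝ) < κ * s i

end ImpulsiveNet

open ImpulsiveNet

/-!
The proof treats the network as one system with state in `Stacked N`, whose Lyapunov–Razumikhin
function is `V(x) = maxᵢ Vᵢ(xᵢ) / sᵢ`.

*Small gain.* `Γ` is a monotone, max-linear map. If `Γ(s) < κ s` and `κ r ≤ Γ(r)` with `r ≠ 0`, the
index that maximizes `rᵢ / sᵢ` gives a contradiction (`IsDecayVector.smallGain`). Conversely,
compactness of the unit sphere makes the failure of `κ r ≤ Γ(r)` quantitative, so it persists for
some `κ' < κ`; then the supremum of all `s ≤ max(1, Γ(s) / κ')` exists and is a vector `s` with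
`Γ(s) ≤ κ' s < κ s` (`SmallGain.exists_isDecayVector`).

*Lyapunov inequalities.* At a point only the indices with `Vᵢ(xᵢ) / sᵢ = V(x)` matter for `D⁺V`, and
for these the Razumikhin condition of the network implies that of the subsystem
(`upperRightDeriv_networkV_le`). At impulses the subsystem inequalities yield, without any
condition, `V(g(φ, v)) ≤ max {e^{-d} V(φ(0)), min {1, e^{-d}} max {γ_t(‖V(φ)‖), γ_u(|v|)}}`
(`networkV_jump_le`). Since `Γ(s) < κ s`, the gain `γ_t` has slope less than `e^{-μ}`
(`networkGainCoeff_lt`).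

*Stability.* Along a solution, `w(t) = V(x(t))` is compared with the decreasing envelope
`R(t) = max {e^{-λ'(t - t₀)} sup V(ξ), γ_u(sup |u|)}`, where `λ' ≤ λ` is small. As long as
`w ≤ K R` with `K` slightly larger than `e^μ`, the slope condition makes the Razumikhin condition
true whenever `w ≥ R`. So after the last time `s` at which `w` was below `R`, the function `w`
is at most `e^{-d N(t, s) - c (t - s)} R(s)`, which the dwell-time condition bounds by `e^μ R(t)`;
this is less than `K R(t)`, and the bound propagates (`le_of_razumikhin`).

*Existence and uniqueness.* The delay equation is solved locally by Banach's fixed point theorem, on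
an interval whose length depends only on a bound for the history and the input (`exists_flow`).
The stability estimate holds for every solution on every compact interval, so it is the a priori
bound that turns local solutions into a global one (`exists_unique_isSolution`). All continuation
arguments are instances of one induction principle on a real interval
(`forall_mem_Icc_of_induction`).
-/

namespace ImpulsiveNet

/-! ### Induction on a real interval -/

/-- Induction on `[a, b]`: a property that holds at `a`, spreads from `[a, t]` to the immediate
right of `t`, and passes from `[a, t)` to `t`, holds on all of `[a, b]`. -/
theorem forall_mem_Icc_of_induction {a b : ℝ} {P : ℝ → Prop} (h0 : P a)
    (hr : ∀ t ∈ Ico a b, (∀ s ∈ Icc a t, P s) → ∀ᶠ s in 𝓝[>] t, P s)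
    (hl : ∀ t ∈ Ioc a b, (∀ s ∈ Ico a t, P s) → P t) :
    ∀ t ∈ Icc a b, P t := by
  by_contra! hcon
  obtain ⟨t₁, ht₁, hPt₁⟩ := hcon
  set A : Set ℝ := {t | t ∈ Icc a b ∧ ¬ P t} with hA
  have hAne : A.Nonempty := ⟨t₁, ht₁, hPt₁⟩
  have hAbdd : BddBelow A := ⟨a, fun t ht => ht.1.1⟩
  set c := sInf A with hc
  have hac : a ≤ c := le_csInf hAne fun t ht => ht.1.1
  have hcb : c ≤ b := (csInf_le hAbdd ⟨ht₁, hPt₁⟩).trans ht₁.2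
  have hlt : ∀ s ∈ Ico a c, P s := by
    intro s hs
    by_contra hPs
    exact absurd (csInf_le hAbdd (⟨⟨hs.1, hs.2.le.trans hcb⟩, hPs⟩ : s ∈ A)) (not_le.2 hs.2)
  have hPc : P c := by
    rcases hac.eq_or_lt with h | h
    · rwa [← h]
    · exact hl c ⟨h, hcb⟩ hlt
  have hle : ∀ s ∈ Icc a c, P s := fun s hs =>
    hs.2.eq_or_lt.elim (fun h => h ▸ hPc) fun h => hlt s ⟨hs.1, h⟩
  have hcb' : c < b := by
    refine lt_of_le_of_ne hcb fun h => hPt₁ (hle t₁ ⟨ht₁.1, h ▸ ht₁.2⟩)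
  obtain ⟨e, hce, he⟩ := mem_nhdsGT_iff_exists_Ioo_subset.1 (hr c ⟨hac, hcb'⟩ hle)
  have : e ≤ c := by
    refine le_csInf hAne fun t ht => ?_
    by_contra! hte
    rcases le_or_gt t c with h | h
    · exact ht.2 (hle t ⟨ht.1.1, h⟩)
    · exact ht.2 (he ⟨h, hte⟩)
  exact absurd this (not_le.2 hce)

/-! ### The small-gain condition -/

section SmallGain

variable {n : ℕ} {γ : Matrix (Fin n) (Fin n) ℝ≥0}

theorem gain_mul_le_gainOperator (γ : Matrix (Fin n) (Fin n) ℝ≥0) (s : Fin n → ℝ≥0) (i j : Fin n) :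
    γ i j * s j ≤ gainOperator γ s i :=
  Finset.le_sup (f := fun j => γ i j * s j) (Finset.mem_univ j)

theorem gainOperator_le_iff {s : Fin n → ℝ≥0} {i : Fin n} {a : ℝ≥0} :
    gainOperator γ s i ≤ a ↔ ∀ j, γ i j * s j ≤ a := by
  simp [gainOperator]

theorem gainOperator_mono (γ : Matrix (Fin n) (Fin n) ℝ≥0) {s r : Fin n → ℝ≥0} (h : s ≤ r)
    (i : Fin n) : gainOperator γ s i ≤ gainOperator γ r i :=
  gainOperator_le_iff.2 fun j => (mul_le_mul_right (h j) _).trans (gain_mul_le_gainOperator γ r i j)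

theorem gainOperator_smul (γ : Matrix (Fin n) (Fin n) ℝ≥0) (a : ℝ≥0) (s : Fin n → ℝ≥0)
    (i : Fin n) : gainOperator γ (a • s) i = a * gainOperator γ s i := by
  simp only [gainOperator, Pi.smul_apply, smul_eq_mul, NNReal.mul_finset_sup]
  congr 1; ext j; push_cast; ring

theorem continuous_gainOperator (γ : Matrix (Fin n) (Fin n) ℝ≥0) (i : Fin n) :
    Continuous fun s => gainOperator γ s i := by
  unfold gainOperator
  exact Continuous.finset_sup_apply fun j _ => by fun_prop

theorem IsDecayVector.pos {κ : ℝ} (hκ : 0 < κ) {s : Fin n → ℝ≥0} (hs : IsDecayVector γ κ s)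
    (i : Fin n) : 0 < s i := by
  have h := (NNReal.coe_nonneg _).trans_lt (hs.2 i)
  exact_mod_cast (pos_iff_pos_of_mul_pos h).1 hκ

/-- A vector that `Γ` contracts rules out every `r ≠ 0` with `κ r ≤ Γ(r)`: compare the two at an
index where `rᵢ / sᵢ` is largest. -/
theorem IsDecayVector.smallGain {κ : ℝ} (hκ : 0 < κ) {s : Fin n → ℝ≥0}
    (hs : IsDecayVector γ κ s) : SmallGain γ κ := by
  intro r hr hle
  have hspos := hs.pos hκ
  obtain ⟨i₀, hi₀⟩ := Function.ne_iff.1 hr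
  obtain ⟨i, -, hi⟩ := Finset.exists_max_image Finset.univ (fun i => r i / s i)
    ⟨i₀, Finset.mem_univ _⟩
  have hm : 0 < r i / s i :=
    (div_pos (pos_iff_ne_zero.2 hi₀) (hspos i₀)).trans_le (hi i₀ (Finset.mem_univ _))
  have hrs : r ≤ (r i / s i) • s := fun j => by
    simpa [div_le_iff₀ (hspos j)] using hi j (Finset.mem_univ _)
  have h1 : gainOperator γ r i ≤ (r i / s i) * gainOperator γ s i :=
    (gainOperator_mono γ hrs i).trans_eq (gainOperator_smul γ _ s i)
  have h2 : ((r i / s i : ℝ≥0) : ℝ) * gainOperator γ s i < (r i / s i : ℝ≥0) * (κ * s i) :=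
    mul_lt_mul_of_pos_left (hs.2 i) (by exact_mod_cast hm)
  have h3 : ((r i / s i : ℝ≥0) : ℝ) * s i = r i := by
    rw [← NNReal.coe_mul, div_mul_cancel₀ _ (hspos i).ne']
  have h4 : (gainOperator γ r i : ℝ) ≤ (r i / s i : ℝ≥0) * gainOperator γ s i := by
    exact_mod_cast h1
  have := hle i
  nlinarith

/-- By compactness of the unit sphere, the failure of `κ r ≤ Γ(r)` is quantitative. -/
theorem SmallGain.exists_gap (hn : 0 < n) {κ : ℝ} (h : SmallGain γ κ) :
    ∃ η : ℝ, 0 < η ∧ ∀ s : Fin n → ℝ≥0, s ≠ 0 →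
      ∃ i, gainOperator γ s i + η * (Finset.univ.sup s : ℝ≥0) ≤ κ * s i := by
  have : Nonempty (Fin n) := ⟨⟨0, hn⟩⟩
  let K : Set (Fin n → ℝ≥0) := {s | (∀ i, s i ∈ Icc 0 1) ∧ Finset.univ.sup s = 1}
  have hK : IsCompact K := by
    have hK' : K = Set.univ.pi (fun _ => Icc 0 1) ∩ {s | Finset.univ.sup s = 1} := by
      ext s
      rw [mem_inter_iff, mem_univ_pi]
      rfl
    rw [hK']
    refine (isCompact_univ_pi fun _ => isCompact_Icc).inter_right ?_
    exact isClosed_eq (Continuous.finset_sup_apply fun i _ => continuous_apply i)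
      continuous_const
  let F : (Fin n → ℝ≥0) → ℝ := fun s =>
    Finset.univ.sup' Finset.univ_nonempty fun i => κ * s i - gainOperator γ s i
  have hF : Continuous F := by
    refine Continuous.finset_sup'_apply _ fun i _ => ?_
    have := continuous_gainOperator γ i
    fun_prop
  have hsup_pos : ∀ s : Fin n → ℝ≥0, s ≠ 0 → 0 < Finset.univ.sup s := by
    intro s hs
    obtain ⟨i, hi⟩ := Function.ne_iff.1 hs
    exact (pos_iff_ne_zero.2 hi).trans_le (Finset.le_sup (Finset.mem_univ i))
  have hKne : K.Nonempty := by
    refine ⟨fun _ => 1, fun i => by simp, ?_⟩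
    exact Finset.sup_const Finset.univ_nonempty 1
  obtain ⟨s₀, hs₀, hmin⟩ := hK.exists_isMinOn hKne hF.continuousOn
  have hs₀ne : s₀ ≠ 0 := by
    rintro rfl
    have : Finset.univ.sup (0 : Fin n → ℝ≥0) = 1 := hs₀.2
    have h0 : (Finset.univ.sup (0 : Fin n → ℝ≥0)) = 0 := by
      exact (Finset.sup_eq_bot_iff _ _).2 fun _ _ => rfl
    rw [h0] at this
    exact zero_ne_one this
  refine ⟨F s₀, ?_, ?_⟩
  · have := h s₀ hs₀ne
    push Not at this
    obtain ⟨i, hi⟩ := this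
    exact (sub_pos.2 hi).trans_le
      (Finset.le_sup' (fun i => κ * s₀ i - gainOperator γ s₀ i) (Finset.mem_univ i))
  · intro s hs
    set a := Finset.univ.sup s with ha
    have hapos : 0 < a := hsup_pos s hs
    have hmem : a⁻¹ • s ∈ K := by
      refine ⟨fun i => ⟨zero_le, ?_⟩, ?_⟩
      · have : s i ≤ a := Finset.le_sup (Finset.mem_univ i)
        simp only [Pi.smul_apply, smul_eq_mul]
        rw [inv_mul_le_iff₀ hapos]; simpa using this
      · have : (Finset.univ.sup fun i => a⁻¹ * s i) = a⁻¹ * Finset.univ.sup s :=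
          (NNReal.mul_finset_sup _ _ _).symm
        change (Finset.univ.sup fun i => a⁻¹ * s i) = 1
        rw [this, ← ha, inv_mul_cancel₀ hapos.ne']
    obtain ⟨i, -, hi⟩ := Finset.exists_mem_eq_sup' (Finset.univ_nonempty (α := Fin n))
      (fun i => κ * (a⁻¹ • s) i - gainOperator γ (a⁻¹ • s) i)
    have h1 : F s₀ ≤ F (a⁻¹ • s) := hmin hmem
    have h2 : F (a⁻¹ • s) = κ * (a⁻¹ • s) i - gainOperator γ (a⁻¹ • s) i := hi
    rw [h2, gainOperator_smul] at h1
    refine ⟨i, ?_⟩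
    have hap : (0 : ℝ) < a := by exact_mod_cast hapos
    simp only [Pi.smul_apply, smul_eq_mul, NNReal.coe_mul, NNReal.coe_inv] at h1
    have h3 := mul_le_mul_of_nonneg_right h1 hap.le
    have h4 : (κ * ((a : ℝ)⁻¹ * s i) - (a : ℝ)⁻¹ * gainOperator γ s i) * a
        = κ * s i - gainOperator γ s i := by
      field_simp
    linarith

/-- The small-gain condition provides a vector that `Γ` contracts: the supremum of all
`s ≤ max(1, Γ(s) / κ')`, with `κ'` slightly below `κ`. This set is bounded because of the gap in the
small-gain condition, and the supremum of all sub-solutions is a super-solution. -/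
theorem SmallGain.exists_isDecayVector (hn : 0 < n) {κ : ℝ} (hκ : 0 < κ) (h : SmallGain γ κ) :
    ∃ s, IsDecayVector γ κ s := by
  have : Nonempty (Fin n) := ⟨⟨0, hn⟩⟩
  obtain ⟨η, hη, hgap⟩ := h.exists_gap hn
  obtain ⟨κ', hκ'0, hκ'κ, hκ'η⟩ : ∃ κ' : ℝ≥0, 0 < κ' ∧ (κ' : ℝ) < κ ∧ κ - η < κ' := by
    obtain ⟨x, hx, hxκ⟩ := exists_between (max_lt hκ (sub_lt_self κ hη))
    exact ⟨⟨x, (le_max_left _ _).trans hx.le⟩,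
      NNReal.coe_lt_coe.1 ((le_max_left (0 : ℝ) _).trans_lt hx), hxκ,
      (le_max_right _ _).trans_lt hx⟩
  let T : Set (Fin n → ℝ≥0) := {s | ∀ i, s i ≤ max 1 (gainOperator γ s i / κ')}
  have hTbdd : ∀ s ∈ T, ∀ i, s i ≤ (κ / η).toNNReal := by
    intro s hs j
    rcases eq_or_ne s 0 with rfl | hs0
    · exact zero_le
    set a := Finset.univ.sup s
    have hle : ∀ i, s i ≤ a := fun i => Finset.le_sup (Finset.mem_univ i)
    have ha : 0 < a := by
      obtain ⟨i, hi⟩ := Function.ne_iff.1 hs0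
      exact (pos_iff_ne_zero.2 hi).trans_le (hle i)
    obtain ⟨i, hi⟩ := hgap s hs0
    have hap : (0 : ℝ) < a := by exact_mod_cast ha
    have hia : (s i : ℝ) ≤ a := by exact_mod_cast hle i
    have haκ : (a : ℝ) ≤ κ / η := by
      rw [le_div_iff₀ hη]
      rcases le_max_iff.1 (hs i) with h1 | h1
      · have h1' : (s i : ℝ) ≤ 1 := by exact_mod_cast h1
        have : (0 : ℝ) ≤ gainOperator γ s i := NNReal.coe_nonneg _
        nlinarith
      · -- the gap excludes this case, as `κ - κ' < η`
        rw [le_div_iff₀ hκ'0] at h1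
        have h1' : (s i : ℝ) * κ' ≤ gainOperator γ s i := by exact_mod_cast h1
        nlinarith
    exact (hle j).trans (NNReal.le_toNNReal_of_coe_le haκ)
  have hbdd : ∀ i, BddAbove (range fun s : T => s.1 i) := fun i =>
    ⟨_, by rintro _ ⟨s, rfl⟩; exact hTbdd s.1 s.2 i⟩
  have hone : (1 : Fin n → ℝ≥0) ∈ T := fun i => le_max_left _ _
  have : Nonempty T := ⟨⟨1, hone⟩⟩
  have hstep : ∀ s ∈ T, (fun i => max 1 (gainOperator γ s i / κ')) ∈ T := by
    intro s hs i
    refine max_le_max le_rfl ?_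
    gcongr
    exact gainOperator_mono γ (fun j => hs j) i
  refine ⟨fun i => ⨆ s : T, s.1 i, ?_, fun i => ?_⟩
  · intro h0
    have h1 : (1 : ℝ≥0) ≤ ⨆ s : T, s.1 ⟨0, hn⟩ := le_ciSup (hbdd ⟨0, hn⟩) ⟨1, hone⟩
    rw [congrFun h0 ⟨0, hn⟩] at h1
    exact absurd h1 (not_le.2 one_pos)
  · have h1 : gainOperator γ (fun i => ⨆ s : T, s.1 i) i ≤ κ' * ⨆ s : T, s.1 i := by
      refine gainOperator_le_iff.2 fun j => ?_
      rw [NNReal.mul_iSup]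
      refine ciSup_le fun s => ?_
      rw [← div_le_iff₀' hκ'0]
      refine le_trans ?_ (le_ciSup (hbdd i) ⟨_, hstep s.1 s.2⟩)
      refine le_trans ?_ (le_max_right _ _)
      gcongr
      exact gain_mul_le_gainOperator γ s.1 i j
    have h2 : (0 : ℝ) < (⨆ s : T, s.1 i : ℝ≥0) := by
      have : (1 : ℝ≥0) ≤ ⨆ s : T, s.1 i := le_ciSup (hbdd i) ⟨1, hone⟩
      exact_mod_cast one_pos.trans_le this
    have h1' : (gainOperator γ (fun i => ⨆ s : T, s.1 i) i : ℝ) ≤ κ' * (⨆ s : T, s.1 i : ℝ≥0) := by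
      exact_mod_cast h1
    nlinarith

end SmallGain

/-! ### Comparison functions -/

theorem IsClassKInf.of_tendsto {γ : ℝ≥0 → ℝ≥0} (hc : Continuous γ) (h0 : γ 0 = 0)
    (hm : StrictMono γ) (hu : ∀ C, ∃ r, C ≤ γ r) : IsClassKInf γ where
  continuous := hc
  map_zero := h0
  strictMono := hm
  unbounded := by
    rintro ⟨C, hC⟩
    obtain ⟨r, hr⟩ := hu (C + 1)
    exact absurd (hr.trans (hC ⟨r, rfl⟩)) (not_le.2 (lt_add_one C))

theorem IsClassKInf.exists_le {γ : ℝ≥0 → ℝ≥0} (h : IsClassKInf γ) (C : ℝ≥0) : ∃ r, C ≤ γ r := by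
  by_contra! hcon
  exact h.unbounded ⟨C, by rintro _ ⟨r, rfl⟩; exact (hcon r).le⟩

theorem IsClassKInf.surjective {γ : ℝ≥0 → ℝ≥0} (h : IsClassKInf γ) : Function.Surjective γ :=
  fun C => mem_range_of_exists_le_of_exists_ge h.continuous
    ⟨0, by rw [h.map_zero]; exact zero_le⟩ (h.exists_le C)

/-- The inverse of a class `K∞` function is of class `K∞`. -/
theorem IsClassKInf.exists_inverse {ψ : ℝ≥0 → ℝ≥0} (h : IsClassKInf ψ) :
    ∃ χ, IsClassKInf χ ∧ ∀ a b, ψ a ≤ b → a ≤ χ b := by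
  let e := h.strictMono.orderIsoOfSurjective ψ h.surjective
  have he : ∀ a, e a = ψ a := fun _ => rfl
  refine ⟨e.symm, .of_tendsto e.symm.continuous ?_ e.symm.strictMono fun C => ⟨ψ C, ?_⟩,
    fun a b hab => ?_⟩
  · rw [e.symm_apply_eq, he, h.map_zero]
  · rw [← he, e.symm_apply_apply]
  · rwa [e.le_symm_apply, he]

section Bounds

variable {E : Type*} [NormedAddCommGroup E] [ProperSpace E] {W : E → ℝ≥0}

/-- The upper bound is `r ↦ r + sup {W(x) : |x| ≤ r}`. -/
theorem exists_classKInf_ge [NormedSpace ℝ E] (hW : Continuous W) (h0 : W 0 = 0) :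
    ∃ ψ, IsClassKInf ψ ∧ ∀ x, W x ≤ ψ ‖x‖₊ := by
  let m : ℝ≥0 → ℝ≥0 := fun r => sSup ((fun y => W ((r : ℝ) • y)) '' Metric.closedBall 0 1)
  have hK : IsCompact (Metric.closedBall (0 : E) 1) := isCompact_closedBall 0 1
  have hm : Continuous m := by
    refine hK.continuous_sSup (f := fun r : ℝ≥0 => fun y : E => W ((r : ℝ) • y)) ?_
    change Continuous fun p : ℝ≥0 × E => W ((p.1 : ℝ) • p.2)
    fun_prop
  have hbdd : ∀ r : ℝ≥0, BddAbove ((fun y => W ((r : ℝ) • y)) '' Metric.closedBall 0 1) :=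
    fun r => hK.bddAbove_image (by fun_prop)
  have hle : ∀ x : E, ∀ r : ℝ≥0, ‖x‖₊ ≤ r → W x ≤ m r := by
    intro x r hxr
    rcases eq_or_ne r 0 with rfl | hr
    · have : x = 0 := by simpa using hxr
      rw [this, h0]
      exact zero_le
    · refine le_csSup (hbdd r) ⟨(r : ℝ)⁻¹ • x, ?_, ?_⟩
      · have : ‖x‖ ≤ r := by exact_mod_cast hxr
        rw [mem_closedBall_zero_iff, norm_smul, norm_inv, NNReal.norm_eq, ← div_eq_inv_mul]
        exact div_le_one_of_le₀ this r.2
      · simp [smul_smul, hr]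
  have hmono : Monotone m := by
    intro r r' hrr'
    refine csSup_le ((Metric.nonempty_closedBall.2 zero_le_one).image _) ?_
    rintro _ ⟨y, hy, rfl⟩
    refine hle _ _ (le_trans ?_ hrr')
    rw [mem_closedBall_zero_iff] at hy
    rw [nnnorm_smul, NNReal.nnnorm_eq]
    exact mul_le_of_le_one_right zero_le (by exact_mod_cast hy)
  refine ⟨fun r => m r + r, .of_tendsto (by fun_prop) ?_ ?_ fun C => ⟨C, le_add_self⟩, fun x => ?_⟩
  · have : m 0 = 0 := by
      refine le_antisymm (csSup_le ((Metric.nonempty_closedBall.2 zero_le_one).image _) ?_) zero_le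
      rintro _ ⟨y, hy, rfl⟩
      simp [h0]
    simp [this]
  · exact hmono.add_strictMono strictMono_id
  · exact (hle x _ le_rfl).trans le_self_add

/-- The lower bound is `r / (1 + r) · inf {W(x) + (r - |x|)₊}`; the infimum is a Lipschitz
function of `r`, below `W(x)` at `r = |x|`. -/
theorem exists_classKInf_le (hW : Continuous W) (h0 : ∀ x, W x = 0 ↔ x = 0)
    (hprop : Tendsto W (Bornology.cobounded E) atTop) :
    ∃ ψ, IsClassKInf ψ ∧ ∀ x, ψ ‖x‖₊ ≤ W x := by
  let h : ℝ≥0 → ℝ≥0 := fun r => ⨅ x : E, (W x + (r - ‖x‖₊))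
  have hle : ∀ r x, h r ≤ W x + (r - ‖x‖₊) := fun r x => ciInf_le (OrderBot.bddBelow _) x
  have hmono : Monotone h := fun r r' hrr' => le_ciInf fun x => (hle r x).trans (by gcongr)
  have hlip : ∀ r r', h r ≤ h r' + (r - r') := by
    intro r r'
    rw [← tsub_le_iff_right]
    refine le_ciInf fun x => ?_
    rw [tsub_le_iff_right]
    refine (hle r x).trans ?_
    rw [add_assoc]
    gcongr
    rw [add_comm]
    exact tsub_le_tsub_add_tsub
  have hcont : Continuous h := by
    refine LipschitzWith.continuous (K := 1) (LipschitzWith.of_dist_le_mul fun r r' => ?_)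
    have key : ∀ a b : ℝ≥0, (h a : ℝ) - h b ≤ |(a : ℝ) - b| := by
      intro a b
      have h1 : (h a : ℝ) ≤ h b + (a - b : ℝ≥0) := by exact_mod_cast hlip a b
      rw [NNReal.coe_sub_def] at h1
      have h2 : max ((a : ℝ) - b) 0 ≤ |(a : ℝ) - b| := max_le (le_abs_self _) (abs_nonneg _)
      linarith
    rw [NNReal.dist_eq, NNReal.dist_eq, NNReal.coe_one, one_mul, abs_sub_le_iff]
    exact ⟨key r r', by rw [abs_sub_comm]; exact key r' r⟩
  have hlarge : ∀ C : ℝ≥0, ∃ R : ℝ≥0, ∀ x, R ≤ ‖x‖₊ → C ≤ W x := by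
    intro C
    obtain ⟨R, -, hR⟩ := (Metric.hasBasis_cobounded_compl_closedBall (0 : E)).eventually_iff.1
      (hprop.eventually_ge_atTop C)
    refine ⟨R.toNNReal + 1, fun x hx => hR ?_⟩
    rw [mem_compl_iff, mem_closedBall_zero_iff, not_le]
    have h1 : ((R.toNNReal + 1 : ℝ≥0) : ℝ) ≤ ‖x‖ := by exact_mod_cast hx
    have h2 := Real.le_coe_toNNReal R
    push_cast at h1
    linarith
  have hpos : ∀ r, 0 < r → 0 < h r := by
    intro r hr
    obtain ⟨R, hR⟩ := hlarge 1
    -- `W` is bounded below by some `ε > 0` where `r / 2 ≤ |x|`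
    obtain ⟨ε, hε, hεW⟩ : ∃ ε : ℝ≥0, 0 < ε ∧ ∀ x : E, r / 2 ≤ ‖x‖₊ → ε ≤ W x := by
      let K : Set E := Metric.closedBall 0 R ∩ {x | r / 2 ≤ ‖x‖₊}
      have hK : IsCompact K := (isCompact_closedBall _ _).inter_right
        (isClosed_le continuous_const continuous_nnnorm)
      rcases K.eq_empty_or_nonempty with hKe | hKne
      · refine ⟨1, one_pos, fun x hx => hR x ?_⟩
        by_contra! hlt
        have : x ∈ K := ⟨by rw [mem_closedBall_zero_iff]; exact_mod_cast hlt.le, hx⟩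
        simp [hKe] at this
      · obtain ⟨y, hy, hmin⟩ := hK.exists_isMinOn hKne hW.continuousOn
        have hy0 : 0 < W y := by
          rw [pos_iff_ne_zero, Ne, h0]
          rintro rfl
          have : r / 2 ≤ 0 := by simpa using hy.2
          exact absurd this (not_le.2 (half_pos hr))
        refine ⟨min (W y) 1, lt_min hy0 one_pos, fun x hx => ?_⟩
        rcases le_total R ‖x‖₊ with h1 | h1
        · exact (min_le_right _ _).trans (hR x h1)
        · exact (min_le_left _ _).trans
            (hmin ⟨by rw [mem_closedBall_zero_iff]; exact_mod_cast h1, hx⟩)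
    refine (lt_min hε (half_pos hr)).trans_le (le_ciInf fun x => ?_)
    rcases le_total (r / 2) ‖x‖₊ with h1 | h1
    · exact (min_le_left _ _).trans ((hεW x h1).trans le_self_add)
    · refine (min_le_right _ _).trans (le_add_left ?_)
      rw [le_tsub_iff_right (h1.trans (half_le_self zero_le))]
      calc r / 2 + ‖x‖₊ ≤ r / 2 + r / 2 := by gcongr
        _ = r := add_halves r
  have hlt1 : ∀ r : ℝ≥0, r / (1 + r) ≤ 1 := fun r => div_le_one_of_le₀ le_add_self zero_le
  have hfrac : StrictMono fun r : ℝ≥0 => r / (1 + r) := by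
    intro a b hab
    change a / (1 + a) < b / (1 + b)
    rw [div_lt_div_iff₀ (by positivity) (by positivity)]
    have : a * (1 + b) = a + a * b := by ring
    have h2 : b * (1 + a) = b + a * b := by ring
    rw [this, h2]
    gcongr
  refine ⟨fun r => r / (1 + r) * h r, .of_tendsto ?_ (by simp) ?_ fun C => ?_, fun x => ?_⟩
  · refine Continuous.mul (continuous_id.div₀ (by fun_prop) fun r => by positivity) hcont
  · intro a b hab
    have hb : 0 < b := zero_le.trans_lt hab
    calc a / (1 + a) * h a ≤ a / (1 + a) * h b := by gcongr; exact hmono hab.le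
      _ < b / (1 + b) * h b := mul_lt_mul_of_pos_right (hfrac hab) (hpos b hb)
  · obtain ⟨R, hR⟩ := hlarge (2 * C)
    refine ⟨R + 2 * C + 1, ?_⟩
    have h1 : 2 * C ≤ h (R + 2 * C + 1) := by
      refine le_ciInf fun x => ?_
      rcases le_total R ‖x‖₊ with h1 | h1
      · exact (hR x h1).trans le_self_add
      · refine le_add_left ?_
        calc 2 * C ≤ (R + 2 * C + 1) - R := by
              rw [add_assoc, add_tsub_cancel_left]; exact le_self_add
          _ ≤ _ := tsub_le_tsub_left h1 _
    have h2 : 1 / 2 ≤ (R + 2 * C + 1) / (1 + (R + 2 * C + 1)) := by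
      rw [div_le_div_iff₀ two_pos (by positivity), one_mul, mul_two]
      gcongr
      exact le_add_self
    calc C = 1 / 2 * (2 * C) := by rw [← mul_assoc]; simp
      _ ≤ _ := by gcongr
  · calc ‖x‖₊ / (1 + ‖x‖₊) * h ‖x‖₊ ≤ 1 * (W x + (‖x‖₊ - ‖x‖₊)) := by
          gcongr
          · exact hlt1 _
          · exact hle _ x
      _ = W x := by simp

end Bounds

/-! ### Piecewise right-continuous paths and their histories -/

section Paths

variable {E F : Type*} [TopologicalSpace E] [TopologicalSpace F] {θ : ℝ≥0} {x y : ℝ → E} {t : ℝ}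

theorem IsCadlag.comp (hx : IsCadlag x) {p : E → F} (hp : Continuous p) :
    IsCadlag fun s => p (x s) where
  right_cont s := hp.continuousAt.comp_continuousWithinAt (hx.right_cont s)
  left_lim s := by
    obtain ⟨l, hl⟩ := hx.left_lim s
    exact ⟨p l, (hp.tendsto l).comp hl⟩

theorem IsPCPath.comp (hx : IsPCPath x) {p : E → F} (hp : Continuous p) :
    IsPCPath fun s => p (x s) where
  toIsCadlag := hx.toIsCadlag.comp hp
  finite_disc a b := (hx.finite_disc a b).subset fun _ hτ =>
    ⟨hτ.1, fun h => hτ.2 (hp.continuousAt.comp h)⟩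

theorem _root_.Continuous.isPCPath (hx : Continuous x) : IsPCPath x where
  right_cont _ := hx.continuousWithinAt
  left_lim s := ⟨x s, (hx.tendsto s).mono_left nhdsWithin_le_nhds⟩
  finite_disc a b := by simp [hx.continuousAt]

/-- Switching from one piecewise right-continuous path to another. -/
theorem IsPCPath.ite_lt (hx : IsPCPath x) (hy : IsPCPath y) (a : ℝ) :
    IsPCPath fun s => if s < a then x s else y s := by
  set z : ℝ → E := fun s => if s < a then x s else y s
  have hlt : ∀ s < a, z =ᶠ[𝓝 s] x := fun s hs => by
    filter_upwards [Iio_mem_nhds hs] with r hr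
    exact if_pos hr
  have hgt : ∀ s, a < s → z =ᶠ[𝓝 s] y := fun s hs => by
    filter_upwards [Ioi_mem_nhds hs] with r hr
    exact if_neg (not_lt.2 (le_of_lt hr))
  have hge : ∀ s, a ≤ s → EqOn z y (Ici s) := fun s hs r hr => if_neg (not_lt.2 (hs.trans hr))
  refine ⟨⟨fun s => ?_, fun s => ?_⟩, fun b c => ?_⟩
  · rcases lt_or_ge s a with h | h
    · exact (hx.right_cont s).congr_of_eventuallyEq ((hlt s h).filter_mono nhdsWithin_le_nhds)
        (hlt s h).eq_of_nhds
    · exact (hy.right_cont s).congr (hge s h) (hge s h self_mem_Ici)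
  · rcases le_or_gt s a with h | h
    · obtain ⟨l, hl⟩ := hx.left_lim s
      refine ⟨l, hl.congr' ?_⟩
      filter_upwards [self_mem_nhdsWithin] with r hr
      exact (if_pos (lt_of_lt_of_le hr h)).symm
    · obtain ⟨l, hl⟩ := hy.left_lim s
      exact ⟨l, hl.congr' ((hgt s h).symm.filter_mono nhdsWithin_le_nhds)⟩
  · refine (((hx.finite_disc b c).union (hy.finite_disc b c)).union (finite_singleton a)).subset ?_
    rintro s ⟨hs, hdisc⟩
    rcases lt_trichotomy s a with h | h | h
    · exact Or.inl (Or.inl ⟨hs, fun hc => hdisc (hc.congr (hlt s h).symm)⟩)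
    · exact Or.inr h
    · exact Or.inl (Or.inr ⟨hs, fun hc => hdisc (hc.congr (hgt s h).symm)⟩)

/-- A history, extended to all times by its values at the end points, with the time `0` of the
history moved to time `a`. -/
noncomputable def PC.extend (φ : PC θ E) (a : ℝ) : ℝ → E :=
  fun s => φ (projIcc (-(θ : ℝ)) 0 (by simp) (s - a))

theorem PC.extend_add (φ : PC θ E) (a : ℝ) (τ : Icc (-(θ : ℝ)) 0) :
    φ.extend a (a + τ) = φ τ := by
  simp [PC.extend]

theorem PC.isPCPath_extend (φ : PC θ E) (a : ℝ) : IsPCPath (φ.extend a) := by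
  have hθ : -(θ : ℝ) ≤ 0 := by simp
  set m : ℝ → Icc (-(θ : ℝ)) 0 := fun s => projIcc (-(θ : ℝ)) 0 hθ (s - a) with hm
  have hmc : Continuous m := continuous_projIcc.comp (continuous_id.sub continuous_const)
  have hmm : Monotone m := fun s r h => monotone_projIcc hθ (sub_le_sub_right h a)
  have hright : ∀ s, 0 < s - a → φ.extend a =ᶠ[𝓝 s] fun _ => φ (m s) := fun s hs => by
    filter_upwards [Ioi_mem_nhds (sub_pos.1 hs)] with r hr
    change φ (m r) = φ (m s)
    simp only [hm]
    rw [projIcc_of_right_le _ hs.le, projIcc_of_right_le _ (sub_nonneg.2 (le_of_lt hr))]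
  have hleft : ∀ s, s - a ≤ -θ → ∀ r ≤ s, φ.extend a r = φ (m s) := fun s hs r hr => by
    change φ (m r) = φ (m s)
    simp only [hm]
    rw [projIcc_of_le_left _ hs, projIcc_of_le_left _ (by linarith)]
  refine ⟨⟨fun s => ?_, fun s => ?_⟩, fun b c => ?_⟩
  · exact (φ.isPC.right_cont (m s)).comp hmc.continuousWithinAt fun r hr => hmm hr
  · rcases le_or_gt (s - a) (-θ) with h1 | h1
    · refine ⟨φ (m s), tendsto_const_nhds.congr' ?_⟩
      filter_upwards [self_mem_nhdsWithin] with r hr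
      exact (hleft s h1 r (le_of_lt hr)).symm
    rcases lt_or_ge 0 (s - a) with h2 | h2
    · exact ⟨φ (m s), tendsto_const_nhds.congr'
        ((hright s h2).symm.filter_mono nhdsWithin_le_nhds)⟩
    · obtain ⟨l, hl⟩ := φ.isPC.left_lim (m s)
      refine ⟨l, hl.comp (tendsto_nhdsWithin_iff.2
        ⟨(hmc.tendsto s).mono_left nhdsWithin_le_nhds, ?_⟩)⟩
      filter_upwards [self_mem_nhdsWithin] with r hr
      have hr : r < s := hr
      change m r < m s
      rw [← Subtype.coe_lt_coe]
      simp only [hm, coe_projIcc]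
      rw [min_eq_right h2, max_eq_right h1.le]
      exact max_lt h1 ((min_le_right _ _).trans_lt (by linarith))
  · refine (φ.isPC.finite_disc.image fun τ : Icc (-(θ : ℝ)) 0 => a + (τ : ℝ)).subset ?_
    rintro s ⟨-, hdisc⟩
    refine ⟨m s, fun hc => hdisc (ContinuousAt.comp (f := m) (g := φ) hc hmc.continuousAt), ?_⟩
    have h2 : s - a ≤ 0 := by
      by_contra! h
      exact hdisc (continuousAt_const.congr (hright s h).symm)
    have h1 : -(θ : ℝ) ≤ s - a := by
      by_contra! h
      refine hdisc (ContinuousAt.congr (f := fun _ => φ (m s)) continuousAt_const ?_)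
      filter_upwards [Iio_mem_nhds (show s < a - θ by linarith)] with r hr
      have hr : r < a - θ := hr
      rcases le_total r s with hrs | hrs
      · exact (hleft s h.le r hrs).symm
      · exact hleft r (by linarith) s hrs
    simp only [hm, coe_projIcc]
    rw [min_eq_right h2, max_eq_right h1]
    ring

theorem IsPCPath.isPC (hx : IsPCPath x) (t : ℝ) :
    IsPC θ fun τ : Icc (-(θ : ℝ)) 0 => x (t + τ) := by
  set m : Icc (-(θ : ℝ)) 0 → ℝ := fun τ => t + τ with hm
  have hmc : Continuous m := by fun_prop
  refine ⟨fun τ => ?_, fun τ => ?_, ?_⟩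
  · exact (hx.right_cont (m τ)).comp hmc.continuousWithinAt fun σ hσ =>
      add_le_add_right (Subtype.coe_le_coe.2 hσ) t
  · obtain ⟨l, hl⟩ := hx.left_lim (m τ)
    refine ⟨l, hl.comp (tendsto_nhdsWithin_iff.2
      ⟨(hmc.tendsto τ).mono_left nhdsWithin_le_nhds, ?_⟩)⟩
    filter_upwards [self_mem_nhdsWithin] with σ hσ
    exact add_lt_add_right (Subtype.coe_lt_coe.2 hσ) t
  · refine ((hx.finite_disc (t - θ) t).preimage (f := m) ?_).subset fun τ hτ => ?_
    · exact fun σ _ τ _ h => Subtype.ext (add_left_cancel h)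
    · refine ⟨⟨?_, ?_⟩, fun hc => hτ (ContinuousAt.comp (g := x) (f := m) hc hmc.continuousAt)⟩
      · have := τ.2.1
        simp only [hm]; linarith
      · have := τ.2.2
        simp only [hm]; linarith

theorem IsPC.update_now {φ : Icc (-(θ : ℝ)) 0 → E} (hφ : IsPC θ φ) (e : E) :
    IsPC θ (Function.update φ (now θ) e) := by
  have hle : ∀ τ : Icc (-(θ : ℝ)) 0, τ ≤ now θ := fun τ => τ.2.2
  have hev : ∀ τ, τ ≠ now θ → Function.update φ (now θ) e =ᶠ[𝓝 τ] φ := fun τ hτ => by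
    filter_upwards [isOpen_ne.mem_nhds hτ] with σ hσ
    exact Function.update_of_ne hσ _ _
  refine ⟨fun τ => ?_, fun τ => ?_, ?_⟩
  · rcases eq_or_ne τ (now θ) with rfl | h
    · have : Ici (now θ) = {now θ} := by
        ext σ
        exact ⟨fun h => le_antisymm (hle σ) h, fun h => (show σ = now θ from h) ▸ self_mem_Ici⟩
      rw [this]
      exact continuousWithinAt_singleton
    · exact (hφ.right_cont τ).congr_of_eventuallyEq ((hev τ h).filter_mono nhdsWithin_le_nhds)
        (hev τ h).eq_of_nhds
  · obtain ⟨l, hl⟩ := hφ.left_lim τ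
    refine ⟨l, hl.congr' ?_⟩
    filter_upwards [self_mem_nhdsWithin] with σ hσ
    exact (Function.update_of_ne (ne_of_lt (lt_of_lt_of_le hσ (hle τ))) _ _).symm
  · refine (hφ.finite_disc.union (finite_singleton (now θ))).subset fun τ hτ => ?_
    rcases eq_or_ne τ (now θ) with rfl | h
    · exact Or.inr rfl
    · exact Or.inl fun hc => hτ (hc.congr (hev τ h).symm)

theorem PC.ext_fun {φ ψ : PC θ E} (h : ∀ τ, φ τ = ψ τ) : φ = ψ := by
  cases φ; cases ψ
  congr
  exact funext h

variable [Zero E]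

theorem IsPCPath.hist_apply (hx : IsPCPath x) (t : ℝ) (τ : Icc (-(θ : ℝ)) 0) :
    hist θ x t τ = x (t + τ) :=
  ImpulsiveNet.hist_apply (hx.isPC t) τ

theorem IsPCPath.hist_now (hx : IsPCPath x) (t : ℝ) : hist θ x t (now θ) = x t := by
  simp [hx.hist_apply, now]

theorem IsPCPath.histLeft_apply (hx : IsPCPath x) (t : ℝ) (τ : Icc (-(θ : ℝ)) 0) :
    histLeft θ x t τ = Function.update (fun τ : Icc (-(θ : ℝ)) 0 => x (t + τ)) (now θ)
      (Function.leftLim x t) τ := by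
  unfold histLeft
  rw [dif_pos ((hx.isPC t).update_now _)]

theorem IsPCPath.histLeft_now (hx : IsPCPath x) (t : ℝ) :
    histLeft θ x t (now θ) = Function.leftLim x t := by
  simp [hx.histLeft_apply]

theorem hist_congr (h : ∀ s ∈ Icc (t - θ) t, x s = y s) : hist θ x t = hist θ y t := by
  have : (fun τ : Icc (-(θ : ℝ)) 0 => x (t + τ)) = fun τ : Icc (-(θ : ℝ)) 0 => y (t + τ) := by
    funext τ
    exact h _ ⟨by linarith [τ.2.1], by linarith [τ.2.2]⟩
  unfold hist
  by_cases hy : IsPC θ fun τ : Icc (-(θ : ℝ)) 0 => y (t + τ)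
  · rw [dif_pos hy, dif_pos (this ▸ hy)]
    exact PC.ext_fun (congrFun this)
  · rw [dif_neg hy, dif_neg (this ▸ hy)]

theorem histLeft_congr [T2Space E] {a : ℝ} (hat : a < t) (haθ : a ≤ t - θ)
    (h : ∀ s ∈ Ico a t, x s = y s) (hx : ∃ l, Tendsto x (𝓝[<] t) (𝓝 l)) :
    histLeft θ x t = histLeft θ y t := by
  have hlim : Function.leftLim x t = Function.leftLim y t := by
    obtain ⟨l, hl⟩ := hx
    rw [leftLim_eq_of_tendsto hl, leftLim_eq_of_tendsto (hl.congr' ?_)]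
    filter_upwards [Ioo_mem_nhdsLT hat] with s hs
    exact h s ⟨hs.1.le, hs.2⟩
  have : Function.update (fun τ : Icc (-(θ : ℝ)) 0 => x (t + τ)) (now θ) (Function.leftLim x t)
      = Function.update (fun τ : Icc (-(θ : ℝ)) 0 => y (t + τ)) (now θ)
        (Function.leftLim y t) := by
    funext τ
    rcases eq_or_ne τ (now θ) with rfl | hτ
    · simp [hlim]
    · have hτ0 : (τ : ℝ) < 0 := lt_of_le_of_ne τ.2.2 fun h0 => hτ (Subtype.ext h0)
      rw [Function.update_of_ne hτ, Function.update_of_ne hτ]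
      exact h _ ⟨by linarith [τ.2.1], by linarith⟩
  unfold histLeft
  by_cases hy : IsPC θ (Function.update (fun τ : Icc (-(θ : ℝ)) 0 => y (t + τ)) (now θ)
      (Function.leftLim y t))
  · rw [dif_pos hy, dif_pos (this ▸ hy)]
    exact PC.ext_fun (congrFun this)
  · rw [dif_neg hy, dif_neg (this ▸ hy)]

end Paths

section Bounded

variable {E : Type*} [NormedAddCommGroup E] {θ : ℝ≥0}

theorem IsCadlag.exists_nnnorm_le {x : ℝ → E} (hx : IsCadlag x) (a b : ℝ) :
    ∃ R : ℝ≥0, ∀ t ∈ Icc a b, ‖x t‖₊ ≤ R := by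
  refine isCompact_Icc.induction_on (p := fun s => ∃ R : ℝ≥0, ∀ t ∈ s, ‖x t‖₊ ≤ R)
    ⟨0, by simp⟩ (fun s t hst ⟨R, hR⟩ => ⟨R, fun r hr => hR r (hst hr)⟩)
    (fun s t ⟨R, hR⟩ ⟨R', hR'⟩ => ⟨max R R', fun r hr => ?_⟩) fun t _ => ?_
  · rcases hr with hr | hr
    · exact (hR r hr).trans (le_max_left _ _)
    · exact (hR' r hr).trans (le_max_right _ _)
  · obtain ⟨l, hl⟩ := hx.left_lim t
    have h1 : ∀ᶠ r in 𝓝[<] t, ‖x r‖₊ ≤ ‖l‖₊ + 1 :=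
      (hl.nnnorm.eventually_lt_const (lt_add_one _)).mono fun _ h => h.le
    have h2 : ∀ᶠ r in 𝓝[≥] t, ‖x r‖₊ ≤ ‖x t‖₊ + 1 :=
      ((hx.right_cont t).tendsto.nnnorm.eventually_lt_const (lt_add_one _)).mono fun _ h => h.le
    refine ⟨{r | ‖x r‖₊ ≤ max (‖l‖₊ + 1) (‖x t‖₊ + 1)}, mem_nhdsWithin_of_mem_nhds ?_, _,
      fun r hr => hr⟩
    rw [← nhdsLT_sup_nhdsGE, mem_sup]
    exact ⟨h1.mono fun _ h => h.trans (le_max_left _ _),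
      h2.mono fun _ h => h.trans (le_max_right _ _)⟩

theorem PC.bddAbove_nnnorm (φ : PC θ E) : BddAbove (range fun τ => ‖φ τ‖₊) := by
  obtain ⟨R, hR⟩ := (φ.isPCPath_extend 0).exists_nnnorm_le (-θ) 0
  refine ⟨R, ?_⟩
  rintro _ ⟨τ, rfl⟩
  have := hR τ τ.2
  rwa [← zero_add (τ : ℝ), φ.extend_add] at this

theorem PC.bddAbove_comp {X : Type*} [TopologicalSpace X] (φ : PC θ X) {V : X → ℝ≥0}
    (hV : Continuous V) : BddAbove (range fun τ => V (φ τ)) := by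
  let ψ : PC θ ℝ := ⟨fun τ => V (φ τ), φ.isPC.comp (by fun_prop : Continuous fun x => (V x : ℝ))⟩
  have := ψ.bddAbove_nnnorm
  simpa [ψ] using this

theorem supNorm_le {φ : PC θ E} {R : ℝ≥0} (h : ∀ τ, ‖φ τ‖₊ ≤ R) : supNorm φ ≤ R :=
  ciSup_le' h

theorem nnnorm_le_supNorm (φ : PC θ E) (τ) : ‖φ τ‖₊ ≤ supNorm φ :=
  le_ciSup φ.bddAbove_nnnorm τ

theorem supDist_le {φ ψ : PC θ E} {R : ℝ≥0} (h : ∀ τ, ‖φ τ - ψ τ‖₊ ≤ R) : supDist φ ψ ≤ R :=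
  ciSup_le' h

theorem nnnorm_sub_le_supDist (φ ψ : PC θ E) (τ) : ‖φ τ - ψ τ‖₊ ≤ supDist φ ψ := by
  refine le_ciSup (f := fun τ => ‖φ τ - ψ τ‖₊) ⟨supNorm φ + supNorm ψ, ?_⟩ τ
  rintro _ ⟨τ, rfl⟩
  exact (nnnorm_sub_le _ _).trans (add_le_add (nnnorm_le_supNorm φ τ) (nnnorm_le_supNorm ψ τ))

theorem supV_le {X : Type*} [TopologicalSpace X] {V : X → ℝ≥0} {φ : PC θ X} {R : ℝ≥0}
    (h : ∀ τ, V (φ τ) ≤ R) : supV V φ ≤ R :=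
  ciSup_le' h

theorem le_supV {X : Type*} [TopologicalSpace X] {V : X → ℝ≥0} (hV : Continuous V)
    (φ : PC θ X) (τ) : V (φ τ) ≤ supV V φ :=
  le_ciSup (φ.bddAbove_comp hV) τ

theorem IsCadlag.nnnorm_le_supNormOn {u : ℝ → E} (hu : IsCadlag u) {a b s : ℝ}
    (hs : s ∈ Icc a b) : ‖u s‖₊ ≤ supNormOn u a b := by
  obtain ⟨R, hR⟩ := hu.exists_nnnorm_le a b
  refine le_csSup ⟨R, ?_⟩ ⟨s, hs, rfl⟩
  rintro _ ⟨r, hr, rfl⟩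
  exact hR r hr

theorem IsCadlag.tendsto_leftLim {u : ℝ → E} (hu : IsCadlag u) (t : ℝ) :
    Tendsto u (𝓝[<] t) (𝓝 (Function.leftLim u t)) :=
  tendsto_leftLim_of_tendsto (hu.left_lim t)

theorem IsCadlag.nnnorm_leftLim_le_supNormOn {u : ℝ → E} (hu : IsCadlag u) {a b t : ℝ}
    (hat : a < t) (htb : t ≤ b) : ‖Function.leftLim u t‖₊ ≤ supNormOn u a b := by
  refine le_of_tendsto (hu.tendsto_leftLim t).nnnorm ?_
  filter_upwards [Ioo_mem_nhdsLT hat] with s hs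
  exact hu.nnnorm_le_supNormOn ⟨hs.1.le, hs.2.le.trans htb⟩

end Bounded

/-! ### Impulse times -/

theorem IsImpulseTimes.exists_gt {t₀ : ℝ} {I : Set ℝ} (hI : IsImpulseTimes t₀ I) (t : ℝ) :
    ∃ t' > t, ∀ s ∈ Ioc t t', s ∉ I := by
  have hfin : (I ∩ Ioc t (t + 1)).Finite :=
    (hI.locally_finite (t + 1)).subset fun s hs => ⟨hs.1, hs.2.2⟩
  rcases (I ∩ Ioc t (t + 1)).eq_empty_or_nonempty with h | h
  · refine ⟨t + 1, lt_add_one t, fun s hs hsI => ?_⟩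
    have : s ∈ I ∩ Ioc t (t + 1) := ⟨hsI, hs⟩
    simp [h] at this
  · obtain ⟨m, hm, hmin⟩ := hfin.exists_minimal h
    refine ⟨(t + m) / 2, by linarith [hm.2.1], fun s hs hsI => ?_⟩
    have hsm : s < m := by linarith [hs.2, hm.2.1]
    exact absurd (hmin ⟨hsI, hs.1, hsm.le.trans hm.2.2⟩ hsm.le) (not_le.2 hsm)

theorem IsImpulseTimes.exists_lt {t₀ : ℝ} {I : Set ℝ} (hI : IsImpulseTimes t₀ I) {a t : ℝ}
    (hat : a < t) : ∃ t', a < t' ∧ t' < t ∧ ∀ s ∈ Ioo t' t, s ∉ I := by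
  have hfin : (I ∩ Ioo a t).Finite :=
    (hI.locally_finite t).subset fun s hs => ⟨hs.1, hs.2.2.le⟩
  rcases (I ∩ Ioo a t).eq_empty_or_nonempty with h | h
  · refine ⟨(a + t) / 2, by linarith, by linarith, fun s hs hsI => ?_⟩
    have : s ∈ I ∩ Ioo a t := ⟨hsI, by linarith [hs.1], hs.2⟩
    simp [h] at this
  · obtain ⟨m, hm, hmax⟩ := hfin.exists_maximal h
    refine ⟨m, hm.2.1, hm.2.2, fun s hs hsI => ?_⟩
    exact absurd (hmax ⟨hsI, hm.2.1.trans hs.1, hs.2⟩ hs.1.le) (not_le.2 hs.1)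

/-! ### Right-hand sides along paths -/

section RightHandSides

variable {θ : ℝ≥0} {X U : Type*} [NormedAddCommGroup X] {x y : ℝ → X}

theorem supNorm_hist_le (hx : IsPCPath x) {R : ℝ≥0} {a t : ℝ}
    (h : ∀ s ∈ Icc a t, ‖x s‖₊ ≤ R) (ha : a ≤ t - θ) : supNorm (hist θ x t) ≤ R :=
  supNorm_le fun τ => by
    rw [hx.hist_apply]
    exact h _ ⟨by linarith [τ.2.1], by linarith [τ.2.2]⟩

theorem supDist_hist_le (hx : IsPCPath x) (hy : IsPCPath y) {D : ℝ≥0} {a t : ℝ}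
    (h : ∀ s ∈ Icc a t, ‖x s - y s‖₊ ≤ D) (ha : a ≤ t - θ) :
    supDist (hist θ x t) (hist θ y t) ≤ D :=
  supDist_le fun τ => by
    rw [hx.hist_apply, hy.hist_apply]
    exact h _ ⟨by linarith [τ.2.1], by linarith [τ.2.2]⟩

section Flow

variable [NormedSpace ℝ X] {f : PC θ X → U → X} {u : ℝ → U}

/-- The integrated form of the differential equation between the times `a` and `c`. -/
def FlowsOn (f : PC θ X → U → X) (u : ℝ → U) (x : ℝ → X) (a c : ℝ) : Prop :=
  IntervalIntegrable (fun s => f (hist θ x s) (u s)) volume a c ∧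
    x c = x a + ∫ s in a..c, f (hist θ x s) (u s)

theorem FlowsOn.congr {a c : ℝ} (hac : a ≤ c) (h : FlowsOn f u x a c)
    (hxy : ∀ s ∈ Ico (a - θ) c, x s = y s) (hc : x c = y c) : FlowsOn f u y a c := by
  have hθ : (0 : ℝ) ≤ θ := θ.2
  have hist_eq : ∀ s ∈ Ioo a c, f (hist θ x s) (u s) = f (hist θ y s) (u s) := fun s hs => by
    rw [hist_congr fun r hr => hxy r ⟨by linarith [hr.1, hs.1], hr.2.trans_lt hs.2⟩]
  refine ⟨h.1.congr_uIoo (by rwa [uIoo_of_le hac]), ?_⟩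
  have ha : x a = y a := by
    rcases hac.eq_or_lt with rfl | h
    · exact hc
    · exact hxy a ⟨by linarith, h⟩
  rw [← hc, ← ha, h.2, intervalIntegral.integral_congr_Ioo_of_le hac hist_eq]

theorem FlowsOn.trans {a c e : ℝ} (h₁ : FlowsOn f u x a c) (h₂ : FlowsOn f u x c e) :
    FlowsOn f u x a e :=
  ⟨h₁.1.trans h₂.1, by
    rw [h₂.2, h₁.2, add_assoc, intervalIntegral.integral_add_adjacent_intervals h₁.1 h₂.1]⟩

theorem FlowsOn.of_left {a c e : ℝ} (h₁ : FlowsOn f u x a c) (h₂ : FlowsOn f u x a e) :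
    FlowsOn f u x c e := by
  refine ⟨h₁.1.symm.trans h₂.1, ?_⟩
  have := intervalIntegral.integral_add_adjacent_intervals h₁.1 (h₁.1.symm.trans h₂.1)
  rw [h₂.2, h₁.2, ← this, add_assoc]

end Flow

variable [NormedAddCommGroup U]

/-- `f` is Lipschitz on every bounded set. -/
def LipschitzOnBoundedSets (f : PC θ X → U → X) : Prop :=
  ∀ R : ℝ≥0, ∃ L : ℝ≥0, ∀ φ ψ v w, supNorm φ ≤ R → supNorm ψ ≤ R → ‖v‖₊ ≤ R → ‖w‖₊ ≤ R →
    ‖f φ v - f ψ w‖₊ ≤ L * (supDist φ ψ + ‖v - w‖₊)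

/-- Along all piecewise right-continuous paths `x` and all inputs `u`, the function
`t ↦ f(x^t, u(t))` is Lebesgue measurable. -/
def MeasurableAlong (f : PC θ X → U → X) : Prop :=
  ∀ (x : ℝ → X) (u : ℝ → U), IsPCPath x → IsCadlag u →
    AEStronglyMeasurable (fun t => f (hist θ x t) (u t)) volume

theorem LipschitzOnBoundedSets.exists_bound {f : PC θ X → U → X}
    (hf : LipschitzOnBoundedSets f) (R : ℝ≥0) :
    ∃ C : ℝ≥0, ∀ φ v, supNorm φ ≤ R → ‖v‖₊ ≤ R → ‖f φ v‖₊ ≤ C := by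
  obtain ⟨L, hL⟩ := hf R
  let z : PC θ X := ⟨_, isPC_const θ 0⟩
  refine ⟨L * (R + R) + ‖f z 0‖₊, fun φ v hφ hv => ?_⟩
  have h1 := hL φ z v 0 hφ (supNorm_le fun τ => by simp [z]) hv (by simp)
  have h2 : supDist φ z ≤ R := supDist_le fun τ => by
    simpa [z] using (nnnorm_le_supNorm φ τ).trans hφ
  calc ‖f φ v‖₊ = ‖(f φ v - f z 0) + f z 0‖₊ := by rw [sub_add_cancel]
    _ ≤ ‖f φ v - f z 0‖₊ + ‖f z 0‖₊ := nnnorm_add_le _ _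
    _ ≤ L * (R + R) + ‖f z 0‖₊ := by
      gcongr
      refine h1.trans ?_
      rw [sub_zero]
      gcongr

theorem intervalIntegrable_along {f : PC θ X → U → X} {u : ℝ → U}
    (hf : LipschitzOnBoundedSets f) (hm : MeasurableAlong f)
    (hx : IsPCPath x) (hu : IsCadlag u) (a c : ℝ) :
    IntervalIntegrable (fun s => f (hist θ x s) (u s)) volume a c := by
  have hθ : (0 : ℝ) ≤ θ := θ.2
  obtain ⟨R₁, hR₁⟩ := hx.exists_nnnorm_le (min a c - θ) (max a c)
  obtain ⟨R₂, hR₂⟩ := hu.exists_nnnorm_le (min a c) (max a c)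
  obtain ⟨C, hC⟩ := hf.exists_bound (max R₁ R₂)
  rw [intervalIntegrable_iff]
  refine Measure.integrableOn_of_bounded (M := C) (by simp [uIoc]) (hm x u hx hu) ?_
  refine (ae_restrict_mem measurableSet_uIoc).mono fun s hs => ?_
  have hs : min a c < s ∧ s ≤ max a c := hs
  exact hC _ _ ((supNorm_hist_le hx (a := min a c - θ)
    (fun r hr => hR₁ r ⟨hr.1, hr.2.trans hs.2⟩) (by linarith)).trans (le_max_left _ _))
    ((hR₂ s ⟨hs.1.le, hs.2⟩).trans (le_max_right _ _))

end RightHandSides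

/-! ### Solutions on compact intervals -/

section Solutions

variable {θ : ℝ≥0} {X U : Type*} [NormedAddCommGroup X] [NormedSpace ℝ X] [NormedAddCommGroup U]

/-- `x` is a solution on the closed interval `[t₀ - θ, b]`. -/
structure SolvesOn (f g : PC θ X → U → X) (I : Set ℝ) (t₀ b : ℝ) (ξ : PC θ X) (u : ℝ → U)
    (x : ℝ → X) : Prop where
  initial : ∀ τ : Icc (-(θ : ℝ)) 0, x (t₀ + τ) = ξ τ
  flow : ∀ a c : ℝ, t₀ ≤ a → a ≤ c → c ≤ b → (∀ t ∈ Ioc a c, t ∉ I) → FlowsOn f u x a c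
  jump : ∀ t ∈ I, t₀ < t → t ≤ b →
    (∃ l, Tendsto x (𝓝[<] t) (𝓝 l)) ∧ x t = g (histLeft θ x t) (Function.leftLim u t)

variable {f g : PC θ X → U → X} {I : Set ℝ} {t₀ b : ℝ} {ξ : PC θ X} {u : ℝ → U} {x y : ℝ → X}

theorem IsSolution.solvesOn {T : EReal} (h : IsSolution f g I t₀ T ξ u x) (hb : (b : EReal) < T) :
    SolvesOn f g I t₀ b ξ u x where
  initial := h.initial
  flow a c ha hac hcb hI := h.flow a c ha hac ((EReal.coe_le_coe_iff.2 hcb).trans_lt hb) hI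
  jump t ht h0 htb := h.jump t ht h0 ((EReal.coe_le_coe_iff.2 htb).trans_lt hb)

theorem isSolution_of_solvesOn {T : EReal} (h0 : ∀ τ : Icc (-(θ : ℝ)) 0, x (t₀ + τ) = ξ τ)
    (h : ∀ b, t₀ ≤ b → (b : EReal) < T → SolvesOn f g I t₀ b ξ u x) :
    IsSolution f g I t₀ T ξ u x where
  initial := h0
  flow a c ha hac hc hI := (h c (ha.trans hac) hc).flow a c ha hac le_rfl hI
  jump t ht h0 htT := (h t h0.le htT).jump t ht h0 le_rfl

theorem SolvesOn.mono (h : SolvesOn f g I t₀ b ξ u x) {c : ℝ} (hcb : c ≤ b) :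
    SolvesOn f g I t₀ c ξ u x where
  initial := h.initial
  flow a e ha hae hec hI := h.flow a e ha hae (hec.trans hcb) hI
  jump t ht h0 htc := h.jump t ht h0 (htc.trans hcb)

theorem SolvesOn.congr (h : SolvesOn f g I t₀ b ξ u x)
    (hxy : ∀ s ∈ Icc (t₀ - θ) b, x s = y s) (htb : t₀ ≤ b) : SolvesOn f g I t₀ b ξ u y where
  initial τ := by
    rw [← hxy _ ⟨by linarith [τ.2.1], by linarith [τ.2.2]⟩]
    exact h.initial τ
  flow a c ha hac hcb hI := (h.flow a c ha hac hcb hI).congr hac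
    (fun s hs => hxy s ⟨by linarith [hs.1], hs.2.le.trans hcb⟩)
    (hxy c ⟨by linarith [θ.2, ha.trans hac], hcb⟩)
  jump t ht h0 htb := by
    have hθ : (0 : ℝ) ≤ θ := θ.2
    obtain ⟨⟨l, hl⟩, hg⟩ := h.jump t ht h0 htb
    have heq : ∀ s ∈ Ico (t₀ - θ) t, x s = y s := fun s hs => hxy s ⟨hs.1, hs.2.le.trans htb⟩
    refine ⟨⟨l, hl.congr' ?_⟩, ?_⟩
    · filter_upwards [Ioo_mem_nhdsLT h0] with s hs
      exact heq s ⟨by linarith [hs.1], hs.2⟩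
    · rw [← hxy t ⟨by linarith, htb⟩, hg,
        histLeft_congr (by linarith : t₀ - θ < t) (by linarith) heq ⟨l, hl⟩]

theorem SolvesOn.eq_initial (h : SolvesOn f g I t₀ b ξ u x) {s : ℝ} (hs : s ∈ Icc (t₀ - θ) t₀) :
    x s = ξ.extend t₀ s := by
  have hmem : s - t₀ ∈ Icc (-(θ : ℝ)) 0 := ⟨by linarith [hs.1], by linarith [hs.2]⟩
  have h1 := h.initial ⟨s - t₀, hmem⟩
  have h2 := ξ.extend_add t₀ ⟨s - t₀, hmem⟩
  simp only [add_sub_cancel] at h1 h2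
  rw [h1, h2]

theorem SolvesOn.continuousOn (h : SolvesOn f g I t₀ b ξ u x) {a c : ℝ} (ha : t₀ ≤ a)
    (hac : a ≤ c) (hcb : c ≤ b) (hI : ∀ t ∈ Ioc a c, t ∉ I) : ContinuousOn x (Icc a c) := by
  have hint := (h.flow a c ha hac hcb hI).1
  have h1 : ContinuousOn (fun s => x a + ∫ r in a..s, f (hist θ x r) (u r)) (Icc a c) := by
    have := intervalIntegral.continuousOn_primitive_interval' hint left_mem_uIcc
    rw [uIcc_of_le hac] at this
    exact continuousOn_const.add this
  refine h1.congr fun s hs => ?_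
  exact (h.flow a s ha hs.1 (hs.2.trans hcb) fun t ht => hI t ⟨ht.1, ht.2.trans hs.2⟩).2

/-- Lipschitz estimate for the right-hand side along two paths. -/
theorem norm_integral_sub_le {L R D : ℝ≥0}
    (hL : ∀ φ ψ v w, supNorm φ ≤ R → supNorm ψ ≤ R → ‖v‖₊ ≤ R → ‖w‖₊ ≤ R →
      ‖f φ v - f ψ w‖₊ ≤ L * (supDist φ ψ + ‖v - w‖₊))
    (hx : IsPCPath x) (hy : IsPCPath y) {a c : ℝ} (hac : a ≤ c)
    (hxR : ∀ s ∈ Icc (a - θ) c, ‖x s‖₊ ≤ R) (hyR : ∀ s ∈ Icc (a - θ) c, ‖y s‖₊ ≤ R)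
    (huR : ∀ s ∈ Icc a c, ‖u s‖₊ ≤ R) (hD : ∀ s ∈ Icc (a - θ) c, ‖x s - y s‖₊ ≤ D)
    (hix : IntervalIntegrable (fun s => f (hist θ x s) (u s)) volume a c)
    (hiy : IntervalIntegrable (fun s => f (hist θ y s) (u s)) volume a c) :
    ‖(∫ s in a..c, f (hist θ x s) (u s)) - ∫ s in a..c, f (hist θ y s) (u s)‖
      ≤ L * D * (c - a) := by
  rw [← intervalIntegral.integral_sub hix hiy]
  refine (intervalIntegral.norm_integral_le_of_norm_le_const (C := L * D) fun s hs => ?_).trans_eq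
    (by rw [abs_of_nonneg (sub_nonneg.2 hac)])
  rw [uIoc_of_le hac] at hs
  have h1 := hL (hist θ x s) (hist θ y s) (u s) (u s)
    (supNorm_hist_le hx (fun r hr => hxR r ⟨hr.1, hr.2.trans hs.2⟩) (by linarith [hs.1]))
    (supNorm_hist_le hy (fun r hr => hyR r ⟨hr.1, hr.2.trans hs.2⟩) (by linarith [hs.1]))
    (huR s ⟨hs.1.le, hs.2⟩) (huR s ⟨hs.1.le, hs.2⟩)
  have h2 := supDist_hist_le hx hy (fun r hr => hD r ⟨hr.1, hr.2.trans hs.2⟩)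
    (by linarith [hs.1] : a - θ ≤ s - θ)
  have h3 : ‖f (hist θ x s) (u s) - f (hist θ y s) (u s)‖₊ ≤ L * D := by
    refine h1.trans ?_
    rw [sub_self, nnnorm_zero, add_zero]
    gcongr
  exact_mod_cast h3

/-! ### Uniqueness -/

/-- Two solutions with the same data agree. Right of a time up to which they agree, the larger
of their distances on a short interval is at most half of itself. -/
theorem SolvesOn.eq_of_isPCPath (hf : LipschitzOnBoundedSets f) (hI : IsImpulseTimes t₀ I)
    (hu : IsCadlag u) (hx : SolvesOn f g I t₀ b ξ u x) (hxp : IsPCPath x)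
    (hy : SolvesOn f g I t₀ b ξ u y) : ∀ t ∈ Icc t₀ b, y t = x t := by
  have hθ : (0 : ℝ) ≤ θ := θ.2
  have hpast : ∀ t, (∀ s ∈ Icc t₀ t, y s = x s) → ∀ s ∈ Icc (t₀ - θ) t, y s = x s := by
    intro t ht s hs
    rcases le_total s t₀ with h | h
    · rw [hx.eq_initial ⟨hs.1, h⟩, hy.eq_initial ⟨hs.1, h⟩]
    · exact ht s ⟨h, hs.2⟩
  refine forall_mem_Icc_of_induction ?_ ?_ ?_
  · exact hpast t₀ (fun s hs => by
      have : s = t₀ := le_antisymm hs.2 hs.1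
      rw [hx.eq_initial ⟨by linarith, hs.2⟩, hy.eq_initial ⟨by linarith, hs.2⟩]) t₀
      ⟨by linarith, le_rfl⟩
  · intro t ht hle
    have hpt := hpast t hle
    obtain ⟨t₁, htt₁, ht₁⟩ := hI.exists_gt t
    set t₂ := min t₁ b with ht₂
    have htt₂ : t < t₂ := lt_min htt₁ ht.2
    have hno : ∀ s ∈ Ioc t t₂, s ∉ I := fun s hs => ht₁ s ⟨hs.1, hs.2.trans (min_le_left _ _)⟩
    have hyc := hy.continuousOn ht.1 htt₂.le (min_le_right _ _) hno
    have hxc := hx.continuousOn ht.1 htt₂.le (min_le_right _ _) hno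
    -- a piecewise right-continuous path that agrees with `y` up to time `t₂`
    set q : ℝ → X := fun s => y (projIcc t t₂ htt₂.le s) with hq
    have hqc : Continuous q :=
      (continuousOn_iff_continuous_domRestrict.1 hyc).comp continuous_projIcc
    set z : ℝ → X := fun s => if s < t then x s else q s with hz
    have hzp : IsPCPath z := hxp.ite_lt hqc.isPCPath t
    have hyz : ∀ s ∈ Icc (t₀ - θ) t₂, y s = z s := by
      intro s hs
      rcases lt_or_ge s t with h | h
      · simp only [hz, if_pos h]
        exact hpt s ⟨hs.1, h.le⟩
      · simp only [hz, if_neg (not_lt.2 h), hq, projIcc_of_mem htt₂.le ⟨h, hs.2⟩]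
    have hzs : SolvesOn f g I t₀ t₂ ξ u z :=
      (hy.mono (min_le_right _ _)).congr hyz (ht.1.trans htt₂.le)
    have hxs := hx.mono (min_le_right t₁ b)
    obtain ⟨R₁, hR₁⟩ := hxp.exists_nnnorm_le (t - θ) t₂
    obtain ⟨R₂, hR₂⟩ := hzp.exists_nnnorm_le (t - θ) t₂
    obtain ⟨R₃, hR₃⟩ := hu.exists_nnnorm_le t t₂
    obtain ⟨L, hL⟩ := hf (max R₁ (max R₂ R₃))
    set t₃ := min t₂ (t + 1 / (2 * (L + 1))) with ht₃
    have htt₃ : t < t₃ := lt_min htt₂ (lt_add_of_pos_right _ (by positivity))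
    have h32 : t₃ ≤ t₂ := min_le_left _ _
    have hLt : (L : ℝ) * (t₃ - t) ≤ 1 / 2 := by
      have h1 : t₃ - t ≤ 1 / (2 * (L + 1)) := by linarith [min_le_right t₂ (t + 1 / (2 * (L + 1)))]
      have hL0 : (0 : ℝ) ≤ L := L.2
      calc (L : ℝ) * (t₃ - t) ≤ L * (1 / (2 * (L + 1))) := by gcongr
        _ ≤ 1 / 2 := by
          rw [mul_one_div, div_le_div_iff₀ (by positivity) two_pos]
          nlinarith
    have hcont : ContinuousOn (fun s => ‖z s - x s‖) (Icc t t₃) := by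
      refine ((hyc.congr fun s hs => ?_).sub hxc).norm.mono (Icc_subset_Icc_right h32)
      exact (hyz s ⟨by linarith [hs.1, ht.1], hs.2⟩).symm
    obtain ⟨m, hm, hmax⟩ := isCompact_Icc.exists_isMaxOn (nonempty_Icc.2 htt₃.le) hcont
    have hzero : ‖z m - x m‖ = 0 := by
      have hD : ∀ s ∈ Icc (t - θ) m, ‖z s - x s‖₊ ≤ ‖z m - x m‖₊ := by
        intro s hs
        rcases lt_or_ge s t with h | h
        · simp [hz, if_pos h]
        · exact hmax ⟨h, hs.2.trans hm.2⟩
      have hno' : ∀ s ∈ Ioc t m, s ∉ I := fun s hs => hno s ⟨hs.1, hs.2.trans (hm.2.trans h32)⟩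
      have hzf := hzs.flow t m ht.1 hm.1 (hm.2.trans h32) hno'
      have hxf := hxs.flow t m ht.1 hm.1 (hm.2.trans h32) hno'
      have hzt : z t = x t := by
        rw [← hyz t ⟨by linarith [ht.1], htt₂.le⟩]
        exact hle t ⟨ht.1, le_rfl⟩
      have key := norm_integral_sub_le hL hzp hxp hm.1
        (fun s hs => (hR₂ s ⟨hs.1, hs.2.trans (hm.2.trans h32)⟩).trans
          ((le_max_left _ _).trans (le_max_right _ _)))
        (fun s hs => (hR₁ s ⟨hs.1, hs.2.trans (hm.2.trans h32)⟩).trans (le_max_left _ _))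
        (fun s hs => (hR₃ s ⟨hs.1, hs.2.trans (hm.2.trans h32)⟩).trans
          ((le_max_right _ _).trans (le_max_right _ _))) hD hzf.1 hxf.1
      have heq : z m - x m = (∫ s in t..m, f (hist θ z s) (u s)) -
          ∫ s in t..m, f (hist θ x s) (u s) := by
        rw [hzf.2, hxf.2, hzt, add_sub_add_left_eq_sub]
      rw [← heq, coe_nnnorm] at key
      have hLm : (L : ℝ) * (m - t) ≤ 1 / 2 :=
        (mul_le_mul_of_nonneg_left (by linarith [hm.2]) L.2).trans hLt
      have h0 := norm_nonneg (z m - x m)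
      nlinarith
    filter_upwards [Ioo_mem_nhdsGT htt₃] with s hs
    have h1 : ‖z s - x s‖ ≤ ‖z m - x m‖ := hmax ⟨hs.1.le, hs.2.le⟩
    rw [hzero, norm_le_zero_iff, sub_eq_zero] at h1
    rw [hyz s ⟨by linarith [hs.1, ht.1], hs.2.le.trans h32⟩, h1]
  · intro t ht hlt
    have hpt : ∀ s ∈ Ico (t₀ - θ) t, x s = y s := fun s hs =>
      (hpast s (fun r hr => hlt r ⟨hr.1, hr.2.trans_lt hs.2⟩) s ⟨hs.1, le_rfl⟩).symm
    by_cases htI : t ∈ I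
    · rw [(hy.jump t htI ht.1 ht.2).2, (hx.jump t htI ht.1 ht.2).2,
        histLeft_congr (by linarith [ht.1] : t₀ - θ < t) (by linarith [ht.1]) hpt
          (hx.jump t htI ht.1 ht.2).1]
    · obtain ⟨a, hta, hat, ha⟩ := hI.exists_lt ht.1
      have hno : ∀ s ∈ Ioc a t, s ∉ I := fun s hs => by
        rcases hs.2.eq_or_lt with h | h
        · rwa [h]
        · exact ha s ⟨hs.1, h⟩
      rw [(hy.flow a t hta.le hat.le ht.2 hno).2, (hx.flow a t hta.le hat.le ht.2 hno).2,
        hlt a ⟨hta.le, hat⟩]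
      congr 1
      refine intervalIntegral.integral_congr_Ioo_of_le hat.le fun s hs => ?_
      have : hist θ y s = hist θ x s := hist_congr fun r hr =>
        (hpt r ⟨by linarith [hr.1, hs.1], hr.2.trans_lt hs.2⟩).symm
      simp only [this]

/-! ### Existence -/

/-- Local existence for the differential equation by Banach's fixed point theorem, on an interval
whose length depends only on a bound for the history and the input. -/
theorem exists_flow (hf : LipschitzOnBoundedSets f) (hm : MeasurableAlong f) [CompleteSpace X]
    (R : ℝ≥0) : ∃ δ : ℝ, 0 < δ ∧ δ ≤ 1 ∧ ∀ (p : ℝ → X) (u : ℝ → U) (a : ℝ), IsPCPath p →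
      IsCadlag u → (∀ s ∈ Icc (a - θ) a, ‖p s‖₊ ≤ R) → (∀ s ∈ Icc a (a + δ), ‖u s‖₊ ≤ R) →
      ∃ y : ℝ → X, Continuous y ∧ y a = p a ∧
        ∀ c ∈ Icc a (a + δ), FlowsOn f u (fun s => if s < a then p s else y s) a c := by
  obtain ⟨L, hL⟩ := hf (R + 1)
  obtain ⟨C, hC⟩ := hf.exists_bound (R + 1)
  -- `C δ ≤ 1` keeps the iteration in the unit ball around the constant `p a`, `L δ ≤ 1 / 2` makes
  -- it a contraction
  set δ : ℝ := min 1 (min (1 / (C + 1)) (1 / (2 * (L + 1)))) with hδ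
  have hδ0 : 0 < δ := by positivity
  have hL0 : (0 : ℝ) ≤ L := L.2
  have hC0 : (0 : ℝ) ≤ C := C.2
  have hδC : (C : ℝ) * δ ≤ 1 := by
    have h1 : δ ≤ 1 / (C + 1) := (min_le_right _ _).trans (min_le_left _ _)
    calc (C : ℝ) * δ ≤ C * (1 / (C + 1)) := by gcongr
      _ ≤ 1 := by rw [mul_one_div, div_le_one (by positivity)]; linarith
  have hδL : (L : ℝ) * δ ≤ 1 / 2 := by
    have h1 : δ ≤ 1 / (2 * (L + 1)) := (min_le_right _ _).trans (min_le_right _ _)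
    calc (L : ℝ) * δ ≤ L * (1 / (2 * (L + 1))) := by gcongr
      _ ≤ 1 / 2 := by
        rw [mul_one_div, div_le_div_iff₀ (by positivity) two_pos]
        nlinarith
  refine ⟨δ, hδ0, min_le_left _ _, fun p u a hp hu hpR huR => ?_⟩
  have hθ : (0 : ℝ) ≤ θ := θ.2
  have hle : a ≤ a + δ := by linarith
  let ext : C(Icc a (a + δ), X) → ℝ → X := fun y s => y (projIcc a (a + δ) hle s)
  have hext : ∀ y, Continuous (ext y) := fun y => y.continuous.comp continuous_projIcc
  let z : C(Icc a (a + δ), X) → ℝ → X := fun y s => if s < a then p s else ext y s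
  have hzp : ∀ y, IsPCPath (z y) := fun y => hp.ite_lt (hext y).isPCPath a
  have hint : ∀ y c e, IntervalIntegrable (fun s => f (hist θ (z y) s) (u s)) volume c e :=
    fun y c e => intervalIntegrable_along hf hm (hzp y) hu c e
  let Φ : C(Icc a (a + δ), X) → C(Icc a (a + δ), X) := fun y =>
    ⟨fun t => p a + ∫ s in a..t, f (hist θ (z y) s) (u s),
      continuous_const.add ((intervalIntegral.continuous_primitive (hint y) a).comp
        continuous_subtype_val)⟩
  let S : Set C(Icc a (a + δ), X) := Metric.closedBall (ContinuousMap.const _ (p a)) 1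
  have hpa : ‖p a‖₊ ≤ R := hpR a ⟨by linarith, le_rfl⟩
  have hzR : ∀ y ∈ S, ∀ s ∈ Icc (a - θ) (a + δ), ‖z y s‖₊ ≤ R + 1 := by
    intro y hy s hs
    rcases lt_or_ge s a with h | h
    · simp only [z, if_pos h]
      exact (hpR s ⟨hs.1, h.le⟩).trans le_self_add
    · simp only [z, if_neg (not_lt.2 h), ext]
      set r := projIcc a (a + δ) hle s
      have h1 : dist (y r) (p a) ≤ 1 :=
        (ContinuousMap.dist_apply_le_dist (f := y) (g := ContinuousMap.const _ (p a)) r).trans hy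
      have h2 : ‖y r‖ ≤ ‖p a‖ + 1 := by
        rw [dist_eq_norm] at h1
        have := norm_add_le (p a) (y r - p a)
        rw [add_sub_cancel] at this
        linarith
      have h3 : (‖p a‖ : ℝ) ≤ R := by exact_mod_cast hpa
      have : (‖y r‖ : ℝ) ≤ (R + 1 : ℝ≥0) := by push_cast; linarith
      exact_mod_cast this
  have huR' : ∀ s ∈ Icc a (a + δ), ‖u s‖₊ ≤ R + 1 := fun s hs => (huR s hs).trans le_self_add
  have hmaps : MapsTo Φ S S := by
    intro y hy
    refine (ContinuousMap.dist_le zero_le_one).2 fun t => ?_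
    change dist (p a + ∫ s in a..t, f (hist θ (z y) s) (u s)) (p a) ≤ 1
    rw [dist_eq_norm, add_sub_cancel_left]
    have h1 := intervalIntegral.norm_integral_le_of_norm_le_const (a := a) (b := (t : ℝ))
      (f := fun s => f (hist θ (z y) s) (u s)) (C := C) fun s hs => by
        rw [uIoc_of_le t.2.1] at hs
        have := hC (hist θ (z y) s) (u s)
          (supNorm_hist_le (hzp y) (a := a - θ)
            (fun r hr => hzR y hy r ⟨hr.1, hr.2.trans (hs.2.trans t.2.2)⟩) (by linarith [hs.1]))
          (huR' s ⟨hs.1.le, hs.2.trans t.2.2⟩)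
        exact_mod_cast this
    refine h1.trans (le_trans ?_ hδC)
    rw [abs_of_nonneg (by linarith [t.2.1])]
    have : (t : ℝ) - a ≤ δ := by linarith [t.2.2]
    gcongr
  have hcontr : ∀ y ∈ S, ∀ y' ∈ S, dist (Φ y) (Φ y') ≤ (1 / 2 : ℝ≥0) * dist y y' := by
    intro y hy y' hy'
    refine (ContinuousMap.dist_le (by positivity)).2 fun t => ?_
    change dist (p a + ∫ s in a..t, f (hist θ (z y) s) (u s))
      (p a + ∫ s in a..t, f (hist θ (z y') s) (u s)) ≤ _
    rw [dist_add_left, dist_eq_norm]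
    have hsub : ∀ s ∈ Icc (a - θ) (t : ℝ), s ∈ Icc (a - θ) (a + δ) := fun s hs =>
      ⟨hs.1, hs.2.trans t.2.2⟩
    have h1 := norm_integral_sub_le (D := nndist y y') hL (hzp y) (hzp y') t.2.1
      (fun s hs => hzR y hy s (hsub s hs)) (fun s hs => hzR y' hy' s (hsub s hs))
      (fun s hs => huR' s ⟨hs.1, hs.2.trans t.2.2⟩) (fun s hs => ?_) (hint y a t) (hint y' a t)
    · refine h1.trans ?_
      rw [coe_nndist]
      have h2 : (t : ℝ) - a ≤ δ := by linarith [t.2.2]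
      have h3 : (L : ℝ) * (t - a) ≤ 1 / 2 :=
        (mul_le_mul_of_nonneg_left h2 hL0).trans hδL
      have h4 : (0 : ℝ) ≤ dist y y' := dist_nonneg
      push_cast
      nlinarith
    · rcases lt_or_ge s a with h | h
      · simp [z, if_pos h]
      · simp only [z, if_neg (not_lt.2 h), ext]
        rw [← NNReal.coe_le_coe, coe_nnnorm, ← dist_eq_norm, coe_nndist]
        exact ContinuousMap.dist_apply_le_dist _
  have hcw : ContractingWith (1 / 2) (hmaps.restrict Φ S S) := by
    refine ⟨by rw [← NNReal.coe_lt_coe]; norm_num, LipschitzWith.of_dist_le_mul ?_⟩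
    rintro ⟨y, hy⟩ ⟨y', hy'⟩
    exact hcontr y hy y' hy'
  obtain ⟨y, -, hy, -⟩ := hcw.exists_fixedPoint' (Metric.isClosed_closedBall.isComplete) hmaps
    (x := ContinuousMap.const _ (p a)) (Metric.mem_closedBall_self zero_le_one) (edist_ne_top _ _)
  have hy' : ∀ t : Icc a (a + δ), y t = p a + ∫ s in a..t, f (hist θ (z y) s) (u s) :=
    fun t => (DFunLike.congr_fun hy t).symm
  have hya : ext y a = p a := by
    simp only [ext, projIcc_of_mem hle (⟨le_rfl, hle⟩ : a ∈ Icc a (a + δ)), hy']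
    simp
  refine ⟨ext y, hext y, hya, fun c hc => ⟨hint y a c, ?_⟩⟩
  change z y c = z y a + _
  have hzc : z y c = y ⟨c, hc⟩ := by
    simp only [z, if_neg (not_lt.2 hc.1), ext, projIcc_of_mem hle hc]
  have hza : z y a = p a := by
    simp only [z, if_neg (lt_irrefl a), hya]
  rw [hzc, hza, hy']

/-- Extension of a solution over an interval without impulses in its interior, at the end of which
there may be one. -/
theorem SolvesOn.extend [CompleteSpace X] {c δ : ℝ} (hx : SolvesOn f g I t₀ c ξ u x)
    (hxp : IsPCPath x) (htc : t₀ ≤ c) (hcb : c < b) (hbδ : b ≤ c + δ)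
    (hno : ∀ t ∈ Ioo c b, t ∉ I)
    (hy : ∃ y : ℝ → X, Continuous y ∧ y c = x c ∧
        ∀ e ∈ Icc c (c + δ), FlowsOn f u (fun s => if s < c then x s else y s) c e) :
    ∃ x', IsPCPath x' ∧ SolvesOn f g I t₀ b ξ u x' := by
  classical
  have hθ : (0 : ℝ) ≤ θ := θ.2
  obtain ⟨y, hyc, hyx, hflow⟩ := hy
  set z : ℝ → X := fun s => if s < c then x s else y s with hz
  have hzp : IsPCPath z := hxp.ite_lt hyc.isPCPath c
  set e : X := if b ∈ I then g (histLeft θ z b) (Function.leftLim u b) else z b with he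
  set w : ℝ → X := fun s => if s < b then z s else e with hw
  have hwp : IsPCPath w := hzp.ite_lt continuous_const.isPCPath b
  have hwz : ∀ s < b, z s = w s := fun s hs => (if_pos hs).symm
  have hxz : ∀ s ≤ c, x s = z s := by
    intro s hs
    rcases hs.lt_or_eq with h | rfl
    · exact (if_pos h).symm
    · simp [hz, hyx]
  have hwb : w b = e := if_neg (lt_irrefl b)
  have hc : SolvesOn f g I t₀ c ξ u w :=
    hx.congr (fun s hs => (hxz s hs.2).trans (hwz s (hs.2.trans_lt hcb))) htc
  have hflow' : ∀ r, c ≤ r → r ≤ b → r ∉ I ∨ r < b → FlowsOn f u w c r := by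
    intro r hcr hrb hr
    refine (hflow r ⟨hcr, hrb.trans hbδ⟩).congr hcr (fun s hs => hwz s (hs.2.trans_le hrb)) ?_
    rcases hrb.lt_or_eq with h | rfl
    · exact hwz r h
    · rw [hwb, he, if_neg (hr.resolve_right (lt_irrefl _))]
  refine ⟨w, hwp, hc.initial, ?_, ?_⟩
  · intro a r ha har hrb hI
    rcases le_or_gt r c with h | h
    · exact hc.flow a r ha har h hI
    rcases har.eq_or_lt with rfl | har'
    · exact ⟨IntervalIntegrable.refl, by simp⟩
    have hcr : FlowsOn f u w c r := hflow' r h.le hrb (Or.inl (hI r ⟨har', le_rfl⟩))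
    rcases le_or_gt a c with hac | hac
    · exact (hc.flow a c ha hac le_rfl fun t ht => hI t ⟨ht.1, ht.2.trans h.le⟩).trans hcr
    · exact (hflow' a hac.le (har.trans hrb) (Or.inr (har'.trans_le hrb))).of_left hcr
  · intro t ht h0 htb
    rcases le_or_gt t c with h | h
    · exact hc.jump t ht h0 h
    have htb' : t = b := by
      by_contra hne
      exact hno t ⟨h, lt_of_le_of_ne htb hne⟩ ht
    subst htb'
    refine ⟨hwp.left_lim t, ?_⟩
    rw [hwb, he, if_pos ht]
    congr 1
    exact histLeft_congr (by linarith : t - θ - 1 < t) (by linarith) (fun s hs => hwz s hs.2)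
      (hzp.left_lim t)

/-- An a priori bound for the solutions on `[t₀, b]` yields existence on `[t₀, b]`: the length of
the local extension steps depends on the bound only. -/
theorem exists_solvesOn [CompleteSpace X] (hf : LipschitzOnBoundedSets f) (hm : MeasurableAlong f)
    (hI : IsImpulseTimes t₀ I) (hu : IsCadlag u) (htb : t₀ ≤ b) {R : ℝ≥0}
    (hR : ∀ c ∈ Icc t₀ b, ∀ x, IsPCPath x → SolvesOn f g I t₀ c ξ u x →
      ∀ t ∈ Icc t₀ c, ‖x t‖₊ ≤ R) :
    ∃ x, IsPCPath x ∧ SolvesOn f g I t₀ b ξ u x := by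
  have hθ : (0 : ℝ) ≤ θ := θ.2
  obtain ⟨R', hR'⟩ := hu.exists_nnnorm_le t₀ (b + 1)
  obtain ⟨δ, hδ0, hδ1, hδ⟩ := exists_flow hf hm (max R (max R' (supNorm ξ)))
  have hstep : ∀ c ∈ Icc t₀ b, ∀ x, IsPCPath x → SolvesOn f g I t₀ c ξ u x →
      ∃ y : ℝ → X, Continuous y ∧ y c = x c ∧
        ∀ e ∈ Icc c (c + δ), FlowsOn f u (fun s => if s < c then x s else y s) c e := by
    intro c hc x hxp hx
    refine hδ x u c hxp hu (fun s hs => ?_) (fun s hs => ?_)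
    · rcases le_total s t₀ with h | h
      · rw [hx.eq_initial ⟨by linarith [hs.1, hc.1], h⟩]
        exact (nnnorm_le_supNorm ξ _).trans ((le_max_right _ _).trans (le_max_right _ _))
      · exact (hR c hc x hxp hx s ⟨h, hs.2⟩).trans (le_max_left _ _)
    · exact (hR' s ⟨hc.1.trans hs.1, by linarith [hs.2, hc.2]⟩).trans
        ((le_max_left _ _).trans (le_max_right _ _))
  refine forall_mem_Icc_of_induction (a := t₀) (b := b)
    (P := fun c => ∃ x, IsPCPath x ∧ SolvesOn f g I t₀ c ξ u x) ?_ ?_ ?_ b ⟨htb, le_rfl⟩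
  · refine ⟨ξ.extend t₀, ξ.isPCPath_extend t₀, ξ.extend_add t₀, fun a c ha hac hc _ => ?_,
      fun t _ h0 ht => absurd h0 (not_lt.2 ht)⟩
    obtain rfl : a = c := le_antisymm hac (hc.trans ha)
    exact ⟨IntervalIntegrable.refl, by simp⟩
  · intro c hc hle
    obtain ⟨x, hxp, hx⟩ := hle c ⟨hc.1, le_rfl⟩
    obtain ⟨c', hcc', hc'⟩ := hI.exists_gt c
    filter_upwards [Ioo_mem_nhdsGT (lt_min hcc' (lt_add_of_pos_right c hδ0))] with s hs
    exact hx.extend hxp hc.1 hs.1 (hs.2.le.trans (min_le_right _ _))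
      (fun t ht => hc' t ⟨ht.1, ht.2.le.trans (hs.2.le.trans (min_le_left _ _))⟩)
      (hstep c ⟨hc.1, hc.2.le⟩ x hxp hx)
  · intro c hc hlt
    obtain ⟨a, hta, hac, ha⟩ := hI.exists_lt (max_lt hc.1 (sub_lt_self c hδ0))
    have hta' : t₀ ≤ a := (le_max_left _ _).trans hta.le
    obtain ⟨x, hxp, hx⟩ := hlt a ⟨hta', hac⟩
    exact hx.extend hxp hta' hac (by linarith [le_max_right t₀ (c - δ)]) ha
      (hstep a ⟨hta', hac.le.trans hc.2⟩ x hxp hx)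

/-- A priori bounds on all compact intervals yield a unique global solution. -/
theorem exists_unique_isSolution [CompleteSpace X] (hf : LipschitzOnBoundedSets f)
    (hm : MeasurableAlong f) (hI : IsImpulseTimes t₀ I) (hu : IsCadlag u)
    (hR : ∀ b, t₀ ≤ b → ∃ R : ℝ≥0, ∀ c ∈ Icc t₀ b, ∀ x, IsPCPath x → SolvesOn f g I t₀ c ξ u x →
      ∀ t ∈ Icc t₀ c, ‖x t‖₊ ≤ R) :
    ∃ x, IsSolution f g I t₀ ⊤ ξ u x ∧
      (∀ (T : EReal) (y : ℝ → X), IsSolution f g I t₀ T ξ u y →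
        ∀ t : ℝ, t₀ ≤ t → (t : EReal) < T → y t = x t) ∧
      ∀ b, t₀ ≤ b → ∃ x', IsPCPath x' ∧ SolvesOn f g I t₀ b ξ u x' ∧ x b = x' b := by
  have hex : ∀ k : ℕ, ∃ x, IsPCPath x ∧ SolvesOn f g I t₀ (t₀ + k) ξ u x := fun k => by
    have hk : t₀ ≤ t₀ + k := by simp
    obtain ⟨R, hR⟩ := hR _ hk
    exact exists_solvesOn hf hm hI hu hk hR
  choose z hzp hz using hex
  -- the solutions on `[t₀, t₀ + k]` agree by uniqueness, so they can be patched together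
  set x : ℝ → X := fun t => z ⌈t - t₀⌉₊ t with hxdef
  have hceil : ∀ t : ℝ, t ≤ t₀ + ⌈t - t₀⌉₊ := fun t => by linarith [Nat.le_ceil (t - t₀)]
  have hagree : ∀ k : ℕ, ∀ t ∈ Icc (t₀ - θ) (t₀ + k), x t = z k t := by
    intro k t ht
    rcases le_total t t₀ with h | h
    · simp only [hxdef]
      rw [(hz _).eq_initial ⟨ht.1, h⟩, (hz _).eq_initial ⟨ht.1, h⟩]
    · have hk : ⌈t - t₀⌉₊ ≤ k := Nat.ceil_le.2 (by linarith [ht.2])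
      have hk' : t₀ + (⌈t - t₀⌉₊ : ℝ) ≤ t₀ + k := by gcongr
      exact ((hz _).eq_of_isPCPath hf hI hu (hzp _) ((hz k).mono hk') t ⟨h, hceil t⟩).symm
  have hxs : ∀ b, t₀ ≤ b → SolvesOn f g I t₀ b ξ u x := fun b hb =>
    ((hz ⌈b - t₀⌉₊).congr (fun s hs => (hagree _ s hs).symm) (by simp)).mono (hceil b)
  refine ⟨x, isSolution_of_solvesOn (hxs t₀ le_rfl).initial fun b hb _ => hxs b hb, ?_, ?_⟩
  · intro T y hy t ht htT
    exact ((hz _).mono (hceil t)).eq_of_isPCPath hf hI hu (hzp _) (hy.solvesOn htT) t ⟨ht, le_rfl⟩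
  · exact fun b hb => ⟨_, hzp ⌈b - t₀⌉₊, (hz _).mono (hceil b), rfl⟩

end Solutions

/-! ### Upper right-hand derivatives -/

theorem eventually_le_of_upperRightDeriv_le {v : ℝ → ℝ} {t a : ℝ}
    (h : upperRightDeriv v t ≤ (a : EReal)) {ε : ℝ} (hε : 0 < ε) :
    ∀ᶠ r in 𝓝[>] t, v r ≤ v t + (r - t) * (a + ε) := by
  have h1 : upperRightDeriv v t < ((a + ε : ℝ) : EReal) :=
    h.trans_lt (EReal.coe_lt_coe_iff.2 (lt_add_of_pos_right a hε))
  have h2 := eventually_lt_of_limsup_lt h1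
  have hmap : Tendsto (fun r => r - t) (𝓝[>] t) (𝓝[>] 0) := by
    refine tendsto_nhdsWithin_iff.2 ⟨?_, ?_⟩
    · have : Tendsto (fun r => r - t) (𝓝 t) (𝓝 (t - t)) := (continuous_sub_right t).tendsto t
      rw [sub_self] at this
      exact this.mono_left nhdsWithin_le_nhds
    · filter_upwards [self_mem_nhdsWithin] with r hr
      exact sub_pos.2 (mem_Ioi.1 hr)
  filter_upwards [hmap.eventually h2, self_mem_nhdsWithin] with r hr hrt
  have hpos : 0 < r - t := sub_pos.2 hrt
  rw [EReal.coe_lt_coe_iff, add_sub_cancel, div_lt_iff₀ hpos] at hr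
  linarith

theorem upperRightDeriv_le_of_eventually {v : ℝ → ℝ} {t a : ℝ}
    (h : ∀ ε > 0, ∀ᶠ r in 𝓝[>] t, v r ≤ v t + (r - t) * (a + ε)) :
    upperRightDeriv v t ≤ (a : EReal) := by
  have hmap : Tendsto (fun r => t + r) (𝓝[>] 0) (𝓝[>] t) := by
    refine tendsto_nhdsWithin_iff.2 ⟨?_, ?_⟩
    · have : Tendsto (fun r => t + r) (𝓝 0) (𝓝 (t + 0)) := (continuous_const_add t).tendsto 0
      rw [add_zero] at this
      exact this.mono_left nhdsWithin_le_nhds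
    · filter_upwards [self_mem_nhdsWithin] with r hr
      exact lt_add_of_pos_right t hr
  refine EReal.le_of_forall_lt_iff_le.1 fun z hz => ?_
  have hz' : 0 < z - a := sub_pos.2 (EReal.coe_lt_coe_iff.1 hz)
  refine limsup_le_of_le (by isBoundedDefault) ?_
  filter_upwards [hmap.eventually (h _ hz'), self_mem_nhdsWithin] with r hr hr0
  have hr0 : 0 < r := hr0
  rw [EReal.coe_le_coe_iff, div_le_iff₀ hr0]
  rw [add_sub_cancel_left, add_sub_cancel] at hr
  linarith

/-! ### Counting impulses -/

section Count

variable {t₀ s t : ℝ} {I : Set ℝ}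

theorem impulseCount_self : impulseCount I s s = 0 := by
  simp [impulseCount]

theorem eventually_impulseCount_right (hI : IsImpulseTimes t₀ I) :
    ∀ᶠ r in 𝓝[>] t, impulseCount I r s = impulseCount I t s := by
  obtain ⟨t', htt', ht'⟩ := hI.exists_gt t
  filter_upwards [Ioo_mem_nhdsGT htt'] with r hr
  unfold impulseCount
  congr 1
  ext q
  refine ⟨fun hq => ⟨hq.1, hq.2.1, ?_⟩, fun hq => ⟨hq.1, hq.2.1, hq.2.2.trans hr.1.le⟩⟩
  by_contra! h
  exact ht' q ⟨h, hq.2.2.trans hr.2.le⟩ hq.1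

theorem eventually_impulseCount_left_of_notMem (hI : IsImpulseTimes t₀ I) (hst : s < t)
    (ht : t ∉ I) : ∀ᶠ r in 𝓝[<] t, impulseCount I r s = impulseCount I t s := by
  obtain ⟨t', -, htt', ht'⟩ := hI.exists_lt hst
  filter_upwards [Ioo_mem_nhdsLT htt'] with r hr
  unfold impulseCount
  congr 1
  ext q
  refine ⟨fun hq => ⟨hq.1, hq.2.1, hq.2.2.trans hr.2.le⟩, fun hq => ⟨hq.1, hq.2.1, ?_⟩⟩
  by_contra! h
  rcases hq.2.2.eq_or_lt with rfl | h'
  · exact ht hq.1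
  · exact ht' q ⟨hr.1.trans h, h'⟩ hq.1

theorem eventually_impulseCount_left_of_mem (hI : IsImpulseTimes t₀ I) (hst : s < t)
    (ht : t ∈ I) : ∀ᶠ r in 𝓝[<] t, impulseCount I t s = impulseCount I r s + 1 := by
  obtain ⟨t', -, htt', ht'⟩ := hI.exists_lt hst
  filter_upwards [Ioo_mem_nhdsLT htt'] with r hr
  have : I ∩ Ioc s t = insert t (I ∩ Ioc s r) := by
    ext q
    refine ⟨fun hq => ?_, ?_⟩
    · rcases hq.2.2.eq_or_lt with rfl | h'
      · exact mem_insert _ _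
      · refine mem_insert_of_mem _ ⟨hq.1, hq.2.1, ?_⟩
        by_contra! h
        exact ht' q ⟨hr.1.trans h, h'⟩ hq.1
    · rintro (rfl | hq)
      · exact ⟨ht, hst, le_rfl⟩
      · exact ⟨hq.1, hq.2.1, hq.2.2.trans hr.2.le⟩
  unfold impulseCount
  rw [this, ncard_insert_of_notMem (fun h => absurd h.2.2 (not_le.2 hr.2))
    ((hI.locally_finite r).subset fun q hq => ⟨hq.1, hq.2.2⟩)]

theorem eventually_impulseCount_start (hI : IsImpulseTimes t₀ I) (hst : s ≤ t) (hs : s ∈ I) :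
    ∀ᶠ r in 𝓝[<] s, impulseCount I t r = impulseCount I t s + 1 := by
  obtain ⟨s', -, hss', hs'⟩ := hI.exists_lt (sub_one_lt s)
  filter_upwards [Ioo_mem_nhdsLT hss'] with r hr
  have : I ∩ Ioc r t = insert s (I ∩ Ioc s t) := by
    ext q
    refine ⟨fun hq => ?_, ?_⟩
    · rcases lt_trichotomy q s with h | rfl | h
      · exact absurd hq.1 (hs' q ⟨hr.1.trans hq.2.1, h⟩)
      · exact mem_insert _ _
      · exact mem_insert_of_mem _ ⟨hq.1, h, hq.2.2⟩
    · rintro (rfl | hq)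
      · exact ⟨hs, hr.2, hst⟩
      · exact ⟨hq.1, hr.2.trans hq.2.1, hq.2.2⟩
  unfold impulseCount
  rw [this, ncard_insert_of_notMem (fun h => absurd h.2.1 (lt_irrefl _))
    ((hI.locally_finite t).subset fun q hq => ⟨hq.1, hq.2.2⟩)]

end Count

/-! ### Comparison along impulsive trajectories -/

section Comparison

variable {t₀ : ℝ} {I : Set ℝ} {w : ℝ → ℝ} {c d : ℝ}

/-- A function with `D⁺w ≤ -c w` that is scaled by at most `e^{-d}` at impulses grows at most like
`exp (-d N(t, s) - c (t - s))`. -/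
theorem le_exp_mul_of_impulsive_decay (hI : IsImpulseTimes t₀ I) (hw0 : ∀ r, 0 ≤ w r) {s t : ℝ}
    (hst : s ≤ t)
    (hflow : ∀ τ ∈ Ico s t, ∀ ε > 0, ∀ᶠ r in 𝓝[>] τ, w r ≤ w τ + (r - τ) * (-c * w τ + ε))
    (hleft : ∀ τ ∈ Ioc s t, ∃ l, Tendsto w (𝓝[<] τ) (𝓝 l) ∧
      (τ ∈ I → w τ ≤ Real.exp (-d) * l) ∧ (τ ∉ I → w τ ≤ l)) :
    w t ≤ Real.exp (-d * impulseCount I t s - c * (t - s)) * w s := by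
  set E : ℝ → ℝ := fun τ => Real.exp (-d * impulseCount I τ s - c * (τ - s)) with hE
  have key : ∀ ε > 0, w t ≤ E t * (w s + ε * (t - s)) := by
    intro ε hε
    refine forall_mem_Icc_of_induction (a := s) (b := t)
      (P := fun τ => w τ ≤ E τ * (w s + ε * (τ - s))) ?_ ?_ ?_ t ⟨hst, le_rfl⟩
    · simp [hE, impulseCount_self]
    · intro τ hτ hle
      have hEpos : 0 < E τ := Real.exp_pos _
      have h1 : ∀ᶠ r in 𝓝[>] τ, (1 / 2 : ℝ) < Real.exp (-c * (r - τ)) := by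
        have : Tendsto (fun r => Real.exp (-c * (r - τ))) (𝓝 τ)
            (𝓝 (Real.exp (-c * (τ - τ)))) := Continuous.tendsto (by fun_prop) τ
        rw [sub_self, mul_zero, Real.exp_zero] at this
        exact (this.mono_left nhdsWithin_le_nhds).eventually_const_lt (by norm_num)
      filter_upwards [hflow τ hτ (E τ * ε / 2) (by positivity), h1,
        eventually_impulseCount_right hI, self_mem_nhdsWithin] with r hr1 hr2 hr3 hr4
      have hr4 : 0 < r - τ := sub_pos.2 hr4
      have hEr : E r = E τ * Real.exp (-c * (r - τ)) := by
        simp only [hE]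
        rw [hr3, ← Real.exp_add]
        ring_nf
      -- `(1 - c h) e^{c h} ≤ 1`, so the linear bound on `w` turns into an exponential one
      have h2 : 1 - c * (r - τ) ≤ Real.exp (-c * (r - τ)) := by
        linarith [Real.add_one_le_exp (-c * (r - τ))]
      have h3 := hle τ ⟨hτ.1, le_rfl⟩
      set e := Real.exp (-c * (r - τ))
      calc w r ≤ (1 - c * (r - τ)) * w τ + (r - τ) * (E τ * ε) * (1 / 2) := by
            linarith [hr1]
        _ ≤ e * w τ + (r - τ) * (E τ * ε) * e := by
            refine add_le_add (mul_le_mul_of_nonneg_right h2 (hw0 τ)) ?_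
            exact mul_le_mul_of_nonneg_left hr2.le (by positivity)
        _ ≤ e * (E τ * (w s + ε * (τ - s))) + (r - τ) * (E τ * ε) * e := by
            gcongr
        _ = E r * (w s + ε * (r - s)) := by rw [hEr]; ring
    · intro τ hτ hlt
      obtain ⟨l, hl, hlI, hlI'⟩ := hleft τ hτ
      have hlim : ∀ k : ℕ, (∀ᶠ r in 𝓝[<] τ, impulseCount I r s = k) →
          l ≤ Real.exp (-d * k - c * (τ - s)) * (w s + ε * (τ - s)) := by
        intro k hk
        have h2 : Tendsto (fun r => Real.exp (-d * k - c * (r - s)) * (w s + ε * (r - s)))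
            (𝓝[<] τ) (𝓝 (Real.exp (-d * k - c * (τ - s)) * (w s + ε * (τ - s)))) :=
          (Continuous.tendsto (by fun_prop) τ).mono_left nhdsWithin_le_nhds
        refine le_of_tendsto_of_tendsto hl h2 ?_
        filter_upwards [hk, Ioo_mem_nhdsLT hτ.1] with r hr1 hr2
        have := hlt r ⟨hr2.1.le, hr2.2⟩
        simp only [hE] at this
        rwa [hr1] at this
      by_cases hτI : τ ∈ I
      · have hk : ∀ᶠ r in 𝓝[<] τ, impulseCount I r s = impulseCount I τ s - 1 :=
          (eventually_impulseCount_left_of_mem hI hτ.1 hτI).mono fun r hr => by omega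
        obtain ⟨r, hr⟩ := (eventually_impulseCount_left_of_mem hI hτ.1 hτI).exists
        have hcast : (impulseCount I τ s : ℝ) = ((impulseCount I τ s - 1 : ℕ) : ℝ) + 1 := by
          rw [hr]; simp
        have h1 := hlim _ hk
        calc w τ ≤ Real.exp (-d) * l := hlI hτI
          _ ≤ Real.exp (-d) * (Real.exp (-d * (impulseCount I τ s - 1 : ℕ) - c * (τ - s)) *
                (w s + ε * (τ - s))) := by gcongr
          _ = E τ * (w s + ε * (τ - s)) := by
            simp only [hE]
            rw [← mul_assoc, ← Real.exp_add, hcast]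
            ring_nf
      · exact (hlI' hτI).trans (hlim _ (eventually_impulseCount_left_of_notMem hI hτ.1 hτI))
  have hlim : Tendsto (fun ε => E t * (w s + ε * (t - s))) (𝓝[>] 0)
      (𝓝 (E t * (w s + 0 * (t - s)))) :=
    (Continuous.tendsto (by fun_prop) 0).mono_left nhdsWithin_le_nhds
  rw [zero_mul, add_zero] at hlim
  refine ge_of_tendsto hlim ?_
  filter_upwards [self_mem_nhdsWithin] with ε hε
  exact key ε hε

/-- The Razumikhin comparison: `w` exceeds the envelope `R(t) = max {e^{-λ'(t - t₀)} W₀, U}` at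
most by the factor `e^μ`. After the last time `s` at which `w` was below `R`, the Razumikhin
condition holds as long as `w ≤ K R` in the past, so `w` decays with the rates `c` and `d`, and
the dwell-time condition bounds its overshoot since `s` by `e^μ < K`. -/
theorem le_of_razumikhin {θ b μ lam lam' p K U W₀ : ℝ} (hθ : 0 ≤ θ)
    (hI : I ∈ dwellTimeClass c d μ lam t₀) (hμ : 0 < μ) (hlam' : 0 < lam') (hlam : lam' ≤ lam)
    (hp0 : 0 ≤ p) (hp1 : p ≤ 1) (hK : Real.exp μ < K) (hpK : p * K * Real.exp (lam' * θ) ≤ 1)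
    (hU : 0 < U) (hW₀ : 0 ≤ W₀) (hw : IsCadlag w) (hw0 : ∀ r, 0 ≤ w r)
    (hinit : ∀ s ∈ Icc (t₀ - θ) t₀, w s ≤ W₀)
    (hcont : ∀ s ∈ Ioc t₀ b, s ∉ I → Tendsto w (𝓝[<] s) (𝓝 (w s)))
    (hflow : ∀ s ∈ Ico t₀ b, (∀ r ∈ Icc (s - θ) s, p * w r ≤ w s) → U ≤ w s →
      ∀ ε > 0, ∀ᶠ r in 𝓝[>] s, w r ≤ w s + (r - s) * (-c * w s + ε))
    (hjump : ∀ s ∈ I, t₀ < s → s ≤ b → ∀ S, (∀ r ∈ Ico (s - θ) s, w r ≤ S) →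
      Function.leftLim w s ≤ S →
      w s ≤ max (Real.exp (-d) * Function.leftLim w s)
        (min 1 (Real.exp (-d)) * max (p * S) U)) :
    ∀ t ∈ Icc t₀ b, w t ≤ Real.exp μ * max (Real.exp (-lam' * (t - t₀)) * W₀) U := by
  obtain ⟨hIt, hdwell⟩ := hI
  set R : ℝ → ℝ := fun t => max (Real.exp (-lam' * (t - t₀)) * W₀) U with hR
  have hRc : Continuous R := by fun_prop
  have hRpos : ∀ t, 0 < R t := fun t => hU.trans_le (le_max_right _ _)
  have hRU : ∀ t, U ≤ R t := fun t => le_max_right _ _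
  have hRanti : Antitone R := by
    intro s t hst
    refine max_le_max (mul_le_mul_of_nonneg_right (Real.exp_le_exp.2 ?_) hW₀) le_rfl
    nlinarith
  have hRW : ∀ s ≤ t₀, W₀ ≤ R s := by
    intro s hs
    refine le_trans ?_ (le_max_left _ _)
    refine le_mul_of_one_le_left hW₀ (Real.one_le_exp ?_)
    nlinarith
  have hRθ : ∀ s, R (s - θ) ≤ Real.exp (lam' * θ) * R s := by
    intro s
    refine max_le ?_ ?_
    · calc Real.exp (-lam' * (s - θ - t₀)) * W₀
          = Real.exp (lam' * θ) * (Real.exp (-lam' * (s - t₀)) * W₀) := by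
            rw [← mul_assoc, ← Real.exp_add]; ring_nf
        _ ≤ _ := by gcongr; exact le_max_left _ _
    · exact (hRU s).trans (le_mul_of_one_le_left (hRpos s).le (Real.one_le_exp (by positivity)))
  have hRdecay : ∀ s t, s ≤ t → Real.exp (-lam * (t - s)) * R s ≤ R t := by
    intro s t hst
    have h1 : Real.exp (-lam * (t - s)) ≤ Real.exp (-lam' * (t - s)) :=
      Real.exp_le_exp.2 (by nlinarith)
    refine (mul_le_mul_of_nonneg_right h1 (hRpos s).le).trans ?_
    rw [hR]
    simp only
    rw [mul_max_of_nonneg _ _ (Real.exp_pos _).le]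
    refine max_le_max (le_of_eq ?_) ?_
    · rw [← mul_assoc, ← Real.exp_add]; ring_nf
    · refine mul_le_of_le_one_left hU.le (Real.exp_le_one_iff.2 ?_)
      nlinarith
  have hK1 : 1 < K := (Real.one_lt_exp_iff.2 hμ).trans hK
  have hd0 := Real.exp_pos (-d)
  -- the bound by `e^μ R` at a time before which the weaker bound by `K R` holds
  have core : ∀ t ∈ Icc t₀ b, (∀ s ∈ Ico t₀ t, w s < K * R s) → w t ≤ Real.exp μ * R t := by
    intro t ht hpast
    by_cases hwt : w t ≤ R t
    · exact hwt.trans (le_mul_of_one_le_left (hRpos t).le (Real.one_le_exp hμ.le))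
    set A : Set ℝ := {s | s ∈ Icc t₀ t ∧ w s ≤ R s} with hA
    have hAne : A.Nonempty :=
      ⟨t₀, ⟨le_rfl, ht.1⟩, (hinit t₀ ⟨by linarith, le_rfl⟩).trans (hRW t₀ le_rfl)⟩
    have hAbdd : BddAbove A := ⟨t, fun s hs => hs.1.2⟩
    set s := sSup A with hs
    have hst₀ : t₀ ≤ s := by
      obtain ⟨a, ha⟩ := hAne
      exact ha.1.1.trans (le_csSup hAbdd ha)
    have hst : s ≤ t := csSup_le hAne fun a ha => ha.1.2
    have hafter : ∀ τ ∈ Ioc s t, R τ < w τ := by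
      intro τ hτ
      by_contra! h
      exact absurd (le_csSup hAbdd (⟨⟨hst₀.trans hτ.1.le, hτ.2⟩, h⟩ : τ ∈ A)) (not_le.2 hτ.1)
    have hhist : ∀ τ ≤ t, ∀ r, t₀ ≤ τ → τ - θ ≤ r → r < τ → w r ≤ K * R (τ - θ) := by
      intro τ hτ r h0 h1 h2
      rcases le_total r t₀ with h | h
      · calc w r ≤ W₀ := hinit r ⟨by linarith, h⟩
          _ ≤ R (τ - θ) := hRW _ (by linarith)
          _ ≤ K * R (τ - θ) := le_mul_of_one_le_left (hRpos _).le hK1.le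
      · refine (hpast r ⟨h, h2.trans_le hτ⟩).le.trans ?_
        exact mul_le_mul_of_nonneg_left (hRanti h1) (by linarith)
    have hpKR : ∀ τ, p * (K * R (τ - θ)) ≤ R τ := by
      intro τ
      calc p * (K * R (τ - θ)) ≤ p * (K * (Real.exp (lam' * θ) * R τ)) := by
            have := hRθ τ
            gcongr
        _ = p * K * Real.exp (lam' * θ) * R τ := by ring
        _ ≤ 1 * R τ := mul_le_mul_of_nonneg_right hpK (hRpos τ).le
        _ = R τ := one_mul _
    have hflow' : ∀ τ ∈ Ico s t, R τ ≤ w τ →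
        ∀ ε > 0, ∀ᶠ r in 𝓝[>] τ, w r ≤ w τ + (r - τ) * (-c * w τ + ε) := by
      intro τ hτ hRw
      refine hflow τ ⟨hst₀.trans hτ.1, hτ.2.trans_le ht.2⟩ (fun r hr => ?_) ((hRU τ).trans hRw)
      rcases hr.2.eq_or_lt with rfl | h
      · exact mul_le_of_le_one_left (hw0 r) hp1
      · exact (mul_le_mul_of_nonneg_left (hhist τ hτ.2.le r (hst₀.trans hτ.1) hr.1 h) hp0).trans
          ((hpKR τ).trans hRw)
    have hjump' : ∀ τ ∈ Icc s t, t₀ < τ → τ ∈ I →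
        w τ ≤ Real.exp (-d) * max (Function.leftLim w τ) (R τ) := by
      intro τ hτ h0 hτI
      have h1 := hjump τ hτI h0 (hτ.2.trans ht.2) (K * R (τ - θ))
        (fun r hr => hhist τ hτ.2 r h0.le hr.1 hr.2) ?_
      · refine h1.trans (max_le ?_ ?_)
        · exact mul_le_mul_of_nonneg_left (le_max_left _ _) hd0.le
        · refine mul_le_mul (min_le_right _ _)
            ((max_le (hpKR τ) (hRU τ)).trans (le_max_right _ _)) ?_ hd0.le
          exact hU.le.trans (le_max_right _ _)
      · have hlim : Tendsto (fun r => K * R (r - θ)) (𝓝[<] τ) (𝓝 (K * R (τ - θ))) :=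
          (Continuous.tendsto (by fun_prop) τ).mono_left nhdsWithin_le_nhds
        refine le_of_tendsto_of_tendsto (hw.tendsto_leftLim τ) hlim ?_
        filter_upwards [Ioo_mem_nhdsLT h0] with r hr
        refine (hpast r ⟨hr.1.le, hr.2.trans_le hτ.2⟩).le.trans ?_
        exact mul_le_mul_of_nonneg_left (hRanti (by linarith)) (by linarith)
    have hgrow : R s ≤ w s → w t ≤ Real.exp (-d * impulseCount I t s - c * (t - s)) * w s := by
      intro hRs
      refine le_exp_mul_of_impulsive_decay hIt hw0 hst (fun τ hτ => hflow' τ hτ ?_)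
        fun τ hτ => ⟨_, hw.tendsto_leftLim τ, fun hτI => ?_, fun hτI => ?_⟩
      · rcases hτ.1.eq_or_lt with h | h
        · rwa [← h]
        · exact (hafter τ ⟨h, hτ.2.le⟩).le
      · refine (hjump' τ ⟨hτ.1.le, hτ.2⟩ (hst₀.trans_lt hτ.1) hτI).trans_eq ?_
        rw [max_eq_left]
        refine le_of_tendsto_of_tendsto ((hRc.tendsto τ).mono_left nhdsWithin_le_nhds)
          (hw.tendsto_leftLim τ) ?_
        filter_upwards [Ioo_mem_nhdsLT hτ.1] with r hr
        exact (hafter r ⟨hr.1, hr.2.le.trans hτ.2⟩).le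
      · exact (leftLim_eq_of_tendsto
          (hcont τ ⟨hst₀.trans_lt hτ.1, hτ.2.trans ht.2⟩ hτI)).ge
    -- it remains to bound the growth since `s`
    have hfinal : ∀ a : ℝ, a - (c - lam) * (t - s) ≤ μ →
        Real.exp (a - c * (t - s)) * R s ≤ Real.exp μ * R t := by
      intro a ha
      calc Real.exp (a - c * (t - s)) * R s
          = Real.exp (a - (c - lam) * (t - s)) * (Real.exp (-lam * (t - s)) * R s) := by
            rw [← mul_assoc, ← Real.exp_add]; ring_nf
        _ ≤ Real.exp μ * R t :=
            mul_le_mul (Real.exp_le_exp.2 ha) (hRdecay s t hst)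
              (mul_nonneg (Real.exp_pos _).le (hRpos s).le) (Real.exp_pos _).le
    by_cases hsA : w s ≤ R s
    · have hlt : s < t := lt_of_le_of_ne hst fun h => hwt (h ▸ hsA)
      have hge : R s ≤ w s := by
        refine le_of_tendsto_of_tendsto ((hRc.tendsto s).mono_left nhdsWithin_le_nhds)
          ((hw.right_cont s).tendsto.mono_left (nhdsWithin_mono s Ioi_subset_Ici_self)) ?_
        filter_upwards [Ioo_mem_nhdsGT hlt] with r hr
        exact (hafter r ⟨hr.1, hr.2.le⟩).le
      refine (hgrow hge).trans ?_
      refine le_trans ?_ (hfinal _ (hdwell s t hst₀ hst))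
      exact mul_le_mul_of_nonneg_left hsA (Real.exp_pos _).le
    · -- `w` jumps above `R` at time `s`
      have hsA' : s ∉ A := fun h => hsA h.2
      have hst₀' : t₀ < s := by
        refine lt_of_le_of_ne hst₀ fun h => hsA ?_
        rw [← h]
        exact (hinit t₀ ⟨by linarith, le_rfl⟩).trans (hRW t₀ le_rfl)
      have hl : Function.leftLim w s ≤ R s := by
        by_contra! h
        have hev : ∀ᶠ r in 𝓝[<] s, R r < w r :=
          ((hRc.tendsto s).mono_left nhdsWithin_le_nhds).eventually_lt (hw.tendsto_leftLim s) h
        obtain ⟨e, hes, he⟩ := mem_nhdsLT_iff_exists_Ioo_subset.1 hev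
        obtain ⟨a, haA, hea⟩ := exists_lt_of_lt_csSup hAne hes
        have has : a < s := lt_of_le_of_ne (le_csSup hAbdd haA) fun h => hsA' (h ▸ haA)
        have h1 : R a < w a := he ⟨hea, has⟩
        exact absurd haA.2 (not_le.2 h1)
      have hsI : s ∈ I := by
        by_contra hsI
        rw [leftLim_eq_of_tendsto (hcont s ⟨hst₀', hst.trans ht.2⟩ hsI)] at hl
        exact hsA hl
      have hws : w s ≤ Real.exp (-d) * R s := by
        have := hjump' s ⟨le_rfl, hst⟩ hst₀' hsI
        rwa [max_eq_right hl] at this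
      -- counting from slightly before `s` includes the impulse at `s`
      have hdw : -d * (impulseCount I t s + 1 : ℕ) - (c - lam) * (t - s) ≤ μ := by
        have hlim : Tendsto (fun r => -d * (impulseCount I t s + 1 : ℕ) - (c - lam) * (t - r))
            (𝓝[<] s) (𝓝 (-d * (impulseCount I t s + 1 : ℕ) - (c - lam) * (t - s))) :=
          (Continuous.tendsto (by fun_prop) s).mono_left nhdsWithin_le_nhds
        refine le_of_tendsto hlim ?_
        filter_upwards [eventually_impulseCount_start hIt hst hsI, Ioo_mem_nhdsLT hst₀']
          with r hr1 hr2
        rw [← hr1]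
        exact hdwell r t hr2.1.le (hr2.2.le.trans hst)
      refine (hgrow (not_le.1 hsA).le).trans (le_trans ?_ (hfinal _ hdw))
      calc Real.exp (-d * impulseCount I t s - c * (t - s)) * w s
          ≤ Real.exp (-d * impulseCount I t s - c * (t - s)) * (Real.exp (-d) * R s) := by
            gcongr
        _ = Real.exp (-d * (impulseCount I t s + 1 : ℕ) - c * (t - s)) * R s := by
            rw [← mul_assoc, ← Real.exp_add]
            push_cast
            ring_nf
  have hall : ∀ t ∈ Icc t₀ b, w t < K * R t := by
    refine forall_mem_Icc_of_induction ?_ ?_ ?_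
    · exact ((hinit t₀ ⟨by linarith, le_rfl⟩).trans (hRW t₀ le_rfl)).trans_lt
        (lt_mul_of_one_lt_left (hRpos _) hK1)
    · intro t ht hle
      have hKR : Tendsto (fun r => K * R r) (𝓝[>] t) (𝓝 (K * R t)) :=
        (Continuous.tendsto (by fun_prop) t).mono_left nhdsWithin_le_nhds
      exact ((hw.right_cont t).tendsto.mono_left
        (nhdsWithin_mono t Ioi_subset_Ici_self)).eventually_lt hKR (hle t ⟨ht.1, le_rfl⟩)
    · intro t ht hlt
      exact (core t ⟨ht.1.le, ht.2⟩ hlt).trans_lt (mul_lt_mul_of_pos_right hK (hRpos t))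
  exact fun t ht => core t ht fun s hs => hall s ⟨hs.1, hs.2.le.trans ht.2⟩

end Comparison

/-! ### Input-to-state stability from a Lyapunov–Razumikhin function -/

section Stability

variable {θ : ℝ≥0} {X U : Type*} [NormedAddCommGroup X] [NormedSpace ℝ X] [NormedAddCommGroup U]
  {f g : PC θ X → U → X} {V : X → ℝ≥0} {γu : ℝ≥0 → ℝ≥0} {I : Set ℝ} {t₀ b : ℝ} {ξ : PC θ X}
  {u : ℝ → U} {x : ℝ → X}

/-- Between impulses, a solution solves the impulse-free equation started from its own history. -/
theorem SolvesOn.isSolution_empty (hx : SolvesOn f g I t₀ b ξ u x) (hxp : IsPCPath x)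
    (hI : IsImpulseTimes t₀ I) {s : ℝ} (hs : s ∈ Ico t₀ b) :
    ∃ T : ℝ, s < T ∧ IsSolution f g ∅ s T (hist θ x s) u x := by
  obtain ⟨t₁, hst₁, ht₁⟩ := hI.exists_gt s
  refine ⟨min t₁ b, lt_min hst₁ hs.2, fun τ => (hxp.hist_apply s τ).symm, ?_, by simp⟩
  intro a c ha hac hc _
  have hc' : c < min t₁ b := EReal.coe_lt_coe_iff.1 hc
  exact hx.flow a c (hs.1.trans ha) hac (hc'.le.trans (min_le_right _ _)) fun t ht =>
    ht₁ t ⟨ha.trans_lt ht.1, ht.2.trans (hc'.le.trans (min_le_left _ _))⟩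

/-- A real number `lam'` and a factor `K` with the slack that the comparison needs. -/
theorem exists_rate_of_lt_exp {p μ lam θ : ℝ} (hp : p < Real.exp (-μ)) (hlam : 0 < lam) :
    ∃ lam' K : ℝ, 0 < lam' ∧ lam' ≤ lam ∧ Real.exp μ < K ∧
      p * K * Real.exp (lam' * θ) ≤ 1 := by
  have hlim : Tendsto (fun r : ℝ => p * Real.exp (μ + r) * Real.exp (r * θ)) (𝓝[>] 0)
      (𝓝 (p * Real.exp (μ + 0) * Real.exp (0 * θ))) :=
    (Continuous.tendsto (by fun_prop) 0).mono_left nhdsWithin_le_nhds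
  have h1 : p * Real.exp (μ + 0) * Real.exp (0 * θ) < 1 := by
    rw [add_zero, zero_mul, Real.exp_zero, mul_one]
    calc p * Real.exp μ < Real.exp (-μ) * Real.exp μ :=
          mul_lt_mul_of_pos_right hp (Real.exp_pos _)
      _ = 1 := by rw [← Real.exp_add]; simp
  obtain ⟨r, hr1, hr2⟩ := ((hlim.eventually_lt_const h1).and (Ioo_mem_nhdsGT hlam)).exists
  exact ⟨r, Real.exp (μ + r), hr2.1, hr2.2.le,
    Real.exp_lt_exp.2 (lt_add_of_pos_right _ hr2.1), hr1.le⟩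

/-- The decay estimate for `V` along solutions. Besides the Lyapunov–Razumikhin inequalities,
it uses a bound for `V` at impulses that needs no lower bound for `V(φ(0))`. -/
theorem SolvesOn.lyapunov_estimate {c d μ lam lam' K : ℝ} {p : ℝ≥0}
    (hV : IsExpLyapunovRazumikhin f g V c d (fun r => p * r) γu)
    (hVg : ∀ φ v, (V (g φ v) : ℝ) ≤ max (Real.exp (-d) * V (φ (now θ)))
      (min 1 (Real.exp (-d)) * max (p * supV V φ : ℝ) (γu ‖v‖₊)))
    (hI : I ∈ dwellTimeClass c d μ lam t₀) (hμ : 0 < μ) (hlam' : 0 < lam') (hlam : lam' ≤ lam)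
    (hp1 : p ≤ 1) (hK : Real.exp μ < K) (hpK : p * K * Real.exp (lam' * θ) ≤ 1)
    (hu : IsCadlag u) (htb : t₀ ≤ b) (hx : SolvesOn f g I t₀ b ξ u x) (hxp : IsPCPath x) :
    (V (x b) : ℝ) ≤ Real.exp μ *
      max (Real.exp (-lam' * (b - t₀)) * supV V ξ) (γu (supNormOn u t₀ b)) := by
  have hθ : (0 : ℝ) ≤ θ := θ.2
  have hγu : Monotone γu := by
    rcases hV.gain_u with h | h
    · exact h.strictMono.monotone
    · rw [h]; exact monotone_const
  set w : ℝ → ℝ := fun s => V (x s) with hw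
  have hVc : Continuous fun y => (V y : ℝ) := NNReal.continuous_coe.comp hV.continuous
  have hwc : IsCadlag w := hxp.toIsCadlag.comp hVc
  have hleft : ∀ s, Function.leftLim w s = V (Function.leftLim x s) := fun s =>
    leftLim_eq_of_tendsto ((hVc.tendsto _).comp (hxp.tendsto_leftLim s))
  -- the comparison needs a positive bound `W` for the input
  have key : ∀ W : ℝ, (γu (supNormOn u t₀ b) : ℝ) < W → w b ≤ Real.exp μ *
      max (Real.exp (-lam' * (b - t₀)) * supV V ξ) W := by
    intro W hW
    have hW0 : 0 < W := (NNReal.coe_nonneg _).trans_lt hW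
    refine le_of_razumikhin (p := p) (b := b) hθ hI hμ hlam' hlam p.2 (by exact_mod_cast hp1)
      hK hpK hW0 (NNReal.coe_nonneg _) hwc (fun r => NNReal.coe_nonneg _) ?_ ?_ ?_ ?_ b
      ⟨htb, le_rfl⟩
    · intro s hs
      simp only [hw]
      rw [hx.eq_initial hs]
      exact NNReal.coe_le_coe.2 (le_supV hV.continuous ξ _)
    · intro s hs hsI
      obtain ⟨a, hta, has, ha⟩ := hI.1.exists_lt hs.1
      have hno : ∀ r ∈ Ioc a s, r ∉ I := fun r hr => by
        rcases hr.2.eq_or_lt with h | h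
        · rwa [h]
        · exact ha r ⟨hr.1, h⟩
      have h1 := hx.continuousOn hta.le has.le hs.2 hno s ⟨has.le, le_rfl⟩
      have h2 : Tendsto x (𝓝[<] s) (𝓝 (x s)) :=
        h1.tendsto.mono_left (nhdsWithin_le_of_mem (Icc_mem_nhdsLT has))
      exact (hVc.tendsto _).comp h2
    · intro s hs hpast hWs ε hε
      obtain ⟨T, hsT, hsol⟩ := hx.isSolution_empty hxp hI.1 hs
      have hcond : max (p * supV V (hist θ x s)) (γu ‖u s‖₊) ≤ V (hist θ x s (now θ)) := by
        rw [hxp.hist_now]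
        refine max_le ?_ ?_
        · rw [supV, NNReal.mul_iSup]
          refine ciSup_le' fun τ => ?_
          rw [hxp.hist_apply]
          exact_mod_cast hpast (s + τ) ⟨by linarith [τ.2.1], by linarith [τ.2.2]⟩
        · refine (hγu (hu.nnnorm_le_supNormOn ⟨hs.1, hs.2.le⟩)).trans ?_
          exact_mod_cast hW.le.trans hWs
      have hD := hV.flow (hist θ x s) (u s) hcond s T u x (EReal.coe_lt_coe_iff.2 hsT) hu rfl hsol
      rw [hxp.hist_now] at hD
      exact eventually_le_of_upperRightDeriv_le hD hε
    · intro s hsI h0 hsb S hS hlS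
      have hval : w s = V (g (histLeft θ x s) (Function.leftLim u s)) := by
        simp only [hw, (hx.jump s hsI h0 hsb).2]
      have h1 := hVg (histLeft θ x s) (Function.leftLim u s)
      rw [hxp.histLeft_now, ← hleft, ← hval] at h1
      refine h1.trans (max_le_max le_rfl ?_)
      refine mul_le_mul_of_nonneg_left (max_le_max ?_ ?_) (le_min zero_le_one (Real.exp_pos _).le)
      · have hS0 : 0 ≤ S := le_trans (by rw [hleft]; exact NNReal.coe_nonneg _) hlS
        lift S to ℝ≥0 using hS0
        have h2 : supV V (histLeft θ x s) ≤ S := by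
          refine supV_le fun τ => ?_
          rw [hxp.histLeft_apply]
          rcases eq_or_ne τ (now θ) with rfl | hτ
          · rw [Function.update_self, ← NNReal.coe_le_coe, ← hleft]
            exact hlS
          · rw [Function.update_of_ne hτ, ← NNReal.coe_le_coe]
            have hτ0 : (τ : ℝ) < 0 := lt_of_le_of_ne τ.2.2 fun h => hτ (Subtype.ext h)
            exact hS _ ⟨by linarith [τ.2.1], by linarith⟩
        exact mul_le_mul_of_nonneg_left (NNReal.coe_le_coe.2 h2) p.2
      · refine le_trans ?_ hW.le
        exact NNReal.coe_le_coe.2 (hγu (hu.nnnorm_leftLim_le_supNormOn h0 hsb))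
  have hlim : Tendsto (fun W : ℝ => Real.exp μ *
      max (Real.exp (-lam' * (b - t₀)) * supV V ξ) W) (𝓝[>] (γu (supNormOn u t₀ b) : ℝ))
      (𝓝 (Real.exp μ * max (Real.exp (-lam' * (b - t₀)) * supV V ξ)
        (γu (supNormOn u t₀ b) : ℝ))) :=
    (Continuous.tendsto (by fun_prop) _).mono_left nhdsWithin_le_nhds
  refine ge_of_tendsto hlim ?_
  filter_upwards [self_mem_nhdsWithin] with W hW
  exact key W hW

theorem supNormOn_mono (hu : IsCadlag u) {a b c : ℝ} (hab : a ≤ b) (hbc : b ≤ c) :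
    supNormOn u a b ≤ supNormOn u a c := by
  refine csSup_le ((nonempty_Icc.2 hab).image _) ?_
  rintro _ ⟨s, hs, rfl⟩
  exact hu.nnnorm_le_supNormOn ⟨hs.1, hs.2.trans hbc⟩

/-- A Lyapunov–Razumikhin function whose gain is smaller than `e^{-μ}` makes the system uniformly
ISS over the impulse time sequences that satisfy the dwell-time condition. -/
theorem uniformlyISS_of_lyapunovRazumikhin [CompleteSpace X] {c d μ lam : ℝ} {p : ℝ≥0}
    (hf : LipschitzOnBoundedSets f) (hm : MeasurableAlong f)
    (hV : IsExpLyapunovRazumikhin f g V c d (fun r => p * r) γu)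
    (hVg : ∀ φ v, (V (g φ v) : ℝ) ≤ max (Real.exp (-d) * V (φ (now θ)))
      (min 1 (Real.exp (-d)) * max (p * supV V φ : ℝ) (γu ‖v‖₊)))
    (hμ : 0 < μ) (hlam : 0 < lam) (hp : (p : ℝ) < Real.exp (-μ)) :
    UniformlyISS f g (dwellTimeClass c d μ lam) := by
  obtain ⟨lam', K, hlam'0, hlam', hK, hpK⟩ := exists_rate_of_lt_exp (θ := θ) hp hlam
  have hp1 : p ≤ 1 := by
    have : (p : ℝ) ≤ 1 := hp.le.trans (Real.exp_le_one_iff.2 (by linarith))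
    exact_mod_cast this
  obtain ⟨ψ₁, ψ₂, hψ₁, hψ₂, hψ⟩ := hV.bounds
  obtain ⟨χ, hχ, hχψ⟩ := hψ₁.exists_inverse
  have hγu : Continuous γu ∧ Monotone γu ∧ γu 0 = 0 := by
    rcases hV.gain_u with h | h
    · exact ⟨h.continuous, h.strictMono.monotone, h.map_zero⟩
    · rw [h]; exact ⟨continuous_const, monotone_const, rfl⟩
  let E : ℝ≥0 → ℝ≥0 := fun t => (Real.exp (μ - lam' * t)).toNNReal
  have hE : ∀ t, (E t : ℝ) = Real.exp (μ - lam' * t) := fun t =>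
    Real.coe_toNNReal _ (Real.exp_pos _).le
  have hE0 : ∀ t, 0 < E t := fun t => Real.toNNReal_pos.2 (Real.exp_pos _)
  have hEc : Continuous E := by fun_prop
  have hEa : Antitone E := by
    intro s t hst
    rw [← NNReal.coe_le_coe, hE, hE]
    have : (s : ℝ) ≤ t := hst
    exact Real.exp_le_exp.2 (by nlinarith)
  have hElim : Tendsto E atTop (𝓝 0) := by
    rw [← NNReal.tendsto_coe]
    simp only [hE]
    refine Real.tendsto_exp_atBot.comp ?_
    refine tendsto_atBot_add_const_left _ μ (f := fun t : ℝ≥0 => -(lam' * (t : ℝ))) ?_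
    exact tendsto_neg_atTop_atBot.comp
      ((NNReal.tendsto_coe_atTop.2 tendsto_id).const_mul_atTop hlam'0)
  -- the estimate `V(x(t)) ≤ max {e^{μ - λ'(t - t₀)} ψ₂(|ξ|), e^μ γ_u(|u|)}` is inverted by
  -- `χ = ψ₁⁻¹`; the identity is added to `γ` since `γ_u` may be bounded
  let β : ℝ≥0 → ℝ≥0 → ℝ≥0 := fun r t => χ (E t * ψ₂ r)
  let γ : ℝ≥0 → ℝ≥0 := fun r => χ (E 0 * γu r) + r
  have hβ : IsClassKL β := by
    refine ⟨fun t => ⟨?_, ?_, ?_⟩, fun r => ⟨?_, ?_, ?_⟩⟩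
    · exact hχ.continuous.comp (continuous_const.mul hψ₂.continuous)
    · simp [β, hψ₂.map_zero, hχ.map_zero]
    · exact fun r r' h => hχ.strictMono (mul_lt_mul_of_pos_left (hψ₂.strictMono h) (hE0 t))
    · exact hχ.continuous.comp (hEc.mul continuous_const)
    · exact fun s t h => hχ.strictMono.monotone (mul_le_mul_left (hEa h) _)
    · have h1 : Tendsto (fun t => E t * ψ₂ r) atTop (𝓝 (0 * ψ₂ r)) := hElim.mul_const _
      rw [zero_mul] at h1
      have h2 := (hχ.continuous.tendsto 0).comp h1
      rwa [hχ.map_zero] at h2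
  have hγ0 : Monotone fun r => χ (E 0 * γu r) := fun r r' h =>
    hχ.strictMono.monotone (mul_le_mul_right (hγu.2.1 h) _)
  have hγ : IsClassKInf γ := by
    refine .of_tendsto ?_ ?_ (hγ0.add_strictMono strictMono_id) fun C => ⟨C, le_add_self⟩
    · exact (hχ.continuous.comp (continuous_const.mul hγu.1)).add continuous_id
    · simp [γ, hγu.2.2, hχ.map_zero]
  have hest : ∀ (t₀ : ℝ), ∀ I ∈ dwellTimeClass c d μ lam t₀, ∀ (ξ : PC θ X) (u : ℝ → U),
      IsCadlag u → ∀ b, t₀ ≤ b → ∀ x, IsPCPath x → SolvesOn f g I t₀ b ξ u x →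
      ‖x b‖₊ ≤ max (β (supNorm ξ) (b - t₀).toNNReal) (γ (supNormOn u t₀ b)) := by
    intro t₀ I hI ξ u hu b htb x hxp hx
    have h1 := hx.lyapunov_estimate hV hVg hI hμ hlam'0 hlam' hp1 hK hpK hu htb hxp
    have hξ : supV V ξ ≤ ψ₂ (supNorm ξ) := supV_le fun τ =>
      (hψ _).2.trans (hψ₂.strictMono.monotone (nnnorm_le_supNorm ξ τ))
    have h2 : V (x b) ≤ max (E (b - t₀).toNNReal * ψ₂ (supNorm ξ))
        (E 0 * γu (supNormOn u t₀ b)) := by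
      rw [← NNReal.coe_le_coe]
      refine h1.trans ?_
      rw [mul_max_of_nonneg _ _ (Real.exp_pos _).le, NNReal.coe_max, NNReal.coe_mul,
        NNReal.coe_mul, hE, hE, Real.coe_toNNReal _ (sub_nonneg.2 htb), NNReal.coe_zero, mul_zero,
        sub_zero, ← mul_assoc, ← Real.exp_add]
      refine max_le_max ?_ le_rfl
      have : μ + -lam' * (b - t₀) = μ - lam' * (b - t₀) := by ring
      rw [this]
      exact mul_le_mul_of_nonneg_left (NNReal.coe_le_coe.2 hξ) (Real.exp_pos _).le
    have h3 := hχψ _ _ ((hψ (x b)).1.trans h2)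
    rw [hχ.strictMono.monotone.map_max] at h3
    exact h3.trans (max_le_max le_rfl le_self_add)
  refine ⟨β, γ, hβ, hγ, fun t₀ I hI ξ u hu => ?_⟩
  obtain ⟨x, hx, huniq, hxb⟩ := exists_unique_isSolution (f := f) (g := g) (ξ := ξ) hf hm hI.1 hu
    (fun b _ => by
      refine ⟨max (β (supNorm ξ) 0) (γ (supNormOn u t₀ b)), fun c hc x hxp hx t ht => ?_⟩
      refine (hest t₀ I hI ξ u hu t ht.1 x hxp (hx.mono ht.2)).trans (max_le_max ?_ ?_)
      · exact (hβ.classL _).antitone zero_le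
      · exact hγ.strictMono.monotone (supNormOn_mono hu ht.1 (ht.2.trans hc.2)))
  refine ⟨x, hx, huniq, fun t ht => ?_⟩
  obtain ⟨x', hxp', hx', heq⟩ := hxb t ht
  rw [heq]
  exact hest t₀ I hI ξ u hu t ht x' hxp' hx'

end Stability

/-! ### The network as a single system -/

section Network

variable {n : ℕ} {θ : ℝ≥0} {N M : Fin n → ℕ}

theorem nnnorm_stacked_le (x : Stacked N) : ‖x‖₊ ≤ ∑ i, ‖x i‖₊ := by
  rw [← NNReal.coe_le_coe, coe_nnnorm, PiLp.norm_eq_of_L2, NNReal.coe_sum]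
  refine Real.sqrt_le_iff.2 ⟨by positivity, ?_⟩
  exact Finset.sum_sq_le_sq_sum_of_nonneg fun i _ => norm_nonneg _

theorem supNorm_component_le (φ : PC θ (Stacked N)) (j : Fin n) :
    supNorm (φ.component j) ≤ supNorm φ :=
  supNorm_le fun τ => (PiLp.nnnorm_apply_le (φ τ) j).trans (nnnorm_le_supNorm φ τ)

theorem supDist_component_le (φ ψ : PC θ (Stacked N)) (j : Fin n) :
    supDist (φ.component j) (ψ.component j) ≤ supDist φ ψ :=
  supDist_le fun τ => (PiLp.nnnorm_apply_le (φ τ - ψ τ) j).trans (nnnorm_sub_le_supDist φ ψ τ)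

theorem hist_component {x : ℝ → Stacked N} (hx : IsPCPath x) (t : ℝ) (j : Fin n) :
    (hist θ x t).component j = hist θ (fun s => x s j) t := by
  have hxj : IsPCPath fun s => x s j := hx.comp (p := fun y : Stacked N => y j) (by fun_prop)
  refine PC.ext_fun fun τ => ?_
  rw [hxj.hist_apply]
  exact congrArg (fun y : Stacked N => y j) (hx.hist_apply t τ)

theorem lipschitzOnBoundedSets_network {f : SubsystemMaps θ N M}
    (hf : ∀ i, LipschitzOnBounded (f i)) : LipschitzOnBoundedSets (network f) := by
  intro R
  choose L hL using fun i => hf i R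
  refine ⟨∑ i, L i * (n + 1), fun φ ψ v w hφ hψ hv hw => ?_⟩
  refine (nnnorm_stacked_le _).trans ?_
  rw [Finset.sum_mul]
  refine Finset.sum_le_sum fun i _ => ?_
  refine (hL i (fun j => φ.component j) (fun j => ψ.component j) (v i) (w i)
    (fun j => (supNorm_component_le φ j).trans hφ) (fun j => (supNorm_component_le ψ j).trans hψ)
    ((PiLp.nnnorm_apply_le v i).trans hv) ((PiLp.nnnorm_apply_le w i).trans hw)).trans ?_
  rw [mul_assoc]
  gcongr
  calc (∑ j, supDist (φ.component j) (ψ.component j)) + ‖v i - w i‖₊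
      ≤ (∑ _j : Fin n, supDist φ ψ) + ‖v - w‖₊ := by
        gcongr with j
        · exact supDist_component_le φ ψ j
        · exact PiLp.nnnorm_apply_le (v - w) i
    _ = n * supDist φ ψ + ‖v - w‖₊ := by simp
    _ ≤ (n + 1) * supDist φ ψ + (n + 1) * ‖v - w‖₊ := by
        gcongr
        · exact le_self_add
        · exact le_mul_of_one_le_left zero_le le_add_self
    _ = (n + 1) * (supDist φ ψ + ‖v - w‖₊) := by ring

theorem measurableAlong_network {f : SubsystemMaps θ N M}
    (hf : ∀ i, MeasurableAlongPaths (f i)) : MeasurableAlong (network f) := by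
  intro x u hx hu
  have h1 : ∀ i, AEStronglyMeasurable
      (fun t => f i (fun j => (hist θ x t).component j) (u t i)) volume := by
    intro i
    have := hf i (fun j s => x s j) (fun s => u s i)
      (fun j => hx.comp (p := fun y : Stacked N => y j) (by fun_prop))
      (hu.comp (p := fun y : Stacked M => y i) (by fun_prop))
    simpa only [hist_component hx] using this
  have h2 : AEStronglyMeasurable
      (fun t i => f i (fun j => (hist θ x t).component j) (u t i)) volume :=
    (aemeasurable_pi_lambda _ fun i => (h1 i).aemeasurable).aestronglyMeasurable
  exact (PiLp.continuous_toLp 2 _).comp_aestronglyMeasurable h2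

/-! ### The Lyapunov–Razumikhin function of the network -/

variable {V : ∀ i, EuclideanSpace ℝ (Fin (N i)) → ℝ≥0} {s : Fin n → ℝ≥0}

theorem sup_eq_zero {a : Fin n → ℝ≥0} (h : ∀ i, a i = 0) : Finset.univ.sup a = 0 :=
  (Finset.sup_eq_bot_iff _ _).2 fun i _ => h i

theorem exists_networkV_eq (hn : 0 < n) (V : ∀ i, EuclideanSpace ℝ (Fin (N i)) → ℝ≥0)
    (s : Fin n → ℝ≥0) (x : Stacked N) : ∃ i, networkV V s x = V i (x i) / s i := by
  have : Nonempty (Fin n) := ⟨⟨0, hn⟩⟩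
  obtain ⟨i, -, hi⟩ := Finset.exists_mem_eq_sup Finset.univ Finset.univ_nonempty
    fun i => V i (x i) / s i
  exact ⟨i, hi⟩

theorem div_le_networkV (V : ∀ i, EuclideanSpace ℝ (Fin (N i)) → ℝ≥0) (s : Fin n → ℝ≥0)
    (x : Stacked N) (i : Fin n) : V i (x i) / s i ≤ networkV V s x :=
  Finset.le_sup (f := fun i => V i (x i) / s i) (Finset.mem_univ i)

theorem le_mul_networkV (hs : ∀ i, 0 < s i) (x : Stacked N) (i : Fin n) :
    V i (x i) ≤ s i * networkV V s x := by
  rw [← div_le_iff₀' (hs i)]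
  exact div_le_networkV V s x i

theorem continuous_networkV (hV : ∀ i, Continuous (V i)) : Continuous (networkV V s) := by
  unfold networkV
  refine Continuous.finset_sup_apply fun i _ => ?_
  have := hV i
  fun_prop

theorem networkV_eq_zero_iff (hs : ∀ i, 0 < s i) (hV : ∀ i x, V i x = 0 ↔ x = 0)
    (x : Stacked N) : networkV V s x = 0 ↔ x = 0 := by
  rw [networkV, ← bot_eq_zero, Finset.sup_eq_bot_iff]
  constructor
  · intro h
    ext1 i
    have := h i (Finset.mem_univ i)
    rw [bot_eq_zero, div_eq_zero_iff, or_iff_left (hs i).ne', hV] at this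
    exact this
  · rintro rfl i -
    rw [bot_eq_zero, div_eq_zero_iff, hV]
    exact Or.inl rfl

theorem tendsto_networkV_atTop (hs : ∀ i, 0 < s i)
    (hV : ∀ i, Tendsto (V i) (Bornology.cobounded _) atTop) :
    Tendsto (networkV V s) (Bornology.cobounded (Stacked N)) atTop := by
  refine tendsto_atTop.2 fun C => ?_
  have h1 : ∀ i, ∃ R : ℝ, ∀ y, R ≤ ‖y‖ → s i * C ≤ V i y := by
    intro i
    obtain ⟨R, -, hR⟩ := hasBasis_cobounded_norm.eventually_iff.1
      ((hV i).eventually_ge_atTop (s i * C))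
    exact ⟨R, fun y hy => hR hy⟩
  choose R hR using h1
  refine hasBasis_cobounded_norm.eventually_iff.2
    ⟨∑ i, max (R i) 0 + 1, trivial, fun x (hx : _ ≤ ‖x‖) => ?_⟩
  by_contra! hlt
  have h2 : ∀ i, ‖x i‖ ≤ max (R i) 0 := by
    intro i
    by_contra! h
    have h3 := (hR i (x i) ((le_max_left _ _).trans h.le)).trans (le_mul_networkV hs x i)
    exact absurd (le_of_mul_le_mul_left h3 (hs i)) (not_le.2 hlt)
  have h3 : ‖x‖ ≤ ∑ i, ‖x i‖ := by simpa using NNReal.coe_le_coe.2 (nnnorm_stacked_le x)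
  have h4 : ∑ i, ‖x i‖ ≤ ∑ i, max (R i) 0 := Finset.sum_le_sum fun i _ => h2 i
  linarith

theorem exists_lipschitzOnWith_sup {J : Finset (Fin n)} {x : Stacked N}
    (h : ∀ i ∈ J, ∃ K, ∃ t ∈ 𝓝 (x i), LipschitzOnWith K (V i) t) :
    ∃ K, ∃ t ∈ 𝓝 x, LipschitzOnWith K (fun y : Stacked N => J.sup fun i => V i (y i) / s i) t := by
  choose! K t ht hK using h
  let T : Set (Stacked N) := ⋂ i ∈ J, (fun y : Stacked N => y i) ⁻¹' t i
  have hT : T ∈ 𝓝 x := by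
    refine (Filter.biInter_finset_mem J).2 fun i hi => ?_
    have : Continuous fun y : Stacked N => y i := by fun_prop
    exact this.continuousAt.preimage_mem_nhds (ht i hi)
  refine ⟨J.sup fun i => K i / s i, T, hT, LipschitzOnWith.of_dist_le_mul fun y hy z hz => ?_⟩
  have key : ∀ y ∈ T, ∀ z ∈ T, (J.sup fun i => V i (y i) / s i) ≤
      (J.sup fun i => V i (z i) / s i) + (J.sup fun i => K i / s i) * nndist y z := by
    intro y hy z hz
    refine Finset.sup_le fun i hi => ?_
    have hyi : y i ∈ t i := mem_iInter₂.1 hy i hi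
    have hzi : z i ∈ t i := mem_iInter₂.1 hz i hi
    have h1 : V i (y i) ≤ V i (z i) + K i * nndist (y i) (z i) := by
      have h2 := (hK i hi).dist_le_mul _ hyi _ hzi
      rw [NNReal.dist_eq] at h2
      have h3 := (le_abs_self _).trans h2
      rw [← NNReal.coe_le_coe]
      push_cast
      linarith
    have h4 : nndist (y i) (z i) ≤ nndist y z := by
      rw [nndist_eq_nnnorm, nndist_eq_nnnorm]
      exact PiLp.nnnorm_apply_le (y - z) i
    calc V i (y i) / s i ≤ (V i (z i) + K i * nndist y z) / s i := by
          gcongr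
          exact h1.trans (by gcongr)
      _ = V i (z i) / s i + K i / s i * nndist y z := by rw [add_div, div_mul_eq_mul_div]
      _ ≤ _ := by
          gcongr
          · exact Finset.le_sup (f := fun i => V i (z i) / s i) hi
          · exact Finset.le_sup (f := fun i => K i / s i) hi
  rw [NNReal.dist_eq, abs_sub_le_iff]
  have h1 : _ ≤ ((_ : ℝ≥0) : ℝ) := NNReal.coe_le_coe.2 (key y hy z hz)
  have h2 : _ ≤ ((_ : ℝ≥0) : ℝ) := NNReal.coe_le_coe.2 (key z hz y hy)
  rw [nndist_comm] at h2
  push_cast at h1 h2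
  constructor <;> linarith

theorem locallyLipschitz_networkV (hV : ∀ i, LocallyLipschitz (V i)) :
    LocallyLipschitz (networkV V s) := fun x =>
  exists_lipschitzOnWith_sup fun i _ => hV i (x i)

/-- Near `x ≠ 0`, the indices `i` with `xᵢ = 0` do not contribute to the maximum. -/
theorem locallyLipschitzOn_networkV (hs : ∀ i, 0 < s i) (hc : ∀ i, Continuous (V i))
    (h0 : ∀ i x, V i x = 0 ↔ x = 0) (hV : ∀ i, LocallyLipschitzOn {0}ᶜ (V i)) :
    LocallyLipschitzOn {0}ᶜ (networkV V s) := by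
  classical
  intro x hx
  let J : Finset (Fin n) := Finset.univ.filter fun i => x i ≠ 0
  obtain ⟨K, t, ht, hK⟩ := exists_lipschitzOnWith_sup (V := V) (s := s) (J := J) (x := x)
    fun i hi => by
      have hi : x i ≠ 0 := (Finset.mem_filter.1 hi).2
      obtain ⟨K, t, ht, hK⟩ := hV i hi
      rw [isOpen_compl_singleton.nhdsWithin_eq hi] at ht
      exact ⟨K, t, ht, hK⟩
  let W : Stacked N → ℝ≥0 := fun y => J.sup fun i => V i (y i) / s i
  have hWc : Continuous W := Continuous.finset_sup_apply fun i _ => by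
    have := hc i
    fun_prop
  have hWx : 0 < W x := by
    obtain ⟨i, hi⟩ : ∃ i, x i ≠ 0 := by
      by_contra! h
      exact hx (PiLp.ext h)
    have h1 : 0 < V i (x i) / s i := div_pos (pos_iff_ne_zero.2 ((h0 i _).not.2 hi)) (hs i)
    exact h1.trans_le (Finset.le_sup (f := fun i => V i (x i) / s i) (by simp [J, hi]))
  have hev : ∀ᶠ y in 𝓝 x, ∀ i ∉ J, V i (y i) / s i < W y := by
    refine Filter.eventually_all.2 fun i => ?_
    by_cases hi : i ∈ J
    · exact Filter.Eventually.of_forall fun _ h => absurd hi h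
    · have hxi : V i (x i) / s i = 0 := by
        have : x i = 0 := by simpa [J] using hi
        rw [this, (h0 i 0).2 rfl, zero_div]
      have hci : Continuous fun y : Stacked N => V i (y i) / s i := by
        have := hc i
        fun_prop
      have h1 := (hci.tendsto x).eventually_lt (hWc.tendsto x) (by rw [hxi]; exact hWx)
      exact h1.mono fun y hy _ => hy
  refine ⟨K, t ∩ {y | ∀ i ∉ J, V i (y i) / s i < W y}, mem_nhdsWithin_of_mem_nhds
    (inter_mem ht hev), ?_⟩
  have heq : EqOn (networkV V s) W (t ∩ {y | ∀ i ∉ J, V i (y i) / s i < W y}) := by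
    intro y hy
    refine le_antisymm (Finset.sup_le fun i _ => ?_) (Finset.sup_mono (Finset.subset_univ J))
    by_cases hi : i ∈ J
    · exact Finset.le_sup (f := fun i => V i (y i) / s i) hi
    · exact (hy.2 i hi).le
  intro y hy z hz
  rw [heq hy, heq hz]
  exact hK hy.1 hz.1

/-! ### Gains of the network -/

variable {γ : Matrix (Fin n) (Fin n) ℝ≥0} {γu : Fin n → ℝ≥0 → ℝ≥0} {d : ℝ}

/-- The linear coefficient `max {e^d, 1} max_{k,j} γₖⱼ sⱼ / sₖ` of the gain `γ_t`. -/
noncomputable def networkGainCoeff (γ : Matrix (Fin n) (Fin n) ℝ≥0) (s : Fin n → ℝ≥0) (d : ℝ) :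
    ℝ≥0 :=
  max (Real.exp d).toNNReal 1 *
    Finset.univ.sup fun k => Finset.univ.sup fun j => γ k j * s j / s k

theorem gain_le_sup (γ : Matrix (Fin n) (Fin n) ℝ≥0) (s : Fin n → ℝ≥0) (k j : Fin n) :
    γ k j * s j / s k ≤
      Finset.univ.sup fun k => Finset.univ.sup fun j => γ k j * s j / s k :=
  (Finset.le_sup (f := fun j => γ k j * s j / s k) (Finset.mem_univ j)).trans
    (Finset.le_sup (f := fun k => Finset.univ.sup fun j => γ k j * s j / s k) (Finset.mem_univ k))

theorem gain_le_networkGainCoeff (γ : Matrix (Fin n) (Fin n) ℝ≥0) (s : Fin n → ℝ≥0) (d : ℝ)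
    (k j : Fin n) : γ k j * s j / s k ≤ networkGainCoeff γ s d :=
  (gain_le_sup γ s k j).trans (le_mul_of_one_le_left zero_le (le_max_right _ _))

theorem div_le_networkGainU (γu : Fin n → ℝ≥0 → ℝ≥0) (s : Fin n → ℝ≥0) (d : ℝ) (i : Fin n)
    (r : ℝ≥0) : γu i r / s i ≤ networkGainU γu s d r :=
  (Finset.le_sup (f := fun i => γu i r / s i) (Finset.mem_univ i)).trans
    (le_mul_of_one_le_left zero_le (le_max_right _ _))

theorem min_mul_max_exp (d : ℝ) :
    min 1 (Real.exp (-d)) * ((max (Real.exp d).toNNReal 1 : ℝ≥0) : ℝ) = 1 := by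
  rw [NNReal.coe_max, Real.coe_toNNReal _ (Real.exp_pos d).le, NNReal.coe_one, Real.exp_neg]
  have h := Real.exp_pos d
  rcases le_total 1 (Real.exp d) with h1 | h1
  · rw [max_eq_left h1, min_eq_right (inv_le_one_of_one_le₀ h1), inv_mul_cancel₀ h.ne']
  · rw [max_eq_right h1, min_eq_left ((one_le_inv₀ h).2 h1), mul_one]

/-- The small-gain condition makes the gain of the network smaller than `e^{-μ}`. -/
theorem networkGainCoeff_lt (hn : 0 < n) {μ : ℝ}
    (hs : IsDecayVector γ (min (Real.exp (-μ)) (Real.exp (-d - μ))) s) :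
    (networkGainCoeff γ s d : ℝ) < Real.exp (-μ) := by
  have : Nonempty (Fin n) := ⟨⟨0, hn⟩⟩
  have hκ : 0 < min (Real.exp (-μ)) (Real.exp (-d - μ)) := by positivity
  have hspos := hs.pos hκ
  obtain ⟨k, -, hk⟩ := Finset.exists_mem_eq_sup Finset.univ Finset.univ_nonempty
    fun k => Finset.univ.sup fun j => γ k j * s j / s k
  obtain ⟨j, -, hj⟩ := Finset.exists_mem_eq_sup Finset.univ Finset.univ_nonempty
    fun j => γ k j * s j / s k
  have hlt : ((γ k j * s j / s k : ℝ≥0) : ℝ) < min (Real.exp (-μ)) (Real.exp (-d - μ)) := by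
    have hsk : (0 : ℝ) < s k := by exact_mod_cast hspos k
    rw [NNReal.coe_div, div_lt_iff₀ hsk]
    exact (NNReal.coe_le_coe.2 (gain_mul_le_gainOperator γ s k j)).trans_lt (hs.2 k)
  have hmin : min (Real.exp (-μ)) (Real.exp (-d - μ)) =
      Real.exp (-μ) * min 1 (Real.exp (-d)) := by
    rw [mul_min_of_nonneg _ _ (Real.exp_pos _).le, mul_one, ← Real.exp_add]
    ring_nf
  have hmax : (0 : ℝ) < (max (Real.exp d).toNNReal 1 : ℝ≥0) :=
    NNReal.coe_pos.2 (one_pos.trans_le (le_max_right _ _))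
  rw [networkGainCoeff, hk, hj, NNReal.coe_mul]
  calc _ < ((max (Real.exp d).toNNReal 1 : ℝ≥0) : ℝ) *
        (Real.exp (-μ) * min 1 (Real.exp (-d))) := by
          rw [← hmin]
          exact mul_lt_mul_of_pos_left hlt hmax
    _ = Real.exp (-μ) * (min 1 (Real.exp (-d)) *
        ((max (Real.exp d).toNNReal 1 : ℝ≥0) : ℝ)) := by ring
    _ = Real.exp (-μ) := by rw [min_mul_max_exp, mul_one]

theorem isClassKInf_mul {p : ℝ≥0} (hp : 0 < p) : IsClassKInf fun r => p * r :=
  .of_tendsto (by fun_prop) (mul_zero p) (fun _ _ h => mul_lt_mul_of_pos_left h hp)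
    fun C => ⟨C / p, by rw [mul_div_cancel₀ _ hp.ne']⟩

theorem isClassKInf_networkGainT (hs : ∀ i, 0 < s i) (hγ : γ ≠ 0) :
    IsClassKInf (networkGainT γ s d) := by
  obtain ⟨k, hk⟩ := Function.ne_iff.1 hγ
  obtain ⟨j, hj⟩ := Function.ne_iff.1 hk
  have h1 : 0 < γ k j * s j / s k := div_pos (mul_pos (pos_iff_ne_zero.2 hj) (hs j)) (hs k)
  exact isClassKInf_mul (h1.trans_le (gain_le_networkGainCoeff γ s d k j))

theorem isClassK_networkGainU (hs : ∀ i, 0 < s i) (hγu : ∀ i, IsClassK (γu i) ∨ γu i = 0)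
    {k : Fin n} (hk : IsClassK (γu k)) : IsClassK (networkGainU γu s d) := by
  have hmax : 0 < max (Real.exp d).toNNReal 1 := one_pos.trans_le (le_max_right _ _)
  refine ⟨?_, ?_, fun r r' hr => mul_lt_mul_of_pos_left ?_ hmax⟩
  · refine continuous_const.mul (Continuous.finset_sup_apply fun i _ => ?_)
    rcases hγu i with h | h
    · have := h.continuous
      fun_prop
    · rw [h]
      simp only [Pi.zero_apply]
      fun_prop
  · have : (Finset.univ.sup fun i => γu i 0 / s i) = 0 := sup_eq_zero fun i => by
      rcases hγu i with h | h
      · rw [h.map_zero, zero_div]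
      · rw [h, Pi.zero_apply, zero_div]
    rw [networkGainU, this, mul_zero]
  · have hpos : 0 < Finset.univ.sup fun i => γu i r' / s i := by
      have h1 : 0 < γu k r' := by
        rw [← hk.map_zero]
        exact hk.strictMono (zero_le.trans_lt hr)
      exact (div_pos h1 (hs k)).trans_le
        (Finset.le_sup (f := fun i => γu i r' / s i) (Finset.mem_univ k))
    refine (Finset.sup_lt_iff (by rwa [bot_eq_zero])).2 fun i _ => ?_
    rcases hγu i with h | h
    · exact (div_lt_div_of_pos_right (h.strictMono hr) (hs i)).trans_le
        (Finset.le_sup (f := fun i => γu i r' / s i) (Finset.mem_univ i))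
    · rw [h, Pi.zero_apply, zero_div]
      exact hpos

theorem isClassKInf_networkGainU (hs : ∀ i, 0 < s i) (hγu : ∀ i, IsClassK (γu i) ∨ γu i = 0)
    {k : Fin n} (hk : IsClassKInf (γu k)) : IsClassKInf (networkGainU γu s d) := by
  have h := isClassK_networkGainU (d := d) hs hγu hk.toIsClassK
  refine .of_tendsto h.continuous h.map_zero h.strictMono fun C => ?_
  obtain ⟨r, hr⟩ := hk.exists_le (C * s k)
  exact ⟨r, ((le_div_iff₀ (hs k)).2 hr).trans (div_le_networkGainU γu s d k r)⟩

/-! ### The Lyapunov–Razumikhin inequalities of the network -/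

variable {f g : SubsystemMaps θ N M} {c d' : Fin n → ℝ} {c₀ : ℝ}

theorem supV_component_le (hs : ∀ i, 0 < s i) (hc : ∀ i, Continuous (V i))
    (φ : PC θ (Stacked N)) (j : Fin n) :
    supV (V j) (φ.component j) ≤ s j * supV (networkV V s) φ :=
  supV_le fun τ => (le_mul_networkV hs (φ τ) j).trans
    (mul_le_mul_right (le_supV (continuous_networkV hc) φ τ) _)

/-- At impulses, `V(g(φ, v))` is bounded without a lower bound for `V(φ(0))`. -/
theorem networkV_jump_le (hn : 0 < n) (hs : ∀ i, 0 < s i) (hd : ∀ i, d ≤ d' i)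
    (hV : ∀ i, IsSubsystemLyapunovRazumikhin f g V i (c i) (d' i) (γ i) (γu i))
    (φ : PC θ (Stacked N)) (v : Stacked M) :
    (networkV V s (network g φ v) : ℝ) ≤ max (Real.exp (-d) * networkV V s (φ (now θ)))
      (min 1 (Real.exp (-d)) * max (networkGainCoeff γ s d * supV (networkV V s) φ : ℝ)
        (networkGainU γu s d ‖v‖₊)) := by
  have hc := fun i => (hV i).continuous
  have hbd : ∀ i, ((V i (network g φ v i) / s i : ℝ≥0) : ℝ) ≤
      max (Real.exp (-d) * networkV V s (φ (now θ)))
      (min 1 (Real.exp (-d)) * max (networkGainCoeff γ s d * supV (networkV V s) φ : ℝ)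
        (networkGainU γu s d ‖v‖₊)) := by
    intro i
    have hsi : (0 : ℝ) < s i := by exact_mod_cast hs i
    have hcancel : ∀ a : ℝ, min 1 (Real.exp (-d)) *
        (((max (Real.exp d).toNNReal 1 : ℝ≥0) : ℝ) * a) = a := fun a => by
      rw [← mul_assoc, min_mul_max_exp, one_mul]
    have hmin : (0 : ℝ) < min 1 (Real.exp (-d)) := by positivity
    rw [NNReal.coe_div, div_le_iff₀ hsi]
    refine ((hV i).jump φ (v i)).trans (max_le ?_ ?_)
    · refine le_trans ?_ (mul_le_mul_of_nonneg_right (le_max_left _ _) hsi.le)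
      have h1 : (V i (φ (now θ) i) : ℝ) ≤ s i * networkV V s (φ (now θ)) := by
        exact_mod_cast le_mul_networkV hs (φ (now θ)) i
      calc Real.exp (-(d' i)) * V i (φ (now θ) i)
          ≤ Real.exp (-d) * (s i * networkV V s (φ (now θ))) :=
            mul_le_mul (Real.exp_le_exp.2 (neg_le_neg (hd i))) h1 (NNReal.coe_nonneg _)
              (Real.exp_pos _).le
        _ = Real.exp (-d) * networkV V s (φ (now θ)) * s i := by ring
    · refine le_trans ?_ (mul_le_mul_of_nonneg_right (le_max_right _ _) hsi.le)
      rw [mul_max_of_nonneg _ _ hmin.le, max_mul_of_nonneg _ _ hsi.le, NNReal.coe_max]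
      refine max_le_max ?_ ?_
      · rw [networkGainCoeff, NNReal.coe_mul, mul_assoc ((max _ _ : ℝ≥0) : ℝ), hcancel]
        set q := Finset.univ.sup fun k => Finset.univ.sup fun j => γ k j * s j / s k
        have : (Finset.univ.sup fun j => γ i j * supV (V j) (φ.component j))
            ≤ q * supV (networkV V s) φ * s i := by
          refine Finset.sup_le fun j _ => ?_
          calc γ i j * supV (V j) (φ.component j)
              ≤ γ i j * (s j * supV (networkV V s) φ) := by
                gcongr
                exact supV_component_le hs hc φ j
            _ = γ i j * s j / s i * supV (networkV V s) φ * s i := by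
                have := (hs i).ne'
                field_simp
            _ ≤ _ := by
                gcongr
                exact gain_le_sup γ s i j
        exact_mod_cast this
      · rw [networkGainU, NNReal.coe_mul, hcancel]
        have hmono : γu i ‖v i‖₊ ≤ γu i ‖v‖₊ := by
          rcases (hV i).gain_u with h | h
          · exact h.strictMono.monotone (PiLp.nnnorm_apply_le v i)
          · simp [h]
        have : γu i ‖v i‖₊ ≤ (Finset.univ.sup fun i => γu i ‖v‖₊ / s i) * s i := by
          rw [← div_le_iff₀ (hs i)]
          refine le_trans ?_ (Finset.le_sup (f := fun i => γu i ‖v‖₊ / s i) (Finset.mem_univ i))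
          gcongr
        exact_mod_cast this
  obtain ⟨i, hi⟩ := exists_networkV_eq hn V s (network g φ v)
  rw [hi]
  exact hbd i

/-- Where the maximum in `V` is attained, the Razumikhin condition of the network implies that of
the subsystem. -/
theorem subsystem_condition_of_network (hs : ∀ i, 0 < s i)
    (hV : ∀ i, IsSubsystemLyapunovRazumikhin f g V i (c i) (d' i) (γ i) (γu i))
    {φ : PC θ (Stacked N)} {v : Stacked M}
    (h : max (networkGainT γ s d (supV (networkV V s) φ)) (networkGainU γu s d ‖v‖₊)
      ≤ networkV V s (φ (now θ))) {i : Fin n}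
    (hi : V i (φ (now θ) i) / s i = networkV V s (φ (now θ))) :
    max (Finset.univ.sup fun j => γ i j * supV (V j) (φ.component j)) (γu i ‖v i‖₊)
      ≤ V i (φ (now θ) i) := by
  have hVi : V i (φ (now θ) i) = networkV V s (φ (now θ)) * s i := by
    rw [← hi, div_mul_cancel₀ _ (hs i).ne']
  rw [hVi]
  refine max_le (Finset.sup_le fun j _ => ?_) ?_
  · calc γ i j * supV (V j) (φ.component j)
        ≤ γ i j * (s j * supV (networkV V s) φ) := by
          gcongr
          exact supV_component_le hs (fun i => (hV i).continuous) φ j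
      _ = γ i j * s j / s i * supV (networkV V s) φ * s i := by
          have := (hs i).ne'
          field_simp
      _ ≤ networkGainCoeff γ s d * supV (networkV V s) φ * s i := by
          gcongr
          exact gain_le_networkGainCoeff γ s d i j
      _ ≤ networkV V s (φ (now θ)) * s i :=
          mul_le_mul_left ((le_max_left _ _).trans h) _
  · have hmono : γu i ‖v i‖₊ ≤ γu i ‖v‖₊ := by
      rcases (hV i).gain_u with h | h
      · exact h.strictMono.monotone (PiLp.nnnorm_apply_le v i)
      · simp [h]
    rw [← div_le_iff₀ (hs i)]
    calc γu i ‖v i‖₊ / s i ≤ γu i ‖v‖₊ / s i := by gcongr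
      _ ≤ networkGainU γu s d ‖v‖₊ := div_le_networkGainU γu s d i _
      _ ≤ _ := (le_max_right _ _).trans h

/-- Solutions of the impulse-free equation are right-continuous at the initial time. -/
theorem IsSolution.tendsto_right {X U : Type*} [NormedAddCommGroup X] [NormedSpace ℝ X]
    [NormedAddCommGroup U] {F G : PC θ X → U → X} {t : ℝ} {T : EReal} {φ : PC θ X} {u : ℝ → U}
    {x : ℝ → X} (hx : IsSolution F G ∅ t T φ u x) (hT : (t : EReal) < T) :
    Tendsto x (𝓝[>] t) (𝓝 (x t)) := by
  obtain ⟨b, htb, hbT⟩ := EReal.lt_iff_exists_real_btwn.1 hT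
  have htb : t < b := EReal.coe_lt_coe_iff.1 htb
  have h := (hx.solvesOn hbT).continuousOn le_rfl htb.le le_rfl (fun _ _ h => h) t
    ⟨le_rfl, htb.le⟩
  exact h.tendsto.mono_left (nhdsWithin_le_of_mem (Icc_mem_nhdsGT htb))

/-- The decay of `V` along trajectories. Only the indices at which the maximum is attained matter
for the upper right-hand derivative of the maximum. -/
theorem upperRightDeriv_networkV_le (hn : 0 < n) (hs : ∀ i, 0 < s i) (hc₀ : ∀ i, c₀ ≤ c i)
    (hV : ∀ i, IsSubsystemLyapunovRazumikhin f g V i (c i) (d' i) (γ i) (γu i))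
    {φ : PC θ (Stacked N)} {v : Stacked M}
    (h : max (networkGainT γ s d (supV (networkV V s) φ)) (networkGainU γu s d ‖v‖₊)
      ≤ networkV V s (φ (now θ))) {t : ℝ} {T : EReal} {u : ℝ → Stacked M} {x : ℝ → Stacked N}
    (htT : (t : EReal) < T) (hu : IsCadlag u) (hut : u t = v)
    (hx : IsSolution (network f) (network g) ∅ t T φ u x) :
    upperRightDeriv (fun r => (networkV V s (x r) : ℝ)) t
      ≤ ((-c₀ * (networkV V s (φ (now θ)) : ℝ) : ℝ) : EReal) := by
  have hxt : x t = φ (now θ) := by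
    have := hx.initial (now θ)
    simpa [now] using this
  have hright := hx.tendsto_right htT
  refine upperRightDeriv_le_of_eventually fun ε hε => ?_
  set v₀ : ℝ := (networkV V s (φ (now θ)) : ℝ) with hv₀
  have hall : ∀ᶠ r in 𝓝[>] t, ∀ i, ((V i (x r i) / s i : ℝ≥0) : ℝ) ≤
      v₀ + (r - t) * (-c₀ * v₀ + ε) := by
    refine Filter.eventually_all.2 fun i => ?_
    have hsi : (0 : ℝ) < s i := by exact_mod_cast hs i
    rcases (div_le_networkV V s (φ (now θ)) i).eq_or_lt with hi | hi
    · have hD := (hV i).flow φ (v i) (subsystem_condition_of_network hs hV h hi) t T u x htT hu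
        (by rw [hut]) hx
      have hVi : (V i (φ (now θ) i) : ℝ) = v₀ * s i := by
        rw [hv₀, ← hi, NNReal.coe_div, div_mul_cancel₀ _ hsi.ne']
      filter_upwards [eventually_le_of_upperRightDeriv_le hD (mul_pos hε hsi),
        self_mem_nhdsWithin] with r hr hrt
      have hrt : 0 < r - t := sub_pos.2 hrt
      rw [hxt, hVi] at hr
      rw [NNReal.coe_div, div_le_iff₀ hsi]
      refine hr.trans ?_
      have h1 : (r - t) * (v₀ * s i) * c₀ ≤ (r - t) * (v₀ * s i) * c i :=
        mul_le_mul_of_nonneg_left (hc₀ i) (by positivity)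
      nlinarith
    · have hci : Continuous fun y : Stacked N => ((V i (y i) / s i : ℝ≥0) : ℝ) := by
        have := (hV i).continuous
        fun_prop
      have h1 : Tendsto (fun r => ((V i (x r i) / s i : ℝ≥0) : ℝ)) (𝓝[>] t)
          (𝓝 ((V i (x t i) / s i : ℝ≥0) : ℝ)) := (hci.tendsto _).comp hright
      have h2 : Tendsto (fun r => v₀ + (r - t) * (-c₀ * v₀ + ε)) (𝓝[>] t)
          (𝓝 (v₀ + (t - t) * (-c₀ * v₀ + ε))) :=
        (Continuous.tendsto (by fun_prop) t).mono_left nhdsWithin_le_nhds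
      have h3 : ((V i (x t i) / s i : ℝ≥0) : ℝ) < v₀ + (t - t) * (-c₀ * v₀ + ε) := by
        rw [sub_self, zero_mul, add_zero, hxt]
        exact NNReal.coe_lt_coe.2 hi
      exact (h1.eventually_lt h2 h3).mono fun _ h => h.le
  filter_upwards [hall] with r hr
  obtain ⟨i, hi⟩ := exists_networkV_eq hn V s (x r)
  rw [hxt, ← hv₀, hi]
  exact hr i

/-- `V(x) = maxᵢ Vᵢ(xᵢ) / sᵢ` is a Lyapunov–Razumikhin function of the network. -/
theorem isExpLyapunovRazumikhin_networkV (hn : 0 < n) (hs : ∀ i, 0 < s i)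
    (hc₀ : ∀ i, c₀ ≤ c i) (hd : ∀ i, d ≤ d' i)
    (hV : ∀ i, IsSubsystemLyapunovRazumikhin f g V i (c i) (d' i) (γ i) (γu i)) :
    IsExpLyapunovRazumikhin (network f) (network g) (networkV V s) c₀ d
      (networkGainT γ s d) (networkGainU γu s d) where
  continuous := continuous_networkV fun i => (hV i).continuous
  locallyLipschitz := locallyLipschitzOn_networkV hs (fun i => (hV i).continuous)
    (fun i => (hV i).posDef) fun i => (hV i).locallyLipschitz
  bounds := by
    have hc : Continuous (networkV V s) := continuous_networkV fun i => (hV i).continuous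
    have h0 := networkV_eq_zero_iff (V := V) hs fun i => (hV i).posDef
    obtain ⟨ψ₁, hψ₁, h₁⟩ := exists_classKInf_le hc h0
      (tendsto_networkV_atTop hs fun i => (hV i).proper)
    obtain ⟨ψ₂, hψ₂, h₂⟩ := exists_classKInf_ge hc ((h0 0).2 rfl)
    exact ⟨ψ₁, ψ₂, hψ₁, hψ₂, fun x => ⟨h₁ x, h₂ x⟩⟩
  gain_t := by
    rcases eq_or_ne γ 0 with rfl | hγ
    · right
      funext r
      have : (Finset.univ.sup fun k => Finset.univ.sup fun j =>
          (0 : Matrix (Fin n) (Fin n) ℝ≥0) k j * s j / s k) = 0 :=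
        sup_eq_zero fun k => sup_eq_zero fun j => by rw [Matrix.zero_apply, zero_mul, zero_div]
      rw [networkGainT, this, mul_zero, zero_mul, Pi.zero_apply]
    · exact Or.inl (isClassKInf_networkGainT hs hγ)
  gain_u := by
    by_cases h : ∃ k, IsClassK (γu k)
    · obtain ⟨k, hk⟩ := h
      exact Or.inl (isClassK_networkGainU hs (fun i => (hV i).gain_u) hk)
    · right
      push Not at h
      have h0 : ∀ i, γu i = 0 := fun i => (hV i).gain_u.resolve_left (h i)
      funext r
      have : (Finset.univ.sup fun i => γu i r / s i) = 0 := sup_eq_zero fun i => by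
        rw [h0 i, Pi.zero_apply, zero_div]
      rw [networkGainU, this, mul_zero, Pi.zero_apply]
  flow _ _ h _ _ _ _ htT hu hut hx := upperRightDeriv_networkV_le hn hs hc₀ hV h htT hu hut hx
  jump φ v h := by
    have hmax : max (networkGainCoeff γ s d * supV (networkV V s) φ : ℝ)
        (networkGainU γu s d ‖v‖₊) ≤ networkV V s (φ (now θ)) := by exact_mod_cast h
    refine (networkV_jump_le hn hs hd hV φ v).trans (max_le le_rfl ?_)
    exact mul_le_mul (min_le_right _ _) hmax (le_max_of_le_right (NNReal.coe_nonneg _))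
      (Real.exp_pos _).le

end Network

end ImpulsiveNet

theorem mainTheorem4 {n : ℕ} (hn : 0 < n) (θ : ℝ≥0) (N M : Fin n → ℕ)
    (f g : SubsystemMaps θ N M)
    (hf_lip : ∀ i, LipschitzOnBounded (f i))
    (hf_meas : ∀ i, MeasurableAlongPaths (f i))
    (V : ∀ i, EuclideanSpace ℝ (Fin (N i)) → ℝ≥0)
    (c d : Fin n → ℝ) (hd : ∀ i, d i ≠ 0)
    (γ : Matrix (Fin n) (Fin n) ℝ≥0) (γu : Fin n → ℝ≥0 → ℝ≥0)
    (hV : ∀ i, IsSubsystemLyapunovRazumikhin f g V i (c i) (d i) (γ i) (γu i))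
    (μ : ℝ) (hμ : 0 < μ) :
    let c₀ : ℝ := ⨅ i, c i
    let d₀ : ℝ := ⨅ i, d i
    let κ : ℝ := min (Real.exp (-μ)) (Real.exp (-d₀ - μ))
    (SmallGain γ κ ↔ ∃ s, IsDecayVector γ κ s) ∧
    (SmallGain γ κ →
      (∀ s, IsDecayVector γ κ s →
        IsExpLyapunovRazumikhin (network f) (network g) (networkV V s) c₀ d₀
          (networkGainT γ s d₀) (networkGainU γu s d₀) ∧
        ((∀ i, LocallyLipschitz (V i)) → LocallyLipschitz (networkV V s)) ∧
        (γ ≠ 0 → IsClassKInf (networkGainT γ s d₀)) ∧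
        ((∃ i, IsClassKInf (γu i)) → IsClassKInf (networkGainU γu s d₀))) ∧
      ∀ lam : ℝ, 0 < lam →
        UniformlyISS (network f) (network g) (dwellTimeClass c₀ d₀ μ lam)) := by
  intro c₀ d₀ κ
  have hκ : 0 < κ := lt_min (Real.exp_pos _) (Real.exp_pos _)
  have hc₀ : ∀ i, c₀ ≤ c i := fun i => ciInf_le (Set.finite_range c).bddBelow i
  have hd₀ : ∀ i, d₀ ≤ d i := fun i => ciInf_le (Set.finite_range d).bddBelow i
  have hLR : ∀ s, IsDecayVector γ κ s →
      IsExpLyapunovRazumikhin (network f) (network g) (networkV V s) c₀ d₀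
        (networkGainT γ s d₀) (networkGainU γu s d₀) := fun s hs =>
    isExpLyapunovRazumikhin_networkV hn (hs.pos hκ) hc₀ hd₀ hV
  refine ⟨⟨fun h => h.exists_isDecayVector hn hκ, fun ⟨s, hs⟩ => hs.smallGain hκ⟩,
    fun h => ⟨fun s hs => ⟨hLR s hs, locallyLipschitz_networkV,
      isClassKInf_networkGainT (hs.pos hκ), fun ⟨i, hi⟩ =>
      isClassKInf_networkGainU (hs.pos hκ) (fun i => (hV i).gain_u) hi⟩, fun lam hlam => ?_⟩⟩
  obtain ⟨s, hs⟩ := h.exists_isDecayVector hn hκ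
  exact uniformlyISS_of_lyapunovRazumikhin (lipschitzOnBoundedSets_network hf_lip)
    (measurableAlong_network hf_meas) (hLR s hs)
    (networkV_jump_le hn (hs.pos hκ) hd₀ hV) hμ hlam (networkGainCoeff_lt hn hs)
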